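/- **Setting.** Let $(V,+)$ be a countably infinite, not necessarily commutative, group with identity $O$ and a finite generating set $S$ with $S=-S$, $O\notin S$. Its Cayley graph $G$ has an edge between $g$ and $g+h$ for all $g\in V$, $h\in S$. Let $d$ be the graph distance (so $d(x,y)=|{-x}+y|$ with $|x|:=d(O,x)$), $W_r(y)=\{x:d(y,x)\le r\}$, $W_r=W_r(O)$, $W_\infty=V$, $w_n=|W_n|$, and $\partial A=\{x\in A:\ x \text{ has a neighbour outside } A\}$. $G$ is *$b$-amenable* if $|\partial W_n|/|W_n|\to0$, and has *polynomial growth* if $w_n=O(n^{d_2})$ for some $d_2>0$. A subset $\mu\subset V$ (a spin configuration, an element of $\{0,1\}^V$ with the product $\sigma$-algebra) is translated by $y\in V$ to $y+\mu=\{y+z:z\in\mu\}$. **Spin models.** A *spin model* $\mathcal P$ is a random subset of $V$ that is stationary ($y+\mathcal P\stackrel d=\mathcal P$ for all $y$) and non-degenerate ($0<\mathbb P(O\in\mathcal P)<1$). It is *clustering* if there are constants $C_k$, $c_k>0$ and a function $\phi$ on $[0,\infty)$ which is non-increasing, $\phi\le1$, $s^m\phi(s)\to0$ as $s\to\infty$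 for all $m\ge1$, such that for all $p,q\ge1$ and all distinct $x_1,\dots,x_{p+q}\in V$, with $s=\min_{i\le p<j}d(x_i,x_j)$, $$\bigl|\mathbb P(\{x_1,\dots,x_{p+q}\}\subset\mathcal P)-\mathbb P(\{x_1,\dots,x_p\}\subset\mathcal P)\,\mathbb P(\{x_{p+1},\dots,x_{p+q}\}\subset\mathcal P)\bigr|\le C_{p+q}\,\phi(c_{p+q}s).$$ The function $\phi$ is *summable* if $\sum_{x\in V}\phi(c|x|)^{1/p}<\infty$ for all $c>0$ and integers $p\ge1$. $\mathcal P$ is *exponentially clustering* if these can be chosen with $\inf_kc_k>0$, $C_k=O(k^{ak})$ for some $a\in[0,1)$, and $\limsup_{t\to\infty}t^{-b}\log\phi(t)<0$ for some $b\in(0,\infty)$ (with $\log0=-\infty$). **Score functions.** A *score function* assigns to $x\in V$ and $\mu\subset V$ a real number $\xi(x,\mu)$, measurable in $\mu$, with $\xi(y+x,y+\mu)=\xi(x,\mu)$ for all $y$, and $\xi(x,\mu)=0$ if $x\notin\mu$. It is *local* if for some integer $r>0$ the value $\xi(O,\mu)$ is a function of $\mu\cap W_r$. Its *radius of stabilisation*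 $R(O,\mu)\in\{1,2,\dots\}\cup\{\infty\}$ is the infimum of the integers $r>0$ such that $\xi(O,\mu')=\xi(O,\mu)$ whenever $\mu'\cap W_r=\mu\cap W_r$, and $R(x,\mu)=R(O,-x+\mu)$. Write $\mathcal P_n=\mathcal P\cap W_n$ for $1\le n\le\infty$. $\xi$ is *exponentially quasi-local* on $\mathcal P$ if there are $A>0$, $c\in(0,\infty)$ and a non-increasing function $\varphi$ on $(0,\infty)$ with $\varphi(t)\to0$ as $t\to\infty$, such that $\sup_{1\le n\le\infty}\sup_{x\in W_n}\mathbb P(R(x,\mathcal P_n)\ge t)\le A\varphi(t)$ for all $t>0$ and $\limsup_{t\to\infty}t^{-c}\log\varphi(t)<0$. It satisfies the *exponential growth condition* if for some $\kappa\ge0$ and $c_*\in\mathbb R$, $|\xi(O,\mu\cap W_t)|\le e^{c_*t^\kappa}$ for all integers $t\ge1$ and all $\mu\subset V$. The pair $(\xi,\mathcal P)$ satisfies the *$p$-moment condition* if $\sup_{1\le n\le\infty}\sup_{x\in W_n}\mathbb E\bigl[\max\{|\xi(x,\mathcal P_n)|,1\}^p\bigr]<\infty$. Put $H_n^\xi=\sum_{x\in\mathcal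 P_n}\xi(x,\mathcal P_n)$. **Theorem (CLT for exponentially quasi-local statistics of clustering spin models).** Let $G$, $\mathcal P$ and the score function $\xi$ satisfy one of the following two conditions: 1. $G$ is $b$-amenable, $\mathcal P$ is a clustering spin model with summable $\phi$, and $\xi$ is local. 2. $G$ has polynomial growth, $\mathcal P$ is an exponentially clustering spin model, and $\xi$ is exponentially quasi-local on $\mathcal P$ and satisfies the exponential growth condition and the $p$-moment condition for all real $p\ge1$. If for some $\nu>0$ one has $\mathrm{Var}(H_n^\xi)=\Omega(w_n^\nu)$, that is, $\mathrm{Var}(H_n^\xi)\ge\epsilon\,w_n^\nu$ for some $\epsilon>0$ and all large $n$, then as $n\to\infty$ $$\frac{H_n^\xi-\mathbb E H_n^\xi}{\sqrt{\mathrm{Var}(H_n^\xi)}}\ \stackrel{d}{\Rightarrow}\ N(0,1).$$ -/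

import Mathlib

open Filter Topology MeasureTheory ProbabilityTheory Asymptotics
open scoped ENNReal

noncomputable section

namespace SpinCLT

variable {V : Type*} [AddGroup V] {Ω : Type*} [MeasurableSpace Ω]

/-! ## Cayley graphs

The group is written additively but is not assumed to be commutative.  The Cayley graph
`SimpleGraph.addCayley S` has an edge between `g` and `g + h` for `h ∈ S`, `h ≠ 0`. -/

/-- `S` is a finite symmetric generating set of `V` that does not contain the identity. -/
structure IsGeneratingSet (S : Finset V) : Prop where
  symm : ∀ h ∈ S, -h ∈ S
  zero_notMem : (0 : V) ∉ S
  generates : AddSubgroup.closure (S : Set V) = ⊤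

/-- The Cayley graph of `V` with respect to `S`. -/
def cayley (S : Finset V) : SimpleGraph V := SimpleGraph.addCayley (S : Set V)

/-- The graph distance `d(x, y) = |-x + y|`. -/
def gdist (S : Finset V) (x y : V) : ℕ := (cayley S).dist x y

/-- The closed ball `W_n(y)`; for `n = ∞` it is the whole (connected) graph. -/
def ball (S : Finset V) (n : ℕ∞) (y : V) : Set V := {x | (cayley S).edist y x ≤ n}

/-- The volume `w_n = |W_n|` of the ball of radius `n` around the identity. -/
def vol (S : Finset V) (n : ℕ) : ℕ := (ball S n 0).ncard

/-- The inner vertex boundary of a set of vertices. -/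
def innerBoundary (S : Finset V) (A : Set V) : Set V := {x ∈ A | ∃ y ∉ A, (cayley S).Adj x y}

/-- `b`-amenability: `|∂W_n| / |W_n| → 0`. -/
def IsBAmenable (S : Finset V) : Prop :=
  Tendsto (fun n : ℕ => ((innerBoundary S (ball S n 0)).ncard : ℝ) / (ball S n 0).ncard)
    atTop (𝓝 0)

/-- Polynomial growth: `|W_n| = O(n ^ d₂)` for some `d₂ > 0`. -/
def HasPolynomialGrowth (S : Finset V) : Prop :=
  ∃ d₂ : ℝ, 0 < d₂ ∧ (fun n : ℕ => (vol S n : ℝ)) =O[atTop] fun n : ℕ => (n : ℝ) ^ d₂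

/-- The distance `min {d(x, y) : x ∈ A, y ∈ B}` between two nonempty finite sets. -/
def setDist (S : Finset V) (A B : Finset V) : ℕ :=
  sInf {k : ℕ | ∃ x ∈ A, ∃ y ∈ B, k = gdist S x y}

/-! ## Spin models

A spin configuration is a subset of `V`, i.e. an element of `{0, 1} ^ V`; the instance on `Set V`
is the product σ-algebra. -/

/-- Translation of a spin configuration by `y`, an automorphism of the Cayley graph. -/
def translate (y : V) (μ : Set V) : Set V := (fun z => y + z) '' μ

/-- A stationary and non-degenerate spin model. -/
structure IsSpinModel (Pr : Measure Ω) (P : Ω → Set V) : Prop where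
  measurable : Measurable P
  stationary : ∀ y : V, IdentDistrib (fun ω => translate y (P ω)) P Pr Pr
  pos : 0 < Pr {ω | (0 : V) ∈ P ω}
  lt_one : Pr {ω | (0 : V) ∈ P ω} < 1

/-- Fast decreasing functions on `[0, ∞)`. -/
structure IsFastDecreasing (φ : ℝ → ℝ) : Prop where
  le_one : ∀ s, 0 ≤ s → φ s ≤ 1
  antitone : AntitoneOn φ (Set.Ici 0)
  decay : ∀ m : ℕ, 1 ≤ m → Tendsto (fun s : ℝ => s ^ m * φ s) atTop (𝓝 0)

/-- `P` is a clustering spin model with clustering function `φ` and clustering constants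
`C k`, `c k`. The distinct points `x₁, …, x_p` and `x_{p+1}, …, x_{p+q}` are the elements of the
disjoint nonempty sets `A` and `B`. -/
structure IsClusteringWith (S : Finset V) (Pr : Measure Ω) (P : Ω → Set V)
    (φ : ℝ → ℝ) (C c : ℕ → ℝ) : Prop where
  spinModel : IsSpinModel Pr P
  fastDecreasing : IsFastDecreasing φ
  c_pos : ∀ k, 0 < c k
  clustering : ∀ A B : Finset V, A.Nonempty → B.Nonempty → Disjoint A B →
    |Pr.real {ω | (A : Set V) ∪ (B : Set V) ⊆ P ω}
        - Pr.real {ω | (A : Set V) ⊆ P ω} * Pr.real {ω | (B : Set V) ⊆ P ω}|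
      ≤ C (A.card + B.card) * φ (c (A.card + B.card) * setDist S A B)

/-- `φ` is summable in the Cayley graph: `∑_x φ(c|x|) ^ (1/p) < ∞` for all `c > 0`, `p ≥ 1`. -/
def IsSummableIn (S : Finset V) (φ : ℝ → ℝ) : Prop :=
  ∀ c : ℝ, 0 < c → ∀ p : ℕ, 1 ≤ p →
    Summable fun x : V => φ (c * gdist S 0 x) ^ (1 / (p : ℝ))

/-- `P` is a clustering spin model with a summable clustering function. -/
def IsSummablyClustering (S : Finset V) (Pr : Measure Ω) (P : Ω → Set V) : Prop :=
  ∃ (φ : ℝ → ℝ) (C c : ℕ → ℝ), IsClusteringWith S Pr P φ C c ∧ IsSummableIn S φ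

/-- `limsup_{t → ∞} log φ(t) / t ^ b < 0`, where `log 0 = -∞`. -/
def HasStretchedExpDecay (φ : ℝ → ℝ) (b : ℝ) : Prop :=
  limsup (fun t : ℝ => ENNReal.log (ENNReal.ofReal (φ t)) / ((t ^ b : ℝ) : EReal)) atTop < 0

/-- Exponentially clustering spin models: the `c k` are bounded below by a positive constant,
`C k = O(k ^ (a k))` with `a ∈ [0, 1)`, and `limsup log φ(t) / t ^ b < 0` with `b ∈ (0, ∞)`. -/
def IsExpClustering (S : Finset V) (Pr : Measure Ω) (P : Ω → Set V) : Prop :=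
  ∃ (φ : ℝ → ℝ) (C c : ℕ → ℝ), IsClusteringWith S Pr P φ C c ∧
    (∃ c₀ : ℝ, 0 < c₀ ∧ ∀ k, c₀ ≤ c k) ∧
    (∃ a : ℝ, 0 ≤ a ∧ a < 1 ∧ C =O[atTop] fun k : ℕ => (k : ℝ) ^ (a * k)) ∧
    ∃ b : ℝ, 0 < b ∧ HasStretchedExpDecay φ b

/-! ## Score functions -/

/-- A score function of spin models: measurable, translation invariant, and vanishing at the
points that do not belong to the configuration. -/
structure IsScoreFunction (ξ : V → Set V → ℝ) : Prop where
  measurable : ∀ x, Measurable (ξ x)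
  translation_invariant : ∀ (y x : V) (μ : Set V), ξ (y + x) (translate y μ) = ξ x μ
  eq_zero : ∀ (x : V) (μ : Set V), x ∉ μ → ξ x μ = 0

/-- Local score functions: `ξ(O, μ)` is a function of `μ ∩ W_r` for some `r > 0`. -/
def IsLocal (S : Finset V) (ξ : V → Set V → ℝ) : Prop :=
  ∃ r : ℕ, 0 < r ∧ ∃ ξ₀ : Set V → ℝ, ∀ μ : Set V, ξ 0 μ = ξ₀ (μ ∩ ball S r 0)

/-- The radius of stabilisation at the identity: the infimum of all `r > 0` such that
`ξ(O, μ') = ξ(O, μ)` for every `μ'` which agrees with `μ` on `W_r` (`∞` if there is none). -/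
def stabRadiusZero (S : Finset V) (ξ : V → Set V → ℝ) (μ : Set V) : ℕ∞ :=
  sInf {k : ℕ∞ | ∃ r : ℕ, 0 < r ∧ k = r ∧
    ∀ μ' : Set V, μ' ∩ ball S r 0 = μ ∩ ball S r 0 → ξ 0 μ = ξ 0 μ'}

/-- The radius of stabilisation at `x`. -/
def stabRadius (S : Finset V) (ξ : V → Set V → ℝ) (x : V) (μ : Set V) : ℕ∞ :=
  stabRadiusZero S ξ (translate (-x) μ)

/-- `ξ` is exponentially quasi-local on `P`: it is stabilising,
`sup_{1 ≤ n ≤ ∞} sup_{x ∈ W_n} Pr(R(x, P ∩ W_n) ≥ t) ≤ A φ(t)` with `φ(t) ↓ 0`, and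
`limsup log φ(t) / t ^ c < 0` for some `c ∈ (0, ∞)`. -/
def IsExpQuasiLocal (S : Finset V) (Pr : Measure Ω) (P : Ω → Set V) (ξ : V → Set V → ℝ) : Prop :=
  ∃ (A : ℝ) (φ : ℝ → ℝ), 0 < A ∧ AntitoneOn φ (Set.Ioi 0) ∧ Tendsto φ atTop (𝓝 0) ∧
    (∀ t : ℝ, 0 < t → ∀ n : ℕ∞, 1 ≤ n → ∀ x ∈ ball S n 0,
      Pr.real {ω | ENNReal.ofReal t ≤ (stabRadius S ξ x (P ω ∩ ball S n 0) : ℝ≥0∞)} ≤ A * φ t) ∧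
    ∃ c : ℝ, 0 < c ∧ HasStretchedExpDecay φ c

/-- Exponential growth condition: `|ξ(O, μ ∩ W_t)| ≤ exp(c_* t ^ κ)` for all `μ` and all
radii `t = 1, 2, …`. -/
def HasExpGrowth (S : Finset V) (ξ : V → Set V → ℝ) : Prop :=
  ∃ κ cstar : ℝ, 0 ≤ κ ∧ ∀ t : ℕ, 0 < t → ∀ μ : Set V,
    |ξ 0 (μ ∩ ball S t 0)| ≤ Real.exp (cstar * (t : ℝ) ^ κ)

/-- The `p`-moment condition:
`sup_{1 ≤ n ≤ ∞} sup_{x ∈ W_n} 𝔼[max(|ξ(x, P ∩ W_n)|, 1) ^ p] < ∞`. -/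
def HasMomentCondition (S : Finset V) (Pr : Measure Ω) (P : Ω → Set V) (ξ : V → Set V → ℝ)
    (p : ℝ) : Prop :=
  (⨆ (n : ℕ∞) (_ : 1 ≤ n) (x ∈ ball S n 0),
    ∫⁻ ω, ENNReal.ofReal (max |ξ x (P ω ∩ ball S n 0)| 1 ^ p) ∂Pr) < ∞

/-- The total mass `H_n(μ) = ∑_{x ∈ μ ∩ W_n} ξ(x, μ ∩ W_n)`, a finite sum. -/
def totalMass (S : Finset V) (ξ : V → Set V → ℝ) (n : ℕ) (μ : Set V) : ℝ :=
  ∑ᶠ x ∈ μ ∩ ball S n 0, ξ x (μ ∩ ball S n 0)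

end SpinCLT

end

/-! The proof is by cumulants. The `k`-th cumulant of a sum is the sum, over all `k`-tuples of
summands, of their joint cumulants, and a joint cumulant is small as soon as the points split into
two groups whose mixed moments almost factorise. Given a tuple, let `D` be the largest distance from
`x 0` to another of its points. The distances from `x 0` leave a gap of length at least `D / k`
(`exists_gap`), so the joint cumulant is at most a constant times `ψ (D / k)`. With `p = k - 1` this
is at most the product of `ψ (d(x 0, x i) / k) ^ (1 / p)` over the `p` other points, and the sum
over tuples factorises. Hence the `k`-th cumulant of `H_n` is `O(w_n)`
(`exists_abs_cumulant_sum_le`).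

As the variance is at least of order `w_n ^ ν`, the `k`-th cumulant of the standardised variable is
`O(w_n ^ (1 - ν k / 2))`, which vanishes in the limit for `k > 2 / ν`. For small `ν` the lower
orders are not controlled by this bound; they are handled by Janson's theorem
(`tendsto_cumulant_gauss`). After a rescaling that bounds the low cumulants, a limit of the moment
sequences has the exponential of a polynomial as generating function. The Cauchy-Schwarz inequality
`|E e^{zX}|² ≤ E e^{2 Re(z) X}` survives in the limit and forces the polynomial to have degree at
most two, as in Marcinkiewicz' theorem. All this happens at the level of moment sequences, without a
limiting random variable.

It remains to see that mixed moments of scores cluster. A function of the spins in a finite set `U`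
is a combination of products of spins whose coefficients sum in absolute value to at most `3 ^ |U|`
times its bound (`exists_spin_expansion`), so it inherits the clustering of the model; this settles
local scores. A quasi-local score is first set to zero where its radius of stabilisation exceeds
`t`, an event decided by the spins in the ball of radius `t` (`truncScore`). With `t` a small power
of the distance `s`, the size of the truncated score, the factor `3 ^ |U|` and the clustering
constants together are an exponential of a polynomial in `t`, absorbed by `exp (-δ s ^ b)`, while
the truncation error is controlled by moments and by the tail of the radius. The resulting rate is a
stretched exponential, summable under polynomial growth. -/

noncomputable section

namespace SpinCLT

section

open scoped Nat

/-! ## Cumulants of moment sequences -/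

/-- The moments with prescribed cumulants. -/
def momentSeq (κ : ℕ → ℝ) : ℕ → ℝ
  | 0 => 1
  | j + 1 => ∑ i : Fin (j + 1), (j.choose i : ℝ) * κ (i + 1) * momentSeq κ (j - i)
  decreasing_by omega

/-- The cumulants of a sequence of moments. -/
def cumulant (m : ℕ → ℝ) : ℕ → ℝ
  | 0 => 0
  | j + 1 => m (j + 1) - ∑ i : Fin j, (j.choose i : ℝ) * cumulant m (i + 1) * m (j - i)
  decreasing_by omega

theorem momentSeq_zero (κ : ℕ → ℝ) : momentSeq κ 0 = 1 := by rw [momentSeq]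

theorem momentSeq_succ (κ : ℕ → ℝ) (j : ℕ) : momentSeq κ (j + 1) =
    ∑ i ∈ Finset.range (j + 1), (j.choose i : ℝ) * κ (i + 1) * momentSeq κ (j - i) := by
  rw [momentSeq, Finset.sum_range (fun i => (j.choose i : ℝ) * κ (i + 1) * momentSeq κ (j - i))]

theorem cumulant_succ (m : ℕ → ℝ) (j : ℕ) : cumulant m (j + 1) =
    m (j + 1) - ∑ i ∈ Finset.range j, (j.choose i : ℝ) * cumulant m (i + 1) * m (j - i) := by
  rw [cumulant, Finset.sum_range (fun i => (j.choose i : ℝ) * cumulant m (i + 1) * m (j - i))]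

theorem moment_succ_eq {m : ℕ → ℝ} (h0 : m 0 = 1) (j : ℕ) : m (j + 1) =
    ∑ i ∈ Finset.range (j + 1), (j.choose i : ℝ) * cumulant m (i + 1) * m (j - i) := by
  rw [Finset.sum_range_succ, cumulant_succ]
  simp [h0]

theorem momentSeq_cumulant {m : ℕ → ℝ} (h0 : m 0 = 1) : momentSeq (cumulant m) = m := by
  funext j
  induction j using Nat.strong_induction_on with
  | _ j ih =>
    cases j with
    | zero => rw [momentSeq_zero, h0]
    | succ j =>
      rw [momentSeq_succ, moment_succ_eq h0]
      refine Finset.sum_congr rfl fun i _ => ?_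
      rw [ih _ (by omega)]

/-- Homogeneity serves three normalisations: by the standard deviation, by the scale in Janson's
theorem, and by the number of summands when sums over tuples become averages. -/
theorem cumulant_smul (m : ℕ → ℝ) (c : ℝ) (j : ℕ) :
    cumulant (fun i => c ^ i * m i) j = c ^ j * cumulant m j := by
  induction j using Nat.strong_induction_on with
  | _ j ih =>
    cases j with
    | zero => simp [cumulant]
    | succ j =>
      rw [cumulant_succ, cumulant_succ, mul_sub, Finset.mul_sum]
      congr 1
      refine Finset.sum_congr rfl fun i hi => ?_
      rw [Finset.mem_range] at hi
      rw [ih _ (by omega)]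
      have : c ^ (j + 1) = c ^ (i + 1) * c ^ (j - i) := by
        rw [← pow_add]; congr 1; omega
      rw [this]; ring

/-- Each moment is a polynomial in finitely many cumulants. The filter is arbitrary because the
statement is applied along ultrafilters as well as along `atTop`. -/
theorem tendsto_momentSeq {ι : Type*} {l : Filter ι} {κ : ι → ℕ → ℝ} {lam : ℕ → ℝ}
    (h : ∀ j, 1 ≤ j → Tendsto (fun n => κ n j) l (𝓝 (lam j))) (j : ℕ) :
    Tendsto (fun n => momentSeq (κ n) j) l (𝓝 (momentSeq lam j)) := by
  induction j using Nat.strong_induction_on with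
  | _ j ih =>
    cases j with
    | zero => simp only [momentSeq_zero]; exact tendsto_const_nhds
    | succ j =>
      simp only [momentSeq_succ]
      refine tendsto_finsetSum _ fun i _ => ?_
      exact (tendsto_const_nhds.mul (h _ (by omega))).mul (ih _ (by omega))

/-! ## The exponential generating function of the moments -/

/-- The exponential generating function of the cumulants of order less than `K`. -/
def cumulantFun (K : ℕ) (lam : ℕ → ℝ) (z : ℂ) : ℂ :=
  ∑ j ∈ Finset.range K, (lam (j + 1) : ℂ) * z ^ (j + 1) / (j + 1)!

theorem hasDerivAt_cumulantFun (K : ℕ) (lam : ℕ → ℝ) (z : ℂ) :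
    HasDerivAt (cumulantFun K lam)
      (∑ j ∈ Finset.range K, (lam (j + 1) : ℂ) * z ^ j / j !) z := by
  unfold cumulantFun
  refine HasDerivAt.fun_sum fun j _ => ?_
  refine (((hasDerivAt_pow (j + 1) z).const_mul (lam (j + 1) : ℂ)).div_const
    ((j + 1)! : ℂ)).congr_deriv ?_
  have : (j ! : ℂ) ≠ 0 := by exact_mod_cast Nat.factorial_ne_zero j
  have h2 : ((j : ℂ) + 1) ≠ 0 := by exact_mod_cast Nat.succ_ne_zero j
  rw [Nat.factorial_succ]
  push_cast
  field_simp

theorem iteratedDeriv_poly_zero (K : ℕ) (lam : ℕ → ℝ) (i : ℕ) :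
    iteratedDeriv i (fun z : ℂ => ∑ j ∈ Finset.range K, (lam (j + 1) : ℂ) * z ^ j / j !) 0 =
      if i < K then (lam (i + 1) : ℂ) else 0 := by
  rw [iteratedDeriv_fun_sum (fun j _ => by fun_prop)]
  have : ∀ j ∈ Finset.range K, iteratedDeriv i (fun z : ℂ => (lam (j + 1) : ℂ) * z ^ j / j !) 0
      = if i = j then (lam (j + 1) : ℂ) else 0 := by
    intro j _
    have h0 : (j ! : ℂ) ≠ 0 := by exact_mod_cast Nat.factorial_ne_zero j
    have : (fun z : ℂ => (lam (j + 1) : ℂ) * z ^ j / j !)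
        = fun z : ℂ => ((lam (j + 1) : ℂ) / j !) * z ^ j := by funext z; ring
    rw [this, iteratedDeriv_const_mul_field, iteratedDeriv_fun_pow_zero]
    split_ifs <;> simp [h0]
  rw [Finset.sum_congr rfl this]
  simp

/-- If `E = exp k` then `E' = k' E`, and the Leibniz rule for the derivatives of `k' E` at zero is
exactly the recursion `momentSeq_succ`. -/
theorem iteratedDeriv_exp_cumulantFun (K : ℕ) {lam : ℕ → ℝ} (hlam : ∀ j, K < j → lam j = 0)
    (i : ℕ) : iteratedDeriv i (fun z => Complex.exp (cumulantFun K lam z)) 0 =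
      (momentSeq lam i : ℂ) := by
  induction i using Nat.strong_induction_on with
  | _ i ih =>
    cases i with
    | zero => simp [cumulantFun, momentSeq_zero]
    | succ i =>
      have hd : deriv (fun z => Complex.exp (cumulantFun K lam z)) =
          fun z => (∑ j ∈ Finset.range K, (lam (j + 1) : ℂ) * z ^ j / j !)
            * Complex.exp (cumulantFun K lam z) := by
        funext z
        rw [((hasDerivAt_cumulantFun K lam z).cexp).deriv, mul_comm]
      rw [iteratedDeriv_succ', hd, iteratedDeriv_fun_mul (by fun_prop)
        (by unfold cumulantFun; fun_prop), momentSeq_succ]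
      push_cast
      refine Finset.sum_congr rfl fun j hj => ?_
      rw [iteratedDeriv_poly_zero, ih _ (by omega)]
      split_ifs with h
      · rfl
      · rw [hlam (j + 1) (by omega)]; simp

theorem hasSum_momentSeq (K : ℕ) {lam : ℕ → ℝ} (hlam : ∀ j, K < j → lam j = 0) (z : ℂ) :
    HasSum (fun j => (momentSeq lam j : ℂ) * z ^ j / j !) (Complex.exp (cumulantFun K lam z)) := by
  have hf : Differentiable ℂ (fun z => Complex.exp (cumulantFun K lam z)) := by
    intro z
    exact ((hasDerivAt_cumulantFun K lam z).cexp).differentiableAt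
  refine (Complex.hasSum_taylorSeries_of_entire hf 0 z).congr_fun fun j => ?_
  rw [iteratedDeriv_exp_cumulantFun K hlam, sub_zero, smul_eq_mul, smul_eq_mul]
  ring

theorem summable_momentSeq (K : ℕ) {lam : ℕ → ℝ} (hlam : ∀ j, K < j → lam j = 0) (r : ℝ) :
    Summable fun j => |momentSeq lam j| * |r| ^ j / j ! := by
  refine (hasSum_momentSeq K hlam (r : ℂ)).summable.norm.congr fun j => ?_
  simp

/-! ## Positivity -/

/-- On each antidiagonal the binomial theorem collapses the double series to the simple one at `z +
w`. The rearrangement is legitimate because the series of norms collapses likewise, to the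
absolutely convergent series at `‖z‖ + ‖w‖`. -/
theorem hasSum_double_momentSeq (K : ℕ) {lam : ℕ → ℝ} (hlam : ∀ j, K < j → lam j = 0) (z w : ℂ) :
    HasSum (fun p : ℕ × ℕ => (momentSeq lam (p.1 + p.2) : ℂ) * (z ^ p.1 / p.1 !) * (w ^ p.2 / p.2 !))
      (Complex.exp (cumulantFun K lam (z + w))) := by
  have binom : ∀ (R : Type) [Field R] [CharZero R] (z w : R) (n : ℕ),
      ∑ p ∈ Finset.HasAntidiagonal.antidiagonal n, (z ^ p.1 / p.1 !) * (w ^ p.2 / p.2 !) = (z + w) ^ n / n ! := by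
    intro R _ _ z w n
    rw [(Commute.all z w).add_pow', Finset.sum_div]
    refine Finset.sum_congr rfl fun p hp => ?_
    rw [Finset.HasAntidiagonal.mem_antidiagonal] at hp
    have hc := Nat.choose_mul_factorial_mul_factorial (n := n) (k := p.1) (by omega)
    rw [show n - p.1 = p.2 by omega] at hc
    have hc' : ((n.choose p.1 : ℕ) : R) * (p.1 ! : R) * (p.2 ! : R) = (n ! : R) := by
      exact_mod_cast hc
    have h1 : (p.1 ! : R) ≠ 0 := by exact_mod_cast Nat.factorial_ne_zero _
    have h2 : (p.2 ! : R) ≠ 0 := by exact_mod_cast Nat.factorial_ne_zero _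
    have h3 : (n ! : R) ≠ 0 := by exact_mod_cast Nat.factorial_ne_zero _
    rw [nsmul_eq_mul]
    field_simp
    rw [← hc']
    ring
  have hsum : Summable (fun p : ℕ × ℕ =>
      (momentSeq lam (p.1 + p.2) : ℂ) * (z ^ p.1 / p.1 !) * (w ^ p.2 / p.2 !)) := by
    rw [← Finset.HasAntidiagonal.sigmaAntidiagonalEquivProd.summable_iff]
    refine Summable.of_norm ?_
    rw [summable_sigma_of_nonneg (fun _ => norm_nonneg _)]
    refine ⟨fun n => (hasSum_fintype _).summable, ?_⟩
    refine (summable_momentSeq K hlam (‖z‖ + ‖w‖)).congr fun n => ?_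
    rw [tsum_fintype, Finset.univ_eq_attach, abs_of_nonneg (by positivity : 0 ≤ ‖z‖ + ‖w‖),
      mul_div_assoc, ← binom ℝ, Finset.mul_sum]
    rw [← Finset.sum_attach]
    refine Finset.sum_congr rfl fun p _ => ?_
    have := Finset.HasAntidiagonal.mem_antidiagonal.1 p.2
    simp [Finset.HasAntidiagonal.sigmaAntidiagonalEquivProd, this, mul_assoc]
  have h1 := Finset.HasAntidiagonal.sigmaAntidiagonalEquivProd.hasSum_iff.2 hsum.hasSum
  have h2 := h1.sigma fun n => hasSum_fintype _
  have h3 : HasSum _ _ := hasSum_momentSeq K hlam (z + w)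
  have : (fun n => (momentSeq lam n : ℂ) * (z + w) ^ n / n !) = fun n =>
      ∑ p : Finset.HasAntidiagonal.antidiagonal n, ((fun p : ℕ × ℕ => (momentSeq lam (p.1 + p.2) : ℂ)
        * (z ^ p.1 / p.1 !) * (w ^ p.2 / p.2 !)) ∘ Finset.HasAntidiagonal.sigmaAntidiagonalEquivProd) ⟨n, p⟩ := by
    funext n
    rw [Finset.univ_eq_attach, mul_div_assoc, ← binom ℂ, Finset.mul_sum, ← Finset.sum_attach]
    refine Finset.sum_congr rfl fun p _ => ?_
    have := Finset.HasAntidiagonal.mem_antidiagonal.1 p.2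
    simp [Finset.HasAntidiagonal.sigmaAntidiagonalEquivProd, this, mul_assoc]
  rw [this] at h3
  rw [h3.unique h2]
  exact hsum.hasSum

/-- The Cauchy-Schwarz inequality for the limit of sequences of moments. -/
theorem re_cumulantFun_le (K : ℕ) {lam : ℕ → ℝ} (hlam : ∀ j, K < j → lam j = 0)
    (hpos : ∀ (N : ℕ) (a : ℕ → ℂ), ‖∑ j ∈ Finset.range N, a j * momentSeq lam j‖ ^ 2 ≤
      (∑ i ∈ Finset.range N, ∑ j ∈ Finset.range N,
        a i * (starRingEnd ℂ) (a j) * momentSeq lam (i + j)).re) (z : ℂ) :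
    2 * (cumulantFun K lam z).re ≤ (cumulantFun K lam (2 * z.re : ℝ)).re := by
  have h1 := ((hasSum_momentSeq K hlam z).tendsto_sum_nat.norm).pow 2
  have h2 := (hasSum_double_momentSeq K hlam z ((starRingEnd ℂ) z)).comp
    (tendsto_atTop_finset_of_monotone
      (f := fun N : ℕ => Finset.range N ×ˢ Finset.range N)
      (fun a b hab => Finset.product_subset_product (Finset.range_mono hab)
        (Finset.range_mono hab))
      (fun p => ⟨p.1 + p.2 + 1, by simp⟩))
  have h3 := (Complex.continuous_re.tendsto _).comp h2
  -- With `a j = z ^ j / j !` the positivity hypothesis tends to the analogue of `|E e^{zX}|² ≤ E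
  -- |e^{zX}|² = E e^{(z + conj z) X}`.
  have h4 := le_of_tendsto_of_tendsto' h1 h3 fun N => by
    refine le_of_eq_of_le ?_ ((hpos N fun j => z ^ j / j !).trans_eq ?_)
    · congr 3
      ext j; ring
    · simp only [Function.comp_apply, Finset.sum_product]
      congr 1
      refine Finset.sum_congr rfl fun i _ => Finset.sum_congr rfl fun j _ => ?_
      simp only [map_div₀, map_pow, Complex.conj_natCast]
      ring
  rw [Complex.norm_exp, ← Real.exp_nat_mul, Complex.add_conj] at h4
  have h5 : ∀ r : ℝ, (Complex.exp (cumulantFun K lam (r : ℂ))).re =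
      Real.exp (cumulantFun K lam (r : ℂ)).re := by
    intro r
    have : cumulantFun K lam (r : ℂ) = ((∑ j ∈ Finset.range K, lam (j + 1) * r ^ (j + 1) / (j + 1)! : ℝ) : ℂ) := by
      unfold cumulantFun
      push_cast
      rfl
    rw [this, ← Complex.ofReal_exp, Complex.ofReal_re, Complex.ofReal_re]
  rw [h5, Real.exp_le_exp] at h4
  exact_mod_cast h4

/-! ### Marcinkiewicz' theorem -/

theorem leadingCoeff_nonneg_of_nonneg {d : ℕ} {c : ℕ → ℝ}
    (h : ∀ r : ℝ, 0 < r → 0 ≤ ∑ j ∈ Finset.range (d + 1), c j * r ^ j) : 0 ≤ c d := by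
  -- This is the polynomial divided by `r ^ d`, written in `s = 1 / r`; letting `s` decrease to `0`
  -- isolates the leading coefficient.
  have hcont : Continuous fun s : ℝ => ∑ j ∈ Finset.range (d + 1), c j * s ^ (d - j) := by
    fun_prop
  have h0 : ∑ j ∈ Finset.range (d + 1), c j * (0 : ℝ) ^ (d - j) = c d := by
    rw [Finset.sum_range_succ, Finset.sum_eq_zero, zero_add, Nat.sub_self, pow_zero, mul_one]
    intro j hj
    rw [Finset.mem_range] at hj
    rw [zero_pow (by omega), mul_zero]
  rw [← h0]
  refine ge_of_tendsto (x := 𝓝[>] (0 : ℝ)) ((hcont.tendsto 0).mono_left nhdsWithin_le_nhds) ?_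
  filter_upwards [self_mem_nhdsWithin] with s hs
  have hs : 0 < s := hs
  have : ∑ j ∈ Finset.range (d + 1), c j * s ^ (d - j) =
      s ^ d * ∑ j ∈ Finset.range (d + 1), c j * (s⁻¹) ^ j := by
    rw [Finset.mul_sum]
    refine Finset.sum_congr rfl fun j hj => ?_
    rw [Finset.mem_range] at hj
    rw [pow_sub₀ _ hs.ne' (by omega), inv_pow]; ring
  rw [this]
  exact mul_nonneg (by positivity) (h _ (by positivity))

/-- A version of Marcinkiewicz' theorem on exponentials of polynomials. -/
theorem eq_zero_of_re_cumulantFun_le (K : ℕ) {lam : ℕ → ℝ} (hlam : ∀ j, K < j → lam j = 0)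
    (h : ∀ z : ℂ, 2 * (cumulantFun K lam z).re ≤ (cumulantFun K lam (2 * z.re : ℝ)).re)
    (j : ℕ) (hj : 3 ≤ j) : lam j = 0 := by
  by_contra hne
  have hjK : j ≤ K := by by_contra hc; exact hne (hlam j (by omega))
  set d := Nat.findGreatest (fun i => lam i ≠ 0) K with hd
  have hdj : j ≤ d := Nat.le_findGreatest hjK hne
  have hd0 : lam d ≠ 0 := Nat.findGreatest_spec (P := fun i => lam i ≠ 0) hjK hne
  have hdK : d ≤ K := Nat.findGreatest_le K
  have hgt : ∀ i, d < i → lam i = 0 := by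
    intro i hi
    by_contra hc
    rcases le_or_gt i K with h' | h'
    · exact absurd (Nat.le_findGreatest (P := fun i => lam i ≠ 0) h' hc) (by omega)
    · exact hc (hlam i h')
  clear_value d
  obtain ⟨e, rfl⟩ : ∃ e, d = e + 1 := ⟨d - 1, by omega⟩
  have hK : ∀ z, cumulantFun K lam z = cumulantFun (e + 1) lam z := by
    intro z
    unfold cumulantFun
    symm
    refine Finset.sum_subset (Finset.range_mono hdK) fun i _ hi => ?_
    rw [Finset.mem_range] at hi
    rw [hgt (i + 1) (by omega)]; simp
  -- On the ray `z = r w` the hypothesis says that a polynomial in `r` is nonnegative; only its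
  -- leading coefficient is kept. Directions `w` giving incompatible signs are then exhibited.
  have key : ∀ w : ℂ, 0 ≤ lam (e + 1) * ((2 * w.re) ^ (e + 1) - 2 * (w ^ (e + 1)).re) := by
    intro w
    have := leadingCoeff_nonneg_of_nonneg (d := e + 1)
      (c := fun j => if j = 0 then 0 else lam j / j ! * ((2 * w.re) ^ j - 2 * (w ^ j).re)) ?_
    · simp only [Nat.add_eq_zero_iff, one_ne_zero, and_false, if_false] at this
      have hf : (0 : ℝ) < (e + 1)! := by exact_mod_cast Nat.factorial_pos _
      rw [div_mul_eq_mul_div] at this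
      by_contra hc
      exact absurd this (not_le.2 (div_neg_of_neg_of_pos (not_le.1 hc) hf))
    · intro r hr
      have hz := h (r * w)
      rw [hK, hK] at hz
      rw [Finset.sum_range_succ']
      simp only [if_true, zero_mul, add_zero, Nat.add_eq_zero_iff, one_ne_zero, and_false, if_false]
      unfold cumulantFun at hz
      rw [Complex.re_sum, Complex.re_sum, Finset.mul_sum, ← sub_nonneg, ← Finset.sum_sub_distrib] at hz
      refine hz.trans_eq (Finset.sum_congr rfl fun i _ => ?_)
      have e1 : ((lam (i + 1) : ℂ) * ((2 * ((r : ℂ) * w).re : ℝ) : ℂ) ^ (i + 1) / ((i + 1)! : ℂ)).re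
          = lam (i + 1) * (2 * (r * w.re)) ^ (i + 1) / (i + 1)! := by
        rw [Complex.re_ofReal_mul]
        exact_mod_cast Complex.ofReal_re _
      have e2 : ((lam (i + 1) : ℂ) * ((r : ℂ) * w) ^ (i + 1) / ((i + 1)! : ℂ)).re
          = lam (i + 1) * r ^ (i + 1) / (i + 1)! * (w ^ (i + 1)).re := by
        rw [← Complex.re_ofReal_mul, mul_pow]
        congr 1
        push_cast
        ring
      rw [e1, e2, mul_left_comm 2 r, mul_pow]
      ring
  -- Since the degree is at least three, `2 ^ (e + 1) - 2 > 0`, so the direction `1` makes the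
  -- leading cumulant positive.
  have h1 := key 1
  have h2 : 0 ≤ lam (e + 1) := by
    have h3 : (4 : ℝ) ≤ 2 ^ (e + 1) := by
      calc (4 : ℝ) = 2 ^ 2 := by norm_num
        _ ≤ 2 ^ (e + 1) := pow_le_pow_right₀ (by norm_num) (by omega)
    simp only [Complex.one_re, mul_one, one_pow] at h1
    exact nonneg_of_mul_nonneg_left h1 (by linarith)
  have h2' : 0 < lam (e + 1) := lt_of_le_of_ne h2 (Ne.symm hd0)
  rcases Nat.even_or_odd (e + 1) with he | he
  -- For even degree, a root of unity close to the imaginary axis makes the bracket in `key` at most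
  -- `1 - 2 < 0`.
  · have hw : ∃ w : ℂ, w ^ (e + 1) = 1 ∧ |2 * w.re| ≤ 1 := by
      obtain ⟨q, hq⟩ := he
      -- The angle `2 π k / (e + 1)` lies in `[π / 3, π / 2]`; the bound `e + 1 ≤ 6 k` uses that the
      -- degree is even and at least four.
      set k := (e + 1) / 4 with hk
      have hk1 : 4 * k ≤ e + 1 := by omega
      have hk2 : e + 1 ≤ 6 * k := by omega
      have hk1' : (4 : ℝ) * k ≤ e + 1 := by exact_mod_cast hk1
      have hk2' : (e + 1 : ℝ) ≤ 6 * k := by exact_mod_cast hk2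
      have he0 : (0 : ℝ) < e + 1 := by positivity
      have hpi := Real.pi_pos
      refine ⟨Complex.exp ((2 * Real.pi * k / (e + 1) : ℝ) * Complex.I), ?_, ?_⟩
      · rw [← Complex.exp_nat_mul, Complex.exp_eq_one_iff]
        refine ⟨k, ?_⟩
        have : (e + 1 : ℂ) ≠ 0 := by exact_mod_cast Nat.succ_ne_zero e
        push_cast
        field_simp
      · rw [Complex.exp_ofReal_mul_I_re]
        have b1 : 2 * Real.pi * k / (e + 1) ≤ Real.pi / 2 := by
          rw [div_le_iff₀ he0]; nlinarith
        have b2 : Real.pi / 3 ≤ 2 * Real.pi * k / (e + 1) := by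
          rw [le_div_iff₀ he0]; nlinarith
        have c1 : 0 ≤ Real.cos (2 * Real.pi * k / (e + 1)) :=
          Real.cos_nonneg_of_mem_Icc ⟨by linarith, b1⟩
        have c2 : Real.cos (2 * Real.pi * k / (e + 1)) ≤ 1 / 2 := by
          rw [← Real.cos_pi_div_three]
          exact Real.cos_le_cos_of_nonneg_of_le_pi (by positivity) (by linarith) b2
        rw [abs_le]; constructor <;> linarith
    obtain ⟨w, hw1, hw2⟩ := hw
    have h3 := key w
    rw [hw1, Complex.one_re] at h3
    have h4 : (2 * w.re) ^ (e + 1) ≤ 1 := by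
      calc (2 * w.re) ^ (e + 1) ≤ |(2 * w.re) ^ (e + 1)| := le_abs_self _
        _ = |2 * w.re| ^ (e + 1) := abs_pow _ _
        _ ≤ 1 := pow_le_one₀ (abs_nonneg _) hw2
    nlinarith
  -- For odd degree the direction `-1` reverses the sign of the bracket at `1`.
  · have h3 := key (-1)
    simp only [Complex.neg_re, Complex.one_re, mul_neg, mul_one, he.neg_pow, one_pow] at h1 h3 
    have h4 : (4 : ℝ) ≤ 2 ^ (e + 1) := by
      calc (4 : ℝ) = 2 ^ 2 := by norm_num
        _ ≤ 2 ^ (e + 1) := pow_le_pow_right₀ (by norm_num) (by omega)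
    nlinarith

/-! ### Positive moment sequences and Janson's theorem -/

/-- The cumulants of the standard normal distribution. -/
def gaussCumulant (j : ℕ) : ℝ := if j = 2 then 1 else 0

/-- The Cauchy-Schwarz inequality for moments of complex polynomials. -/
def IsPositiveMoments (m : ℕ → ℝ) : Prop :=
  ∀ (N : ℕ) (a : ℕ → ℂ), ‖∑ j ∈ Finset.range N, a j * m j‖ ^ 2 ≤
    (∑ i ∈ Finset.range N, ∑ j ∈ Finset.range N, a i * (starRingEnd ℂ) (a j) * m (i + j)).re

theorem IsPositiveMoments.smul {m : ℕ → ℝ} (hm : IsPositiveMoments m) (c : ℝ) :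
    IsPositiveMoments fun i => c ^ i * m i := by
  intro N a
  refine le_of_eq_of_le ?_ ((hm N (fun j => a j * c ^ j)).trans_eq ?_)
  · congr 3
    ext j
    push_cast; ring
  · congr 1
    refine Finset.sum_congr rfl fun i _ => Finset.sum_congr rfl fun j _ => ?_
    push_cast
    simp only [map_mul, map_pow, Complex.conj_ofReal]
    ring

theorem IsPositiveMoments.of_tendsto {ι : Type*} {l : Filter ι} [l.NeBot] {m : ι → ℕ → ℝ}
    {μ : ℕ → ℝ} (hm : ∀ᶠ n in l, IsPositiveMoments (m n))
    (h : ∀ j, Tendsto (fun n => m n j) l (𝓝 (μ j))) : IsPositiveMoments μ := by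
  intro N a
  have hc : ∀ j, Tendsto (fun n => (m n j : ℂ)) l (𝓝 (μ j : ℂ)) :=
    fun j => (Complex.continuous_ofReal.tendsto _).comp (h j)
  refine le_of_tendsto_of_tendsto (b := l) ?_ ?_ (hm.mono fun n hn => hn N a)
  · exact (tendsto_finsetSum _ fun j _ => tendsto_const_nhds.mul (hc j)).norm.pow 2
  · exact (Complex.continuous_re.tendsto _).comp (tendsto_finsetSum _ fun i _ =>
      tendsto_finsetSum _ fun j _ => tendsto_const_nhds.mul (hc _))

/-- Janson's theorem: if the cumulants of high order of standardised random variables vanish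
asymptotically, then all moments converge to those of the standard normal distribution. -/
theorem tendsto_cumulant_gauss {ι : Type*} {l : Filter ι} {m : ι → ℕ → ℝ}
    (h0 : ∀ n, m n 0 = 1) (h1 : ∀ᶠ n in l, m n 1 = 0) (h2 : ∀ᶠ n in l, m n 2 = 1)
    (hpos : ∀ᶠ n in l, IsPositiveMoments (m n)) (K : ℕ)
    (hκ : ∀ j, K < j → Tendsto (fun n => cumulant (m n) j) l (𝓝 0)) (j : ℕ) (hj : 1 ≤ j) :
    Tendsto (fun n => cumulant (m n) j) l (𝓝 (gaussCumulant j)) := by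
  wlog hK : 2 ≤ K generalizing K
  · exact this 2 (fun i hi => hκ i (by omega)) le_rfl
  -- Along an ultrafilter every bounded sequence converges and every finite alternative is decided,
  -- so no subsequences need to be extracted.
  rw [tendsto_iff_ultrafilter]
  intro U hU
  have h1 := hU h1
  have h2 := hU h2
  replace hpos := Filter.Eventually.filter_mono hU hpos
  replace hκ := fun j hj => (hκ j hj).mono_left hU
  have hne : (Finset.Icc 2 K).Nonempty := ⟨2, by simp [hK]⟩
  have hκ1 : ∀ᶠ n in (U : Filter ι), cumulant (m n) 1 = 0 := by
    filter_upwards [h1] with n hn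
    rw [cumulant_succ]; simpa using hn
  have hκ2 : ∀ᶠ n in (U : Filter ι), cumulant (m n) 2 = 1 := by
    filter_upwards [h1, h2] with n hn hn2
    rw [cumulant_succ]; simp [hn, hn2]
  -- The smallest scale for which all rescaled cumulants of orders `2, …, K` lie in `[-1, 1]`: at
  -- least one of them then has absolute value one. As the variance is one, `c n ≥ 1`, so the
  -- rescaled cumulants of higher order still vanish in the limit.
  set c : ι → ℝ := fun n => (Finset.Icc 2 K).sup' hne
    fun j => |cumulant (m n) j| ^ (1 / (j : ℝ)) with hc
  have hc1 : ∀ᶠ n in (U : Filter ι), 1 ≤ c n := by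
    filter_upwards [hκ2] with n hn
    refine le_trans ?_ (Finset.le_sup' _ (by simp [hK] : 2 ∈ Finset.Icc 2 K))
    rw [hn]; simp
  set κ : ι → ℕ → ℝ := fun n j => (c n)⁻¹ ^ j * cumulant (m n) j with hκdef
  have hb : ∀ j, 2 ≤ j → j ≤ K → ∀ᶠ n in (U : Filter ι), κ n j ∈ Set.Icc (-1 : ℝ) 1 := by
    intro j hj2 hjK
    filter_upwards [hc1] with n hn
    have hcn : 0 < c n := by linarith
    rw [Set.mem_Icc, ← abs_le, hκdef]
    simp only
    rw [abs_mul, abs_of_nonneg (by positivity), inv_pow, inv_mul_le_iff₀ (by positivity), mul_one]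
    have : |cumulant (m n) j| ^ (1 / (j : ℝ)) ≤ c n :=
      Finset.le_sup' (fun j : ℕ => |cumulant (m n) j| ^ (1 / (j : ℝ))) (by simp; omega)
    calc |cumulant (m n) j| = (|cumulant (m n) j| ^ (1 / (j : ℝ))) ^ j := by
          rw [one_div, Real.rpow_inv_natCast_pow (abs_nonneg _) (by omega)]
      _ ≤ c n ^ j := pow_le_pow_left₀ (by positivity) this j
  have hlarge : ∀ j, K < j → Tendsto (fun n => κ n j) U (𝓝 0) := by
    intro j hj
    refine squeeze_zero_norm' ?_ (by simpa using (hκ j hj).norm)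
    filter_upwards [hc1] with n hn
    have hcn : 0 < c n := by linarith
    rw [hκdef, norm_mul, norm_pow, norm_inv, Real.norm_of_nonneg hcn.le]
    exact mul_le_of_le_one_left (norm_nonneg _) (pow_le_one₀ (by positivity) (inv_le_one_of_one_le₀ hn))
  have hlim : ∀ j, ∃ a, (1 ≤ j → Tendsto (fun n => κ n j) U (𝓝 a)) ∧ (K < j → a = 0) := by
    intro j
    rcases le_or_gt j K with hjK | hjK
    · rcases le_or_gt 2 j with hj2 | hj2
      · obtain ⟨a, _, ha⟩ := isCompact_Icc.ultrafilter_le_nhds' (U.map fun n => κ n j)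
          (hb j hj2 hjK)
        exact ⟨a, fun _ => ha, fun h => absurd h (by omega)⟩
      · refine ⟨0, fun h => ?_, fun _ => rfl⟩
        obtain rfl : j = 1 := by omega
        refine tendsto_const_nhds.congr' ?_
        filter_upwards [hκ1] with n hn
        simp [hκdef, hn]
    · exact ⟨0, fun _ => hlarge j hjK, fun _ => rfl⟩
  choose lam hlam hlam0 using hlim
  have hcum : ∀ n, cumulant (fun i => (c n)⁻¹ ^ i * m n i) = κ n := fun n => by
    funext j; rw [cumulant_smul]
  have hmom : ∀ j, Tendsto (fun n => (c n)⁻¹ ^ j * m n j) U (𝓝 (momentSeq lam j)) := by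
    intro j
    refine (tendsto_momentSeq (κ := κ) (l := U) hlam j).congr fun n => ?_
    rw [← hcum, momentSeq_cumulant (by simp [h0])]
  have hlam3 : ∀ j, 3 ≤ j → lam j = 0 :=
    eq_zero_of_re_cumulantFun_le K hlam0 (re_cumulantFun_le K hlam0
      (IsPositiveMoments.of_tendsto (l := (U : Filter ι)) (hpos.mono fun n hn => hn.smul (c n)⁻¹) hmom))
  -- The order attaining the maximum depends on `n`, but the ultrafilter selects a single one. Its
  -- limit is nonzero, and `hlam3` then leaves only order two.
  have hatt : ∃ j ∈ Finset.Icc 2 K, ∀ᶠ n in (U : Filter ι), |κ n j| = 1 := by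
    have : ∀ᶠ n in (U : Filter ι), ∃ j ∈ Finset.Icc 2 K, |κ n j| = 1 := by
      filter_upwards [hc1] with n hn
      have hcn : 0 < c n := by linarith
      obtain ⟨j, hj, hj'⟩ := Finset.exists_mem_eq_sup' hne
        (fun j : ℕ => |cumulant (m n) j| ^ (1 / (j : ℝ)))
      refine ⟨j, hj, ?_⟩
      have hj2 : j ≠ 0 := by have := (Finset.mem_Icc.1 hj).1; omega
      have hcj : c n = |cumulant (m n) j| ^ (1 / (j : ℝ)) := hj'
      have : c n ^ j = |cumulant (m n) j| := by
        rw [hcj, one_div, Real.rpow_inv_natCast_pow (abs_nonneg _) hj2]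
      rw [hκdef]
      simp only
      rw [abs_mul, abs_of_nonneg (by positivity), ← this, ← mul_pow, inv_mul_cancel₀ hcn.ne', one_pow]
    have h' : (⋃ j ∈ (Finset.Icc 2 K : Set ℕ), {n | |κ n j| = 1}) ∈ U := by
      filter_upwards [this] with n hn
      simpa using hn
    obtain ⟨j, hj, hj'⟩ := (Ultrafilter.finite_biUnion_mem_iff (Finset.finite_toSet _)).1 h'
    exact ⟨j, hj, hj'⟩
  obtain ⟨j₀, hj₀, hj₀'⟩ := hatt
  rw [Finset.mem_Icc] at hj₀
  have habs : |lam j₀| = 1 := by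
    refine tendsto_nhds_unique ((hlam j₀ (by omega)).abs) (tendsto_const_nhds.congr' ?_)
    filter_upwards [hj₀'] with n hn using hn.symm
  have hj₀2 : j₀ = 2 := by
    by_contra hc
    rw [hlam3 j₀ (by omega)] at habs
    simp at habs
  subst hj₀2
  -- The rescaled variance is `(c n)⁻¹ ^ 2` and its limit has absolute value one. Hence `c` tends to
  -- `1`, and the cumulants have the same limits before and after rescaling.
  have hci : Tendsto (fun n => (c n)⁻¹ ^ 2) U (𝓝 (lam 2)) := by
    refine (hlam 2 (by omega)).congr' ?_
    filter_upwards [hκ2] with n hn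
    simp [hκdef, hn]
  have hlam2 : lam 2 = 1 := by
    rw [← habs, abs_of_nonneg]
    exact ge_of_tendsto' hci fun n => sq_nonneg _
  have hcinv : Tendsto (fun n => (c n)⁻¹) U (𝓝 1) := by
    rw [hlam2] at hci
    have := (Real.continuous_sqrt.tendsto _).comp hci
    rw [Real.sqrt_one] at this
    refine this.congr' ?_
    filter_upwards [hc1] with n hn
    have : 0 ≤ (c n)⁻¹ := by positivity
    simp only [Function.comp_apply]
    exact Real.sqrt_sq this
  have hct : Tendsto c U (𝓝 1) := by
    have := hcinv.inv₀ one_ne_zero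
    simpa using this
  have hfin : Tendsto (fun n => cumulant (m n) j) U (𝓝 (lam j)) := by
    have := (hct.pow j).mul (hlam j hj)
    rw [one_pow, one_mul] at this
    refine this.congr' ?_
    filter_upwards [hc1] with n hn
    have hcn : c n ≠ 0 := by linarith
    simp only [hκdef]
    rw [← mul_assoc, ← mul_pow, mul_inv_cancel₀ hcn, one_pow, one_mul]
  have : lam j = gaussCumulant j := by
    unfold gaussCumulant
    split_ifs with h
    · rw [h, hlam2]
    · rcases Nat.lt_or_ge j 3 with h3 | h3
      · obtain rfl : j = 1 := by omega
        refine tendsto_nhds_unique hfin (tendsto_const_nhds.congr' ?_)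
        filter_upwards [hκ1] with n hn using hn.symm
      · exact hlam3 j h3
  rw [← this]
  exact hfin

/-! ### From moments to convergence in distribution -/

theorem norm_exp_sub_sum_le {c : ℂ} (hc : c.re = 0) (n : ℕ) :
    ‖Complex.exp c - ∑ j ∈ Finset.range n, c ^ j / (j ! : ℂ)‖ ≤ ‖c‖ ^ n / (n ! : ℝ) := by
  suffices h : ∀ (n : ℕ) (s : ℝ), 0 ≤ s →
      ‖Complex.exp (c * s) - ∑ j ∈ Finset.range n, (c * s) ^ j / (j ! : ℂ)‖ ≤ ‖c‖ ^ n * s ^ n / (n ! : ℝ) by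
    simpa using h n 1 zero_le_one
  intro n
  induction n with
  | zero =>
    intro s _
    simp [Complex.norm_exp, hc]
  | succ n ih =>
    intro s hs
    -- Along the ray through `c`, the derivative of a Taylor remainder is `c` times the remainder of
    -- one order less, so the bound propagates by comparing derivatives.
    have hder : ∀ x : ℝ, HasDerivAt (fun s : ℝ => Complex.exp (c * s)
        - ∑ j ∈ Finset.range (n + 1), (c * s) ^ j / j !)
        (c * (Complex.exp (c * x) - ∑ j ∈ Finset.range n, (c * x) ^ j / j !)) x := by
      intro x
      have hx : HasDerivAt (fun s : ℝ => c * (s : ℂ)) c x := by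
        simpa using (Complex.ofRealCLM.hasDerivAt (x := x)).const_mul c
      have h1 := hx.cexp
      have h2 : HasDerivAt (fun s : ℝ => ∑ j ∈ Finset.range (n + 1), (c * (s : ℂ)) ^ j / (j ! : ℂ))
          (∑ j ∈ Finset.range (n + 1), (j * (c * (x : ℂ)) ^ (j - 1) * c) / (j ! : ℂ)) x :=
        HasDerivAt.fun_sum fun j _ => (hx.pow j).div_const _
      refine (h1.sub h2).congr_deriv ?_
      rw [Finset.sum_range_succ', mul_sub, mul_comm (Complex.exp _), Finset.mul_sum]
      congr 1
      simp only [Nat.cast_zero, zero_mul, zero_div, add_zero]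
      refine Finset.sum_congr rfl fun j _ => ?_
      have h0 : (j ! : ℂ) ≠ 0 := by exact_mod_cast Nat.factorial_ne_zero j
      have h2 : ((j : ℂ) + 1) ≠ 0 := by exact_mod_cast Nat.succ_ne_zero j
      rw [Nat.factorial_succ, Nat.add_sub_cancel]
      push_cast
      field_simp
    have hB : ∀ x : ℝ, HasDerivAt (fun s : ℝ => ‖c‖ ^ (n + 1) * s ^ (n + 1) / (n + 1)!)
        (‖c‖ ^ (n + 1) * x ^ n / n !) x := by
      intro x
      refine (((hasDerivAt_pow (n + 1) x).const_mul _).div_const _).congr_deriv ?_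
      have h0 : (n ! : ℝ) ≠ 0 := by exact_mod_cast Nat.factorial_ne_zero n
      rw [Nat.factorial_succ, Nat.add_sub_cancel]
      push_cast
      field_simp
    refine image_norm_le_of_norm_deriv_right_le_deriv_boundary (a := 0) (b := s)
      (fun x _ => (hder x).continuousAt.continuousWithinAt) (fun x _ => (hder x).hasDerivWithinAt)
      (by simp [Finset.sum_range_succ']) hB (fun x hx => ?_) (Set.right_mem_Icc.2 hs)
    rw [norm_mul, pow_succ', mul_assoc, mul_div_assoc]
    exact mul_le_mul_of_nonneg_left (ih x hx.1) (norm_nonneg _)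

section

variable {Ω : Type*} [MeasurableSpace Ω] {Pr : Measure Ω} [IsProbabilityMeasure Pr]

theorem sq_integral_le {f : Ω → ℝ} (hf : Integrable f Pr) (hf2 : Integrable (fun ω => f ω ^ 2) Pr) :
    (∫ ω, f ω ∂Pr) ^ 2 ≤ ∫ ω, f ω ^ 2 ∂Pr := by
  set c := ∫ ω, f ω ∂Pr with hc
  have h : 0 ≤ ∫ ω, (f ω ^ 2 - 2 * c * f ω + c ^ 2) ∂Pr :=
    integral_nonneg fun ω => by
      show 0 ≤ f ω ^ 2 - 2 * c * f ω + c ^ 2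
      nlinarith [sq_nonneg (f ω - c)]
  have hf' : Integrable (fun ω => 2 * c * f ω) Pr := hf.const_mul _
  have hf'' : Integrable (fun ω => f ω ^ 2 - 2 * c * f ω) Pr := hf2.sub hf'
  rw [integral_add hf'' (integrable_const _), integral_sub hf2 hf', integral_const_mul, ← hc] at h
  simp at h
  nlinarith

/-- For the polynomial `q` with coefficients `a`, the two sides are `|E q(X)|²` and `E |q(X)|²`. -/
theorem isPositiveMoments_integral {X : Ω → ℝ}
    (hX : ∀ j : ℕ, Integrable (fun ω => X ω ^ j) Pr) :
    IsPositiveMoments fun j => ∫ ω, X ω ^ j ∂Pr := by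
  intro N a
  have hXc : ∀ (z : ℂ) (j : ℕ), Integrable (fun ω => z * ((X ω ^ j : ℝ) : ℂ)) Pr :=
    fun z j => ((hX j).ofReal).const_mul z
  have hq : Integrable (fun ω => ∑ j ∈ Finset.range N, a j * ((X ω ^ j : ℝ) : ℂ)) Pr :=
    integrable_finsetSum _ fun j _ => hXc _ j
  have h1 : ∑ j ∈ Finset.range N, a j * ((∫ ω, X ω ^ j ∂Pr : ℝ) : ℂ)
      = ∫ ω, ∑ j ∈ Finset.range N, a j * ((X ω ^ j : ℝ) : ℂ) ∂Pr := by
    rw [integral_finsetSum _ fun j _ => hXc _ j]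
    refine Finset.sum_congr rfl fun j _ => ?_
    rw [integral_const_mul, integral_complex_ofReal]
  have h2 : ∀ ω, ‖∑ j ∈ Finset.range N, a j * ((X ω ^ j : ℝ) : ℂ)‖ ^ 2 =
      (∑ i ∈ Finset.range N, ∑ j ∈ Finset.range N,
        a i * (starRingEnd ℂ) (a j) * ((X ω ^ (i + j) : ℝ) : ℂ)).re := by
    intro ω
    rw [← Complex.normSq_eq_norm_sq, ← Complex.ofReal_re (Complex.normSq _), ← Complex.mul_conj,
      map_sum, Finset.sum_mul_sum]
    congr 1
    refine Finset.sum_congr rfl fun i _ => Finset.sum_congr rfl fun j _ => ?_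
    rw [map_mul, Complex.conj_ofReal, pow_add]
    push_cast
    ring
  have hdd : Integrable (fun ω => ∑ i ∈ Finset.range N, ∑ j ∈ Finset.range N,
      a i * (starRingEnd ℂ) (a j) * ((X ω ^ (i + j) : ℝ) : ℂ)) Pr :=
    integrable_finsetSum _ fun i _ => integrable_finsetSum _ fun j _ => hXc _ _
  have h3 : (∑ i ∈ Finset.range N, ∑ j ∈ Finset.range N,
      a i * (starRingEnd ℂ) (a j) * ((∫ ω, X ω ^ (i + j) ∂Pr : ℝ) : ℂ)).re =
      ∫ ω, ‖∑ j ∈ Finset.range N, a j * ((X ω ^ j : ℝ) : ℂ)‖ ^ 2 ∂Pr := by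
    simp only [h2]
    have hre : ∫ ω, (∑ i ∈ Finset.range N, ∑ j ∈ Finset.range N,
      a i * (starRingEnd ℂ) (a j) * ((X ω ^ (i + j) : ℝ) : ℂ)).re ∂Pr = _ := integral_re hdd
    rw [hre]
    congr 1
    rw [integral_finsetSum _ fun i _ => integrable_finsetSum _ fun j _ => hXc _ _]
    refine Finset.sum_congr rfl fun i _ => ?_
    rw [integral_finsetSum _ fun j _ => hXc _ _]
    refine Finset.sum_congr rfl fun j _ => ?_
    rw [integral_const_mul, integral_complex_ofReal]
  rw [h1, h3]
  refine (pow_le_pow_left₀ (norm_nonneg _) (norm_integral_le_integral_norm _) 2).trans ?_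
  refine sq_integral_le hq.norm ?_
  refine hdd.re.congr (Eventually.of_forall fun ω => ?_)
  exact (h2 ω).symm

/-- The expansion stops at an even order so that the remainder is bounded by a moment and no
absolute moment occurs. -/
theorem norm_charFun_sub_sum_le {X : Ω → ℝ} (hXm : AEMeasurable X Pr)
    (hX : ∀ j : ℕ, Integrable (fun ω => X ω ^ j) Pr) (t : ℝ) (N : ℕ) :
    ‖charFun (Pr.map X) t - ∑ j ∈ Finset.range (2 * N),
      ((∫ ω, X ω ^ j ∂Pr : ℝ) : ℂ) * (t * Complex.I) ^ j / (j ! : ℂ)‖ ≤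
      (∫ ω, X ω ^ (2 * N) ∂Pr) * |t| ^ (2 * N) / (2 * N)! := by
  have hXc : ∀ (j : ℕ), Integrable (fun ω => (t * X ω * Complex.I) ^ j / (j ! : ℂ)) Pr := by
    intro j
    refine (((hX j).ofReal (𝕜 := ℂ)).const_mul ((t * Complex.I) ^ j / (j ! : ℂ))).congr
      (Eventually.of_forall fun ω => ?_)
    simp only [Complex.coe_algebraMap]
    push_cast
    ring
  have hexp : Integrable (fun ω => Complex.exp (t * X ω * Complex.I)) Pr := by
    refine Integrable.of_bound (C := 1) ?_ (Eventually.of_forall fun ω => ?_)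
    · have : Measurable fun x : ℝ => Complex.exp (t * x * Complex.I) := by fun_prop
      exact (this.comp_aemeasurable hXm).aestronglyMeasurable
    · rw [← Complex.ofReal_mul, Complex.norm_exp_ofReal_mul_I]
  have h1 : charFun (Pr.map X) t - ∑ j ∈ Finset.range (2 * N),
      ((∫ ω, X ω ^ j ∂Pr : ℝ) : ℂ) * (t * Complex.I) ^ j / j ! =
      ∫ ω, (Complex.exp (t * X ω * Complex.I)
        - ∑ j ∈ Finset.range (2 * N), (t * X ω * Complex.I) ^ j / j !) ∂Pr := by
    rw [integral_sub hexp (integrable_finsetSum _ fun j _ => hXc j),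
      integral_finsetSum _ fun j _ => hXc j, charFun_apply_real, integral_map hXm (by fun_prop)]
    congr 1
    refine Finset.sum_congr rfl fun j _ => ?_
    rw [← integral_complex_ofReal, mul_div_assoc, ← integral_mul_const]
    congr 1
    funext ω
    push_cast
    ring
  rw [h1]
  refine (norm_integral_le_of_norm_le (((hX (2 * N)).mul_const (|t| ^ (2 * N))).div_const
    ((2 * N)! : ℝ)) (Eventually.of_forall fun ω => ?_)).trans_eq ?_
  · refine (norm_exp_sub_sum_le (by simp) (2 * N)).trans_eq ?_
    congr 1
    rw [norm_mul, norm_mul, Complex.norm_I, Complex.norm_real, Complex.norm_real, mul_one, mul_pow,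
      mul_comm, Real.norm_eq_abs, Real.norm_eq_abs]
    congr 1
    rw [pow_mul, sq_abs, ← pow_mul]
  · rw [integral_div, integral_mul_const]

theorem tendsto_charFun_of_cumulants {X : ℕ → Ω → ℝ} (hXm : ∀ n, AEMeasurable (X n) Pr)
    (hX : ∀ᶠ n in atTop, ∀ j : ℕ, Integrable (fun ω => X n ω ^ j) Pr)
    (hκ : ∀ j, 1 ≤ j → Tendsto (fun n => cumulant (fun i => ∫ ω, X n ω ^ i ∂Pr) j) atTop
      (𝓝 (gaussCumulant j))) (t : ℝ) :
    Tendsto (fun n => charFun (Pr.map (X n)) t) atTop (𝓝 (Complex.exp (-(t ^ 2 / 2 : ℝ)))) := by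
  have hg : ∀ j, 2 < j → gaussCumulant j = 0 := fun j hj => by
    unfold gaussCumulant; rw [if_neg (by omega)]
  have hm : ∀ j, Tendsto (fun n => ∫ ω, X n ω ^ j ∂Pr) atTop (𝓝 (momentSeq gaussCumulant j)) := by
    intro j
    refine (tendsto_momentSeq hκ j).congr fun n => ?_
    rw [momentSeq_cumulant (by simp)]
  have hlim : cumulantFun 2 gaussCumulant (t * Complex.I) = (-(t ^ 2 / 2 : ℝ) : ℂ) := by
    simp [cumulantFun, Finset.sum_range_succ, gaussCumulant, mul_pow]
    ring
  have hS := (hasSum_momentSeq 2 hg (t * Complex.I)).tendsto_sum_nat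
  rw [hlim] at hS
  have hR := (summable_momentSeq 2 hg t).tendsto_atTop_zero
  rw [Metric.tendsto_atTop] at hS hR
  refine Metric.tendsto_nhds.2 fun ε hε => ?_
  obtain ⟨N₁, hN₁⟩ := hS (ε / 4) (by positivity)
  obtain ⟨N₂, hN₂⟩ := hR (ε / 4) (by positivity)
  -- At order `2 * N` both the tail of the Gaussian series and its single term bounding the Taylor
  -- remainder are below `ε / 4`; convergence of finitely many moments does the rest.
  set N := max N₁ N₂
  specialize hN₁ (2 * N) (by omega)
  specialize hN₂ (2 * N) (by omega)
  have hSn : Tendsto (fun n => ∑ j ∈ Finset.range (2 * N),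
      ((∫ ω, X n ω ^ j ∂Pr : ℝ) : ℂ) * (t * Complex.I) ^ j / j !) atTop
      (𝓝 (∑ j ∈ Finset.range (2 * N),
        (momentSeq gaussCumulant j : ℂ) * (t * Complex.I) ^ j / j !)) := by
    refine tendsto_finsetSum _ fun j _ => ?_
    exact (((Complex.continuous_ofReal.tendsto _).comp (hm j)).mul_const _).div_const _
  have hRn : Tendsto (fun n => (∫ ω, X n ω ^ (2 * N) ∂Pr) * |t| ^ (2 * N) / (2 * N)!) atTop
      (𝓝 (momentSeq gaussCumulant (2 * N) * |t| ^ (2 * N) / (2 * N)!)) :=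
    ((hm _).mul_const _).div_const _
  have hR2 : momentSeq gaussCumulant (2 * N) * |t| ^ (2 * N) / (2 * N)! < ε / 4 := by
    refine lt_of_le_of_lt ?_ hN₂
    rw [dist_zero_right, Real.norm_eq_abs]
    refine le_trans ?_ (le_abs_self _)
    gcongr
    exact le_abs_self _
  filter_upwards [hX, Metric.tendsto_nhds.1 hSn (ε / 4) (by positivity),
    hRn.eventually (gt_mem_nhds hR2)] with n hn h1 h2
  have h3 := norm_charFun_sub_sum_le (hXm n) hn t N
  rw [← dist_eq_norm] at h3
  have := dist_triangle4 (charFun (Pr.map (X n)) t) _ _ (Complex.exp (-(t ^ 2 / 2 : ℝ)))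
    |>.trans (add_le_add (add_le_add h3 h1.le) hN₁.le)
  linarith

/-- Convergence in distribution to the standard normal law of standardised random variables whose
cumulants of high order vanish asymptotically. -/
theorem tendstoInDistribution_of_cumulants {X : ℕ → Ω → ℝ} (hXm : ∀ n, AEMeasurable (X n) Pr)
    (hX : ∀ᶠ n in atTop, ∀ j : ℕ, Integrable (fun ω => X n ω ^ j) Pr)
    (h1 : ∀ᶠ n in atTop, ∫ ω, X n ω ∂Pr = 0) (h2 : ∀ᶠ n in atTop, ∫ ω, X n ω ^ 2 ∂Pr = 1) (K : ℕ)
    (hκ : ∀ j, K < j → Tendsto (fun n => cumulant (fun i => ∫ ω, X n ω ^ i ∂Pr) j) atTop (𝓝 0)) :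
    TendstoInDistribution X atTop (id : ℝ → ℝ) (fun _ => Pr) (gaussianReal 0 1) where
  forall_aemeasurable := hXm
  tendsto := by
    refine ProbabilityMeasure.tendsto_iff_tendsto_charFun.2 fun t => ?_
    have := tendsto_charFun_of_cumulants hXm hX (tendsto_cumulant_gauss (by simp)
      (by simpa using h1) h2 (hX.mono fun n hn => isPositiveMoments_integral hn) K hκ) t
    simpa [charFun_gaussianReal, neg_div] using this

end

end

/-! ## Joint cumulants -/

section

variable {ι : Type*} [LinearOrder ι]

/-- The joint cumulant of the variables with indices in `A`, in terms of the mixed moments. -/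
def jointCumulant (M : Finset ι → ℝ) (A : Finset ι) : ℝ :=
  if h : A.Nonempty then
    M A - ∑ C ∈ (A.erase (A.min' h)).ssubsets.attach,
      jointCumulant M (insert (A.min' h) C.1) * M (A.erase (A.min' h) \ C.1)
  else 0
  termination_by A.card
  decreasing_by
    have h1 := Finset.card_lt_card (Finset.mem_ssubsets.1 C.2)
    have h2 := Finset.card_erase_lt_of_mem (A.min'_mem h)
    have h3 := Finset.card_insert_le (A.min' h) C.1
    omega

theorem jointCumulant_eq (M : Finset ι → ℝ) {A : Finset ι} (h : A.Nonempty) :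
    jointCumulant M A = M A - ∑ C ∈ (A.erase (A.min' h)).ssubsets,
      jointCumulant M (insert (A.min' h) C) * M (A.erase (A.min' h) \ C) := by
  rw [jointCumulant, dif_pos h]
  congr 1
  exact Finset.sum_attach (A.erase (A.min' h)).ssubsets
    (fun C => jointCumulant M (insert (A.min' h) C) * M (A.erase (A.min' h) \ C))

theorem sum_powerset_eq_add_sum_ssubsets (f : Finset ι → ℝ) (A : Finset ι) :
    ∑ C ∈ A.powerset, f C = f A + ∑ C ∈ A.ssubsets, f C := by
  rw [Finset.ssubsets, Finset.add_sum_erase _ _ (Finset.mem_powerset_self A)]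

theorem moment_eq_sum_jointCumulant {M : Finset ι → ℝ} (h0 : M ∅ = 1) {A : Finset ι}
    (h : A.Nonempty) : M A = ∑ C ∈ (A.erase (A.min' h)).powerset,
      jointCumulant M (insert (A.min' h) C) * M (A.erase (A.min' h) \ C) := by
  rw [sum_powerset_eq_add_sum_ssubsets, Finset.insert_erase (A.min'_mem h), jointCumulant_eq M h,
    Finset.sdiff_self, h0]
  ring

theorem card_insert_ssubset_lt {A C : Finset ι} {a : ι} (ha : a ∈ A)
    (hC : C ∈ (A.erase a).ssubsets) : (insert a C).card < A.card := by
  have h1 := Finset.card_lt_card (Finset.mem_ssubsets.1 hC)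
  have h2 := Finset.card_erase_lt_of_mem ha
  have h3 := Finset.card_insert_le a C
  omega

theorem card_ssubsets_erase_le {A : Finset ι} {a : ι} (ha : a ∈ A) {N : ℕ} (hN : A.card ≤ N + 1) :
    ((A.erase a).ssubsets.card : ℝ) ≤ 2 ^ N := by
  have h1 : (A.erase a).ssubsets.card ≤ 2 ^ N := by
    refine (Finset.card_le_card (Finset.erase_subset _ _)).trans ?_
    rw [Finset.card_powerset, Finset.card_erase_of_mem ha]
    exact Nat.pow_le_pow_right (by norm_num) (by omega)
  exact_mod_cast h1

/-- The recursion has at most `2 ^ N` terms. What matters is the order of quantifiers: the constant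
is uniform over all families of moments, hence over all tuples of points. -/
theorem exists_abs_jointCumulant_le {K : ℝ} (hK : 0 ≤ K) (N : ℕ) : ∃ D : ℝ, 0 ≤ D ∧
    ∀ M : Finset ι → ℝ, (∀ A, |M A| ≤ K) → ∀ A : Finset ι, A.card ≤ N →
      |jointCumulant M A| ≤ D := by
  induction N with
  | zero =>
    refine ⟨0, le_rfl, fun M _ A hA => ?_⟩
    rw [Nat.le_zero, Finset.card_eq_zero] at hA
    subst hA
    rw [jointCumulant]; simp
  | succ N ih =>
    obtain ⟨D, hD, ih⟩ := ih
    refine ⟨K + 2 ^ N * (D * K), by positivity, fun M hM A hA => ?_⟩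
    rcases A.eq_empty_or_nonempty with rfl | hne
    · rw [jointCumulant]; simp; positivity
    rw [jointCumulant_eq M hne]
    refine (abs_sub _ _).trans (add_le_add (hM A) ?_)
    refine (Finset.abs_sum_le_sum_abs _ _).trans ?_
    refine (Finset.sum_le_card_nsmul _ _ (D * K) fun C hC => ?_).trans ?_
    · rw [abs_mul]
      have := card_insert_ssubset_lt (A.min'_mem hne) hC
      exact mul_le_mul (ih M hM _ (by omega)) (hM _) (abs_nonneg _) hD
    · rw [nsmul_eq_mul]
      exact mul_le_mul_of_nonneg_right (card_ssubsets_erase_le (A.min'_mem hne) hA) (by positivity)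

/-- Quantitative form of the fact that joint cumulants of two independent groups vanish. In the
recursion, the terms whose cumulant mixes the groups are small by induction. In the others the
moment factorises up to `ε`, and their sum recombines to the product of the moments of the two
groups, which cancels the leading moment up to `ε`. -/
theorem exists_abs_jointCumulant_le_mul {K : ℝ} (hK : 0 ≤ K) (N : ℕ) : ∃ D : ℝ, 0 ≤ D ∧
    ∀ M : Finset ι → ℝ, M ∅ = 1 → (∀ A, |M A| ≤ K) → ∀ (ε : ℝ) (I : Set ι) [DecidablePred (· ∈ I)],
      (∀ A : Finset ι, |M A - M (A.filter (· ∈ I)) * M (A.filter (· ∉ I))| ≤ ε) →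
      ∀ A : Finset ι, A.card ≤ N → (∃ i ∈ A, i ∈ I) → (∃ i ∈ A, i ∉ I) →
      |jointCumulant M A| ≤ D * ε := by
  induction N with
  | zero =>
    refine ⟨0, le_rfl, fun M _ _ ε I _ _ A hA h1 => ?_⟩
    rw [Nat.le_zero, Finset.card_eq_zero] at hA
    subst hA
    simp at h1
  | succ N ih =>
    obtain ⟨D, hD, ih⟩ := ih
    obtain ⟨D₁, hD₁, hJ⟩ := exists_abs_jointCumulant_le (ι := ι) hK (N + 1)
    refine ⟨1 + 2 ^ N * (D₁ + D * K), by positivity, fun M h0 hM ε I _ hI A hA h1 h2 => ?_⟩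
    have hne : A.Nonempty := h1.imp fun _ h => h.1
    have hε : 0 ≤ ε := (abs_nonneg _).trans (hI ∅)
    -- The hypotheses are symmetric in `I` and its complement.
    wlog ha : A.min' hne ∈ I generalizing I
    · refine this Iᶜ (fun _ => inferInstance) (fun B => ?_) (by simpa using h2) (by simpa using h1) ha
      have := hI B
      rw [mul_comm] at this
      convert this using 5 <;> (ext; simp)
    set a := A.min' hne with ha'
    have haA : a ∈ A := A.min'_mem hne
    set A' := A.erase a with hA'
    set AI := A.filter (· ∈ I) with hAI
    have haAI : a ∈ AI := by simp [hAI, haA, ha]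
    have hneI : AI.Nonempty := ⟨a, haAI⟩
    have hminI : AI.min' hneI = a := by
      refine le_antisymm (Finset.min'_le _ _ haAI) (Finset.le_min' _ _ _ fun y hy => ?_)
      exact Finset.min'_le _ _ (Finset.mem_filter.1 hy).1
    have hmI := moment_eq_sum_jointCumulant h0 hneI
    rw [hminI] at hmI
    -- Subsets inside `I` are automatically proper in `A'`, since `A` has an element outside `I`.
    have hsub : (AI.erase a).powerset = A'.ssubsets.filter (fun C => ∀ i ∈ C, i ∈ I) := by
      ext C
      simp only [Finset.mem_powerset, Finset.mem_filter, Finset.mem_ssubsets]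
      constructor
      · intro hC
        have hC1 : C ⊆ A' := hC.trans (Finset.erase_subset_erase _ (Finset.filter_subset _ _))
        have hC2 : ∀ i ∈ C, i ∈ I := fun i hi =>
          (Finset.mem_filter.1 (Finset.mem_of_mem_erase (hC hi))).2
        refine ⟨Finset.ssubset_iff_subset_ne.2 ⟨hC1, ?_⟩, hC2⟩
        rintro rfl
        obtain ⟨i, hi, hiI⟩ := h2
        exact hiI (hC2 i (Finset.mem_erase.2 ⟨by rintro rfl; exact hiI ha, hi⟩))
      · rintro ⟨hC1, hC2⟩ i hi
        have := Finset.mem_erase.1 (hC1.1 hi)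
        exact Finset.mem_erase.2 ⟨this.1, Finset.mem_filter.2 ⟨this.2, hC2 i hi⟩⟩
    rw [hsub] at hmI
    rw [jointCumulant_eq M hne]
    -- The recursion for `AI`, multiplied by the moment of the other group, is subtracted and added
    -- back.
    have key : M A - ∑ C ∈ A'.ssubsets, jointCumulant M (insert a C) * M (A' \ C) =
        (M A - M AI * M (A.filter (· ∉ I))) - ∑ C ∈ A'.ssubsets,
          (jointCumulant M (insert a C) * M (A' \ C) - if ∀ i ∈ C, i ∈ I then
            jointCumulant M (insert a C) * M (AI.erase a \ C) * M (A.filter (· ∉ I)) else 0) := by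
      rw [Finset.sum_sub_distrib, ← Finset.sum_filter, ← Finset.sum_mul, ← hmI]
      ring
    rw [key, add_mul, one_mul]
    refine (abs_sub _ _).trans (add_le_add (hI A) ?_)
    refine (Finset.abs_sum_le_sum_abs _ _).trans ?_
    refine (Finset.sum_le_card_nsmul _ _ ((D₁ + D * K) * ε) fun C hC => ?_).trans ?_
    · have hlt := card_insert_ssubset_lt haA hC
      have hCA := (Finset.mem_ssubsets.1 hC).1
      split_ifs with hCI
      · have e1 : (A' \ C).filter (· ∈ I) = AI.erase a \ C := by
          ext i; simp [hA', hAI]; tauto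
        have e2 : (A' \ C).filter (· ∉ I) = A.filter (· ∉ I) := by
          ext i
          simp only [hA', Finset.mem_filter, Finset.mem_sdiff, Finset.mem_erase]
          constructor
          · tauto
          · rintro ⟨h3, h4⟩
            exact ⟨⟨⟨by rintro rfl; exact h4 ha, h3⟩, fun h => h4 (hCI i h)⟩, h4⟩
        have h3 := hI (A' \ C)
        rw [e1, e2] at h3
        rw [mul_assoc, ← mul_sub, abs_mul]
        calc _ ≤ D₁ * ε := mul_le_mul (hJ M hM _ (by omega)) h3 (abs_nonneg _) hD₁
          _ ≤ _ := by
            refine mul_le_mul_of_nonneg_right ?_ hε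
            have := mul_nonneg hD hK
            linarith
      · push Not at hCI
        obtain ⟨i, hi, hiI⟩ := hCI
        rw [sub_zero, abs_mul]
        have h3 := ih M h0 hM ε I hI (insert a C) (by omega) ⟨a, by simp, ha⟩
          ⟨i, Finset.mem_insert_of_mem hi, hiI⟩
        calc _ ≤ D * ε * K := mul_le_mul h3 (hM _) (abs_nonneg _) (by positivity)
          _ = D * K * ε := by ring
          _ ≤ _ := mul_le_mul_of_nonneg_right (by linarith) hε
    · rw [nsmul_eq_mul, mul_assoc]
      exact mul_le_mul_of_nonneg_right (card_ssubsets_erase_le haA hA) (by positivity)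

theorem jointCumulant_congr {M M' : Finset ι → ℝ} {A : Finset ι} (h : ∀ B ⊆ A, M B = M' B) :
    jointCumulant M A = jointCumulant M' A := by
  induction hN : A.card using Nat.strong_induction_on generalizing A with
  | _ N ih =>
    rcases A.eq_empty_or_nonempty with rfl | hne
    · rw [jointCumulant, jointCumulant]; simp
    rw [jointCumulant_eq M hne, jointCumulant_eq M' hne, h A subset_rfl]
    congr 1
    refine Finset.sum_congr rfl fun C hC => ?_
    have hCA := (Finset.mem_ssubsets.1 hC).1
    have hsub : insert (A.min' hne) C ⊆ A :=
      Finset.insert_subset (A.min'_mem hne) (hCA.trans (Finset.erase_subset _ _))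
    have hlt := card_insert_ssubset_lt (A.min'_mem hne) hC
    rw [h _ (Finset.sdiff_subset.trans (Finset.erase_subset _ _)),
      ih _ (by omega) (fun B hB => h B (hB.trans hsub)) rfl]

/-! ### Averages over tuples -/

/-- The average of functions on a finite set of tuples. -/
def tupleAvg {W : Type*} [Fintype W] [Fintype ι] (f : (ι → W) → ℝ) : ℝ :=
  (∑ x, f x) / Fintype.card (ι → W)

variable {W : Type*} [Fintype W] [Fintype ι] [Nonempty W]

/-- The coordinates of a uniform tuple are independent. Concretely, exchanging the coordinates
outside `A` between two tuples is an involution of the pairs that turns `f x * g y` into `f x * g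
x`. -/
theorem tupleAvg_mul {f g : (ι → W) → ℝ} (A : Finset ι)
    (hf : ∀ x y, (∀ i ∈ A, x i = y i) → f x = f y)
    (hg : ∀ x y, (∀ i ∉ A, x i = y i) → g x = g y) :
    tupleAvg (fun x => f x * g x) = tupleAvg f * tupleAvg g := by
  have hcard : (Fintype.card (ι → W) : ℝ) ≠ 0 := by exact_mod_cast Fintype.card_ne_zero
  have h1 : (∑ x, f x) * ∑ y, g y = ∑ p : (ι → W) × (ι → W), f p.1 * g p.1 := by
    rw [Finset.sum_mul_sum, ← Fintype.sum_prod_type' (f := fun x y => f x * g y)]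
    let e : (ι → W) × (ι → W) → (ι → W) × (ι → W) :=
      fun p => (A.piecewise p.1 p.2, A.piecewise p.2 p.1)
    have he : Function.Involutive e := by
      intro p
      ext i <;> by_cases hi : i ∈ A <;> simp [e, hi]
    refine Fintype.sum_equiv he.toPerm _ _ fun p => ?_
    simp only [Function.Involutive.coe_toPerm, e]
    congr 1
    · exact hf _ _ fun i hi => by simp [hi]
    · exact hg _ _ fun i hi => by simp [hi]
  rw [Fintype.sum_prod_type] at h1
  simp only [Finset.sum_const, Finset.card_univ, nsmul_eq_mul] at h1
  rw [← Finset.mul_sum] at h1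
  unfold tupleAvg
  rw [div_mul_div_comm, h1]
  field_simp

/-- The joint cumulants, averaged over all tuples, are the cumulants of the averaged moments. -/
theorem tupleAvg_jointCumulant {M : (ι → W) → Finset ι → ℝ} {m : ℕ → ℝ} (h0 : m 0 = 1)
    (hM : ∀ A x y, (∀ i ∈ A, x i = y i) → M x A = M y A)
    (hm : ∀ A, tupleAvg (fun x => M x A) = m A.card) {A : Finset ι} (hA : A.Nonempty) :
    tupleAvg (fun x => jointCumulant (M x) A) = cumulant m A.card := by
  induction hN : A.card using Nat.strong_induction_on generalizing A with
  | _ N ih =>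
    subst hN
    have e1 : tupleAvg (fun x => jointCumulant (M x) A) = tupleAvg (fun x => M x A) -
        ∑ C ∈ (A.erase (A.min' hA)).ssubsets, tupleAvg (fun x =>
          jointCumulant (M x) (insert (A.min' hA) C) * M x (A.erase (A.min' hA) \ C)) := by
      unfold tupleAvg
      rw [← Finset.sum_div, ← sub_div, Finset.sum_comm, ← Finset.sum_sub_distrib]
      congr 1
      exact Finset.sum_congr rfl fun x _ => jointCumulant_eq (M x) hA
    have hmin := A.min'_mem hA
    set a := A.min' hA
    have e2 : ∀ C ∈ (A.erase a).ssubsets, tupleAvg (fun x =>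
        jointCumulant (M x) (insert a C) * M x (A.erase a \ C)) =
        cumulant m (C.card + 1) * m ((A.card - 1) - C.card) := by
      intro C hC
      have hCA := (Finset.mem_ssubsets.1 hC).1
      have haC : a ∉ C := fun h => Finset.notMem_erase a A (hCA h)
      have hlt := card_insert_ssubset_lt hmin hC
      rw [tupleAvg_mul (insert a C)
        (fun x y hxy => jointCumulant_congr fun B hB => hM B x y fun i hi => hxy i (hB hi))
        (fun x y hxy => hM _ x y fun i hi => hxy i fun h => ?_), ih _ hlt (by simp) rfl, hm,
        Finset.card_insert_of_notMem haC, Finset.card_sdiff_of_subset hCA,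
        Finset.card_erase_of_mem hmin]
      rw [Finset.mem_sdiff, Finset.mem_erase] at hi
      rcases Finset.mem_insert.1 h with h | h
      · exact hi.1.1 h
      · exact hi.2 h
    rw [e1, hm, Finset.sum_congr rfl e2]
    obtain ⟨N, hN⟩ : ∃ N, A.card = N + 1 := ⟨A.card - 1, by have := hA.card_pos; omega⟩
    have hcard : (A.erase a).card = N := by rw [Finset.card_erase_of_mem hmin]; omega
    -- Grouping subsets by cardinality produces the binomial coefficients of the scalar recursion;
    -- the full set is the extra top term.
    have hs := sum_powerset_eq_add_sum_ssubsets
      (fun C => cumulant m (C.card + 1) * m (N - C.card)) (A.erase a)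
    rw [Finset.sum_powerset_apply_card (fun c => cumulant m (c + 1) * m (N - c)), hcard,
      Finset.sum_range_succ] at hs
    simp only [Nat.choose_self, one_smul, Nat.sub_self, h0, mul_one] at hs
    rw [hN, cumulant_succ, Nat.add_sub_cancel]
    have hs' : ∑ C ∈ (A.erase a).ssubsets, cumulant m (C.card + 1) * m (N - C.card) =
        ∑ i ∈ Finset.range N, (N.choose i : ℝ) * cumulant m (i + 1) * m (N - i) := by
      rw [add_comm, add_left_cancel_iff] at hs
      rw [← hs]
      refine Finset.sum_congr rfl fun i _ => ?_
      rw [nsmul_eq_mul, mul_assoc]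
    rw [hs']

end

/-! ## Geometry of Cayley graphs -/

section

variable {V : Type*} [AddGroup V] {S : Finset V}

theorem cayley_adj_add (hS : IsGeneratingSet S) {h : V} (hh : h ∈ S) (g : V) :
    (cayley S).Adj g (g + h) := by
  rw [cayley, SimpleGraph.addCayley_adj]
  refine ⟨fun he => ?_, Or.inl (by simpa using hh)⟩
  have : h = 0 := by simpa using he.symm
  exact hS.zero_notMem (this ▸ hh)

theorem cayley_adj_iff_mem (hS : IsGeneratingSet S) {u v : V} (h : (cayley S).Adj u v) :
    -u + v ∈ S := by
  rw [cayley, SimpleGraph.addCayley_adj] at h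
  rcases h.2 with h | h
  · simpa using h
  · have := hS.symm _ h
    simpa using this

theorem cayley_connected (hS : IsGeneratingSet S) : (cayley S).Connected := by
  -- The base point stays arbitrary so that, for a sum, a path from `g` can be continued from `g +
  -- x`.
  have h : ∀ x : V, ∀ g : V, (cayley S).Reachable g (g + x) := by
    intro x
    have hx : x ∈ AddSubgroup.closure (S : Set V) := by rw [hS.generates]; trivial
    induction hx using AddSubgroup.closure_induction with
    | mem x hx => exact fun g => (cayley_adj_add hS hx g).reachable
    | zero => exact fun g => by simp
    | add x y _ _ hx hy => exact fun g => by rw [← add_assoc]; exact (hx g).trans (hy _)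
    | neg x _ hx => exact fun g => by simpa using (hx (g + -x)).symm
  exact ⟨fun u v => by simpa using h (-u + v) u⟩

theorem gdist_comm (x y : V) : gdist S x y = gdist S y x := SimpleGraph.dist_comm

theorem gdist_self (x : V) : gdist S x x = 0 := SimpleGraph.dist_self

theorem gdist_triangle (hS : IsGeneratingSet S) (x y z : V) :
    gdist S x z ≤ gdist S x y + gdist S y z :=
  (cayley_connected hS).dist_triangle

theorem gdist_translate_le (hS : IsGeneratingSet S) (g x y : V) :
    gdist S (g + x) (g + y) ≤ gdist S x y := by
  obtain ⟨p, hp⟩ := (cayley_connected hS).exists_walk_length_eq_dist x y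
  let f : cayley S →g cayley S := ⟨fun z => g + z, fun {a b} hab => by
    rw [cayley, SimpleGraph.addCayley_adj_add_iff_right]; exact hab⟩
  have := SimpleGraph.dist_le (p.map f)
  rw [SimpleGraph.Walk.length_map, hp] at this
  exact this

theorem gdist_translate (hS : IsGeneratingSet S) (g x y : V) :
    gdist S (g + x) (g + y) = gdist S x y := by
  refine le_antisymm (gdist_translate_le hS g x y) ?_
  simpa using gdist_translate_le hS (-g) (g + x) (g + y)

theorem gdist_eq_zero_neg_add (hS : IsGeneratingSet S) (x y : V) :
    gdist S x y = gdist S 0 (-x + y) := by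
  rw [← gdist_translate hS (-x) x y]; simp

theorem mem_ball (hS : IsGeneratingSet S) {n : ℕ} {x y : V} :
    x ∈ ball S n y ↔ gdist S y x ≤ n := by
  rw [ball, Set.mem_ofPred_eq, ← ((cayley_connected hS).preconnected y x).coe_dist_eq_edist]
  exact_mod_cast Iff.rfl

theorem neg_add_mem_ball (hS : IsGeneratingSet S) {n : ℕ} {x y : V} :
    -x + y ∈ ball S n 0 ↔ y ∈ ball S n x := by
  rw [mem_ball hS, mem_ball hS, gdist_eq_zero_neg_add hS x y]

/-- The elements of the group represented by words of length `n`. -/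
def wordSet (S : Finset V) : ℕ → Set V
  | 0 => {0}
  | n + 1 => Set.image2 (· + ·) (S : Set V) (wordSet S n)

theorem finite_wordSet (S : Finset V) (n : ℕ) : (wordSet S n).Finite := by
  induction n with
  | zero => exact Set.finite_singleton 0
  | succ n ih => exact Set.Finite.image2 _ S.finite_toSet ih

theorem walk_mem_wordSet (hS : IsGeneratingSet S) {u v : V} (p : (cayley S).Walk u v) :
    -u + v ∈ wordSet S p.length := by
  induction p with
  | nil => simp [wordSet]
  | @cons u w v h p ih =>
    exact ⟨_, cayley_adj_iff_mem hS h, _, ih, by simp [add_assoc]⟩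

theorem finite_ball (hS : IsGeneratingSet S) (n : ℕ) (y : V) : (ball S n y).Finite := by
  refine ((Set.finite_Iic n).biUnion fun m _ => (finite_wordSet S m).image (y + ·)).subset ?_
  intro x hx
  rw [mem_ball hS] at hx
  obtain ⟨p, hp⟩ := (cayley_connected hS).exists_walk_length_eq_dist y x
  rw [Set.mem_iUnion₂]
  exact ⟨p.length, by rw [hp]; exact hx, _, walk_mem_wordSet hS p, by simp⟩

/-- The ball of radius `n` as a finite set. -/
def ballFinset (hS : IsGeneratingSet S) (n : ℕ) (y : V) : Finset V := (finite_ball hS n y).toFinset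

theorem mem_ballFinset (hS : IsGeneratingSet S) {n : ℕ} {x y : V} :
    x ∈ ballFinset hS n y ↔ gdist S y x ≤ n := by
  rw [ballFinset, Set.Finite.mem_toFinset, mem_ball hS]

theorem coe_ballFinset (hS : IsGeneratingSet S) (n : ℕ) (y : V) :
    (ballFinset hS n y : Set V) = ball S n y := by simp [ballFinset]

theorem card_ballFinset (hS : IsGeneratingSet S) (n : ℕ) (y : V) :
    (ballFinset hS n y).card = vol S n := by
  rw [vol, ← coe_ballFinset hS, Set.ncard_coe_finset]
  refine Finset.card_bij (fun x _ => -y + x) (fun x hx => ?_) (fun a _ b _ h => by simpa using h)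
    fun x hx => ⟨y + x, ?_, by simp⟩
  · rw [mem_ballFinset] at hx ⊢
    rwa [← gdist_eq_zero_neg_add hS]
  · rw [mem_ballFinset] at hx ⊢
    rw [gdist_eq_zero_neg_add hS]
    simpa using hx

theorem vol_pos (hS : IsGeneratingSet S) (n : ℕ) : 0 < vol S n := by
  rw [← card_ballFinset hS n 0]
  exact Finset.card_pos.2 ⟨0, by rw [mem_ballFinset, gdist_self]; omega⟩

theorem vol_mono (hS : IsGeneratingSet S) : Monotone (vol S) := by
  intro m n hmn
  rw [← card_ballFinset hS m 0, ← card_ballFinset hS n 0]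
  refine Finset.card_le_card fun x hx => ?_
  rw [mem_ballFinset] at hx ⊢
  omega

theorem tendsto_vol [Infinite V] (hS : IsGeneratingSet S) : Tendsto (vol S) atTop atTop := by
  refine tendsto_atTop_atTop_of_monotone (vol_mono hS) fun b => ?_
  obtain ⟨F, hF⟩ := Infinite.exists_subset_card_eq V b
  refine ⟨F.sup (gdist S 0), ?_⟩
  rw [← hF, ← card_ballFinset hS _ 0]
  refine Finset.card_le_card fun x hx => ?_
  rw [mem_ballFinset]
  exact Finset.le_sup hx

theorem sum_comp_gdist_le_tsum {f : ℕ → ℝ} (hS : IsGeneratingSet S)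
    (h : Summable fun x : V => f (gdist S 0 x)) (hf : ∀ s, 0 ≤ f s) (y : V) (W : Finset V) :
    ∑ x ∈ W, f (gdist S y x) ≤ ∑' x : V, f (gdist S 0 x) := by
  have : ∑ x ∈ W, f (gdist S y x) = ∑ x ∈ W.map (Equiv.addLeft (-y)).toEmbedding, f (gdist S 0 x) := by
    rw [Finset.sum_map]
    refine Finset.sum_congr rfl fun x _ => ?_
    rw [gdist_eq_zero_neg_add hS]; rfl
  rw [this]
  exact h.sum_le_tsum _ fun x _ => hf _

end

/-! ## Cumulants of sums of clustering variables -/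

/-- Finitely many natural numbers, one of which vanishes, leave a large gap. -/
theorem exists_gap {p : ℕ} (f : Fin (p + 1) → ℕ) (h0 : f 0 = 0) {i₀ : Fin (p + 1)}
    (hpos : 0 < f i₀) :
    ∃ a s : ℕ, f i₀ ≤ (p + 1) * s ∧ a + s ≤ f i₀ ∧ 0 < s ∧ ∀ i, f i ≤ a ∨ a + s ≤ f i := by
  set D := f i₀ with hD
  set t := D / (p + 1) with ht
  have ht1 : (p + 1) * t ≤ D := Nat.mul_div_le _ _
  have ht2 : D < (p + 1) * (t + 1) := Nat.lt_mul_div_succ _ (by omega)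
  clear_value t
  -- Pigeonhole: among the `p + 1` blocks `(l t, (l + 1) t]` one is free of values, because `f 0 =
  -- 0` lies in none and only `p` values remain.
  obtain ⟨l, hl, hl'⟩ := Finset.exists_mem_notMem_of_card_lt_card
    (s := ((Finset.univ : Finset (Fin (p + 1))).erase 0).image fun i => (f i - 1) / t)
    (t := Finset.range (p + 1)) (by
      refine lt_of_le_of_lt Finset.card_image_le ?_
      rw [Finset.card_erase_of_mem (Finset.mem_univ _)]
      simp)
  rw [Finset.mem_range] at hl
  have hgap : ∀ i, f i ≤ l * t ∨ (l + 1) * t < f i := by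
    intro i
    by_contra hc
    push Not at hc
    apply hl'
    have hfi : 1 ≤ f i := by omega
    have hi0 : i ≠ 0 := by rintro rfl; omega
    refine Finset.mem_image.2 ⟨i, Finset.mem_erase.2 ⟨hi0, Finset.mem_univ _⟩, ?_⟩
    refine Nat.div_eq_of_lt_le ?_ ?_ <;> omega
  -- Values beyond the empty block exceed its end strictly, so the gap is `t + 1`. This makes it
  -- positive even for `t = 0` and compensates the rounding in `t`.
  refine ⟨l * t, t + 1, ht2.le, ?_, by omega, fun i => ?_⟩
  · have h1 : (l + 1) * t ≤ (p + 1) * t := Nat.mul_le_mul_right _ (by omega)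
    rcases hgap i₀ with h | h
    · have : (l + 1) * t = l * t + t := by ring
      have : t = 0 := by omega
      simp [this]
      omega
    · have : (l + 1) * t = l * t + t := by ring
      omega
  · have : (l + 1) * t = l * t + t := by ring
    have := hgap i
    omega

/-- Once the centre `x 0` is fixed, the other `p` points are summed independently. -/
theorem sum_prod_star {V : Type*} {W : Finset V} (g : V → V → ℝ) (p : ℕ) :
    ∑ x : Fin (p + 1) → W, ∏ i : Fin p, g (x 0) (x i.succ) = ∑ y ∈ W, (∑ z ∈ W, g y z) ^ p := by
  rw [← (Fin.consEquiv fun _ : Fin (p + 1) => (W : Type _)).sum_comp, Fintype.sum_prod_type,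
    ← Finset.sum_coe_sort W fun y => (∑ z ∈ W, g y z) ^ p]
  refine Finset.sum_congr rfl fun y _ => ?_
  rw [← Finset.sum_coe_sort W, Fintype.sum_pow]
  refine Finset.sum_congr rfl fun z _ => ?_
  simp [Fin.consEquiv]

section

variable {V : Type*} {Ω : Type*} [MeasurableSpace Ω] {Pr : Measure Ω}

/-- The mixed moments of the variables `Y (x i)`, `i ∈ A`. -/
def mixedMoment (Pr : Measure Ω) (Y : V → Ω → ℝ) {ι : Type*} (x : ι → V) (A : Finset ι) : ℝ :=
  ∫ ω, ∏ i ∈ A, Y (x i) ω ∂Pr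

/-- Each index outside `A` is free and contributes a factor `W.card`. The average over tuples thus
depends on `A` only through its cardinality, as `tupleAvg_jointCumulant` requires. -/
theorem sum_mixedMoment (W : Finset V) (Y : V → Ω → ℝ) {k : ℕ}
    (hint : ∀ x : Fin k → V, (∀ i, x i ∈ W) → ∀ A : Finset (Fin k),
      Integrable (fun ω => ∏ i ∈ A, Y (x i) ω) Pr) (A : Finset (Fin k)) :
    ∑ x : Fin k → W, mixedMoment Pr Y (fun i => (x i : V)) A =
      (∫ ω, (∑ x ∈ W, Y x ω) ^ A.card ∂Pr) * (W.card : ℝ) ^ (k - A.card) := by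
  unfold mixedMoment
  rw [← integral_finsetSum _ fun x _ => hint (fun i => (x i : V)) (fun i => (x i).2) A,
    ← integral_mul_const]
  congr 1
  funext ω
  have h1 : ∀ x : Fin k → W, ∏ i ∈ A, Y (x i) ω = ∏ i, if i ∈ A then Y (x i) ω else 1 := by
    intro x; simp
  simp only [h1]
  have h3 := Finset.prod_univ_sum (fun _ : Fin k => (Finset.univ : Finset W))
    (fun i w => if i ∈ A then Y (w : V) ω else 1)
  rw [Fintype.piFinset_univ] at h3
  rw [← h3]
  have h2 : ∀ i, (∑ w : W, if i ∈ A then Y (w : V) ω else 1) =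
      if i ∈ A then ∑ x ∈ W, Y x ω else (W.card : ℝ) := by
    intro i
    split_ifs
    · exact Finset.sum_coe_sort W fun x => Y x ω
    · simp
  simp only [h2]
  rw [Finset.prod_ite]
  simp [Finset.filter_not, Finset.card_sdiff]

/-- Multilinearity of cumulants. The averaged mixed moments are the moments of the mean of the `Y
x`, and by homogeneity the powers of `W.card` cancel. -/
theorem sum_jointCumulant_mixedMoment [IsProbabilityMeasure Pr] {W : Finset V} (hW : W.Nonempty)
    (Y : V → Ω → ℝ) {k : ℕ} (hk : 0 < k)
    (hint : ∀ x : Fin k → V, (∀ i, x i ∈ W) → ∀ A : Finset (Fin k),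
      Integrable (fun ω => ∏ i ∈ A, Y (x i) ω) Pr) :
    ∑ x : Fin k → W, jointCumulant (mixedMoment Pr Y fun i => (x i : V)) Finset.univ =
      cumulant (fun j => ∫ ω, (∑ x ∈ W, Y x ω) ^ j ∂Pr) k := by
  have : Nonempty W := hW.to_subtype
  have hw : (W.card : ℝ) ≠ 0 := by exact_mod_cast hW.card_ne_zero
  have hne : (Finset.univ : Finset (Fin k)).Nonempty := ⟨⟨0, hk⟩, Finset.mem_univ _⟩
  have h := tupleAvg_jointCumulant (ι := Fin k) (W := W)
    (M := fun x => mixedMoment Pr Y fun i => (x i : V))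
    (m := fun j => (W.card : ℝ)⁻¹ ^ j * ∫ ω, (∑ x ∈ W, Y x ω) ^ j ∂Pr) (by simp)
    (fun A x y hxy => by
      unfold mixedMoment
      congr 1
      funext ω
      exact Finset.prod_congr rfl fun i hi => by simp only [hxy i hi])
    (fun A => by
      unfold tupleAvg
      rw [sum_mixedMoment W Y hint A, Fintype.card_fun, Fintype.card_coe, Fintype.card_fin]
      have : A.card ≤ k := by simpa using Finset.card_le_univ A
      push_cast
      have e : (W.card : ℝ) ^ k = (W.card : ℝ) ^ (k - A.card) * (W.card : ℝ) ^ A.card := by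
        rw [← pow_add, Nat.sub_add_cancel this]
      rw [e, inv_pow]
      field_simp) hne
  rw [cumulant_smul, tupleAvg, Fintype.card_fun, Fintype.card_coe, Fintype.card_fin,
    Finset.card_univ, Fintype.card_fin] at h
  push_cast at h
  rw [inv_pow, div_eq_inv_mul] at h
  exact mul_left_cancel₀ (by positivity) h

variable [AddGroup V] {S : Finset V}

/-- Rates of decay that are summable over the graph together with all their roots. -/
structure IsSummableRate (S : Finset V) (ψ : ℝ → ℝ) : Prop where
  antitone : AntitoneOn ψ (Set.Ici 0)
  nonneg : ∀ s, 0 ≤ ψ s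
  one_le_zero : 1 ≤ ψ 0
  summable : IsSummableIn S ψ

/-- The mixed moments of order at most `k` of the variables `Y x`, `x ∈ W`, are bounded by `K` and
factorise up to an error `ψ s` for groups of variables at distance `s`. -/
def HasClusteringMoments (S : Finset V) (Pr : Measure Ω) (W : Finset V) (Y : V → Ω → ℝ) (k : ℕ)
    (K : ℝ) (ψ : ℝ → ℝ) : Prop :=
  ∀ x : Fin k → V, (∀ i, x i ∈ W) →
    (∀ A : Finset (Fin k), Integrable (fun ω => ∏ i ∈ A, Y (x i) ω) Pr) ∧
    (∀ A : Finset (Fin k), |mixedMoment Pr Y x A| ≤ K) ∧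
    ∀ (s : ℕ) (I : Set (Fin k)) [DecidablePred (· ∈ I)], 0 < s →
      (∀ i ∈ I, ∀ j ∉ I, s ≤ gdist S (x i) (x j)) → ∀ A : Finset (Fin k),
        |mixedMoment Pr Y x A - mixedMoment Pr Y x (A.filter (· ∈ I)) *
          mixedMoment Pr Y x (A.filter (· ∉ I))| ≤ ψ s

/-- The cumulants of sums of clustering variables grow at most like the number of summands. -/
theorem exists_abs_cumulant_sum_le [IsProbabilityMeasure Pr] (hS : IsGeneratingSet S) {p : ℕ}
    (hp : 1 ≤ p) {K : ℝ} (hK : 0 ≤ K) {ψ : ℝ → ℝ} (hψ : IsSummableRate S ψ) :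
    ∃ D : ℝ, ∀ (W : Finset V) (Y : V → Ω → ℝ), W.Nonempty →
      HasClusteringMoments S Pr W Y (p + 1) K ψ →
      |cumulant (fun j => ∫ ω, (∑ x ∈ W, Y x ω) ^ j ∂Pr) (p + 1)| ≤ D * W.card := by
  obtain ⟨hψ, hψ0, hψ1, hsum⟩ := hψ
  obtain ⟨D₁, hD₁, hJ₁⟩ := exists_abs_jointCumulant_le (ι := Fin (p + 1)) hK (p + 1)
  obtain ⟨D₂, hD₂, hJ₂⟩ := exists_abs_jointCumulant_le_mul (ι := Fin (p + 1)) hK (p + 1)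
  -- The root lets one value of `ψ` be distributed over the `p` points other than `x 0`.
  set g : ℕ → ℝ := fun d => ψ ((p + 1 : ℝ)⁻¹ * d) ^ (1 / (p : ℝ)) with hg
  have hsum' : Summable fun x : V => g (gdist S 0 x) := hsum _ (by positivity) p hp
  have hg0 : ∀ s, 0 ≤ g s := fun s => Real.rpow_nonneg (hψ0 _) _
  refine ⟨(D₁ + D₂) * (∑' x : V, g (gdist S 0 x)) ^ p, fun W Y hW h => ?_⟩
  rw [← sum_jointCumulant_mixedMoment hW Y (Nat.succ_pos p) fun x hx => (h x hx).1]
  have hx : ∀ x : Fin (p + 1) → W,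
      |jointCumulant (mixedMoment Pr Y fun i => (x i : V)) Finset.univ| ≤
        (D₁ + D₂) * ∏ i : Fin p, g (gdist S (x 0) (x i.succ)) := by
    intro x
    obtain ⟨hint, hbd, hcl⟩ := h (fun i => (x i : V)) fun i => (x i).2
    obtain ⟨i₀, _, hi₀⟩ := Finset.exists_max_image Finset.univ
      (fun i => gdist S (x 0 : V) (x i)) ⟨0, Finset.mem_univ _⟩
    replace hi₀ := fun i => hi₀ i (Finset.mem_univ i)
    set D := gdist S (x 0 : V) (x i₀) with hD
    have hstar : ψ ((p + 1 : ℝ)⁻¹ * D) ≤ ∏ i : Fin p, g (gdist S (x 0) (x i.succ)) := by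
      have h1 : ψ ((p + 1 : ℝ)⁻¹ * D) = ∏ _i : Fin p, g D := by
        rw [Finset.prod_const, Finset.card_univ, Fintype.card_fin, hg]
        simp only
        rw [one_div, Real.rpow_inv_natCast_pow (hψ0 _) (by omega)]
      rw [h1]
      refine Finset.prod_le_prod (fun _ _ => hg0 _) fun i _ => ?_
      refine Real.rpow_le_rpow (hψ0 _) (hψ ?_ ?_ ?_) (by positivity)
      · exact Set.mem_Ici.2 (by positivity)
      · exact Set.mem_Ici.2 (by positivity)
      · have : (gdist S (x 0 : V) (x i.succ) : ℝ) ≤ D := by exact_mod_cast hi₀ _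
        gcongr
    have hprod := (hψ0 _).trans hstar
    -- If all points coincide there is no gap; the trivial bound suffices since `ψ 0 ≥ 1`.
    rcases Nat.eq_zero_or_pos D with hD0 | hDpos
    · have h1 := hJ₁ _ hbd Finset.univ (by simp)
      rw [hD0, Nat.cast_zero, mul_zero] at hstar
      refine h1.trans ?_
      rw [add_mul]
      nlinarith [mul_nonneg hD₂ hprod, mul_le_mul_of_nonneg_left (hψ1.trans hstar) hD₁]
    -- By the triangle inequality, a gap of length `s` in the distances from `x 0` separates the
    -- points inside from those outside by at least `s`.
    · obtain ⟨a, s, hs1, hs2, hs0, hs3⟩ := exists_gap (fun i => gdist S (x 0 : V) (x i))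
        (gdist_self _) hDpos
      have h2 := hJ₂ (mixedMoment Pr Y fun i => (x i : V)) (by simp [mixedMoment]) hbd (ψ s)
        {i | gdist S (x 0 : V) (x i) ≤ a} (hcl s _ hs0 fun i hi j hj => ?_) Finset.univ (by simp)
        ⟨0, Finset.mem_univ _, by simp [gdist_self]⟩ ⟨i₀, Finset.mem_univ _, by simp; omega⟩
      · refine h2.trans ?_
        have h3 : ψ s ≤ ψ ((p + 1 : ℝ)⁻¹ * D) := by
          refine hψ (Set.mem_Ici.2 (by positivity)) (Set.mem_Ici.2 (by positivity)) ?_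
          rw [inv_mul_le_iff₀ (by positivity)]
          exact_mod_cast hs1
        rw [add_mul]
        nlinarith [mul_nonneg hD₁ hprod, mul_le_mul_of_nonneg_left (h3.trans hstar) hD₂]
      · have hi' : gdist S (x 0 : V) (x i) ≤ a := hi
        have hj' : ¬ gdist S (x 0 : V) (x j) ≤ a := hj
        have h3 := hs3 j
        have h4 := gdist_triangle hS (x 0 : V) (x i) (x j)
        omega
  refine (Finset.abs_sum_le_sum_abs _ _).trans ((Finset.sum_le_sum fun x _ => hx x).trans ?_)
  rw [← Finset.mul_sum, sum_prod_star fun y z => g (gdist S y z), mul_assoc]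
  refine mul_le_mul_of_nonneg_left ?_ (by positivity)
  refine (Finset.sum_le_card_nsmul _ _ ((∑' x : V, g (gdist S 0 x)) ^ p) fun y _ => ?_).trans ?_
  · exact pow_le_pow_left₀ (Finset.sum_nonneg fun _ _ => hg0 _)
      (sum_comp_gdist_le_tsum hS hsum' hg0 y W) p
  · rw [nsmul_eq_mul, mul_comm]

/-- The central limit theorem for sums of clustering variables over balls. -/
theorem tendstoInDistribution_of_clustering [Infinite V] [IsProbabilityMeasure Pr]
    (hS : IsGeneratingSet S) {Y : ℕ → V → Ω → ℝ} {H : ℕ → Ω → ℝ}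
    (hHm : ∀ n, AEMeasurable (H n) Pr)
    (hH : ∀ᶠ n in atTop, ∀ ω, H n ω = ∑ x ∈ ballFinset hS n 0, Y n x ω)
    (hint : ∀ᶠ n in atTop, ∀ j : ℕ, Integrable (fun ω => H n ω ^ j) Pr)
    (hmean : ∀ᶠ n in atTop, ∫ ω, H n ω ∂Pr = 0) {ν : ℝ} (hν : 0 < ν)
    (hvar : (fun n : ℕ => (vol S n : ℝ) ^ ν) =O[atTop] fun n : ℕ => ∫ ω, H n ω ^ 2 ∂Pr)
    (hcl : ∀ p : ℕ, 1 ≤ p → ∃ K ψ, 0 ≤ K ∧ IsSummableRate S ψ ∧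
      ∀ᶠ n : ℕ in atTop, HasClusteringMoments S Pr (ballFinset hS n 0) (Y n) (p + 1) K ψ) :
    TendstoInDistribution (fun n ω => H n ω / √(∫ ω', H n ω' ^ 2 ∂Pr)) atTop (id : ℝ → ℝ)
      (fun _ => Pr) (gaussianReal 0 1) := by
  set v : ℕ → ℝ := fun n => ∫ ω, H n ω ^ 2 ∂Pr with hv
  have hv0 : ∀ n, 0 ≤ v n := fun n => integral_nonneg fun ω => sq_nonneg _
  obtain ⟨C, hC, hCv⟩ := hvar.exists_pos
  rw [IsBigOWith] at hCv
  have hw : ∀ n, (0 : ℝ) < vol S n := fun n => by exact_mod_cast vol_pos hS n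
  have hlow : ∀ᶠ n in atTop, C⁻¹ * (vol S n : ℝ) ^ ν ≤ v n := by
    filter_upwards [hCv] with n hn
    have := hw n
    rw [Real.norm_of_nonneg (by positivity), Real.norm_of_nonneg (hv0 n)] at hn
    rwa [inv_mul_le_iff₀ hC]
  have hvpos : ∀ᶠ n in atTop, 0 < v n := by
    filter_upwards [hlow] with n hn
    have := hw n
    exact lt_of_lt_of_le (by positivity) hn
  obtain ⟨k₀, hk₀⟩ := exists_nat_gt (2 / ν)
  have hXpow : ∀ n (j : ℕ) ω, (H n ω / √(v n)) ^ j = (√(v n))⁻¹ ^ j * H n ω ^ j := fun n j ω => by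
    rw [div_eq_inv_mul, mul_pow]
  refine tendstoInDistribution_of_cumulants (fun n => (hHm n).div_const _) ?_ ?_ ?_ (k₀ + 1)
    fun j hj => ?_
  · filter_upwards [hint] with n hn j
    change Integrable (fun ω => (H n ω / √(v n)) ^ j) Pr
    simp only [hXpow]
    exact (hn j).const_mul _
  · filter_upwards [hmean] with n hn
    rw [integral_div, hn, zero_div]
  · filter_upwards [hvpos] with n hn
    change ∫ ω, (H n ω / √(v n)) ^ 2 ∂Pr = 1
    simp only [hXpow]
    rw [integral_const_mul, inv_pow, Real.sq_sqrt (hv0 n)]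
    exact inv_mul_cancel₀ hn.ne'
  obtain ⟨p, rfl⟩ : ∃ p, j = p + 1 := ⟨j - 1, by omega⟩
  obtain ⟨K, ψ, hK, hψ, hmom⟩ := hcl p (by omega)
  obtain ⟨D, hD⟩ := exists_abs_cumulant_sum_le (Pr := Pr) hS (p := p) (by omega) hK hψ
  -- The cumulant is `O(w_n)` and the normalisation divides by at least a multiple of `w_n ^ (ν (p +
  -- 1) / 2)`; the choice `k₀ > 2 / ν` makes the latter win.
  have hexp : 1 < ν * (((p + 1 : ℕ) : ℝ) / 2) := by
    have h1 : (k₀ : ℝ) < ((p + 1 : ℕ) : ℝ) := by exact_mod_cast (by omega : k₀ < p + 1)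
    have h2 := hk₀.trans h1
    rw [div_lt_iff₀ hν] at h2
    linarith
  have hlim : Tendsto (fun n => |D| * (C⁻¹ ^ (((p + 1 : ℕ) : ℝ) / 2))⁻¹ *
      (vol S n : ℝ) ^ (-(ν * (((p + 1 : ℕ) : ℝ) / 2) - 1))) atTop (𝓝 0) := by
    have := ((tendsto_rpow_neg_atTop (sub_pos.2 hexp)).comp
      (tendsto_natCast_atTop_atTop.comp (tendsto_vol hS))).const_mul
        (|D| * (C⁻¹ ^ (((p + 1 : ℕ) : ℝ) / 2))⁻¹)
    rw [mul_zero] at this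
    exact this
  refine squeeze_zero_norm' ?_ hlim
  filter_upwards [hH, hmom, hlow, hvpos] with n hHn hn hl hvp
  have hwn := hw n
  have h1 : (fun i => ∫ ω, (H n ω / √(v n)) ^ i ∂Pr) =
      fun i => (√(v n))⁻¹ ^ i * ∫ ω, (∑ x ∈ ballFinset hS n 0, Y n x ω) ^ i ∂Pr := by
    funext i
    simp only [hXpow]
    rw [integral_const_mul]
    simp only [hHn]
  rw [h1, cumulant_smul, norm_mul, Real.norm_eq_abs (cumulant _ _)]
  have h2 := hD _ (Y n) ⟨0, by rw [mem_ballFinset, gdist_self]; omega⟩ hn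
  rw [card_ballFinset] at h2
  have h3 : ‖(√(v n))⁻¹ ^ (p + 1)‖ ≤ (C⁻¹ ^ (((p + 1 : ℕ) : ℝ) / 2))⁻¹ *
      ((vol S n : ℝ) ^ (ν * (((p + 1 : ℕ) : ℝ) / 2)))⁻¹ := by
    rw [Real.norm_of_nonneg (by positivity), inv_pow, ← mul_inv]
    refine inv_anti₀ (by positivity) ?_
    rw [Real.rpow_mul hwn.le, ← Real.mul_rpow (by positivity) (by positivity),
      Real.sqrt_eq_rpow, ← Real.rpow_natCast, ← Real.rpow_mul (hv0 n)]
    rw [show 1 / 2 * ((p + 1 : ℕ) : ℝ) = ((p + 1 : ℕ) : ℝ) / 2 by ring]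
    exact Real.rpow_le_rpow (by positivity) hl (by positivity)
  have h4 : |cumulant (fun i => ∫ ω, (∑ x ∈ ballFinset hS n 0, Y n x ω) ^ i ∂Pr) (p + 1)| ≤
      |D| * vol S n := h2.trans (mul_le_mul_of_nonneg_right (le_abs_self D) hwn.le)
  refine (mul_le_mul h3 h4 (abs_nonneg _) (by positivity)).trans_eq ?_
  rw [neg_sub, Real.rpow_sub hwn, Real.rpow_one]
  field_simp

end

/-! ## Local functions of spin models -/

section

variable {V : Type*} {Ω : Type*} [MeasurableSpace Ω] {Pr : Measure Ω}

open scoped Classical in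
/-- Functions of finitely many spins are linear combinations of products of spins. -/
theorem exists_spin_expansion (U : Finset V) : ∀ (F : Set V → ℝ) (B : ℝ),
    (∀ μ, F μ = F (μ ∩ U)) → (∀ μ, |F μ| ≤ B) → ∃ a : Finset V → ℝ,
      (∀ μ, F μ = ∑ A ∈ U.powerset, a A * if (A : Set V) ⊆ μ then 1 else 0) ∧
      ∑ A ∈ U.powerset, |a A| ≤ 3 ^ U.card * B := by
  induction U using Finset.induction_on with
  | empty =>
    intro F B hF hB
    refine ⟨fun _ => F ∅, fun μ => ?_, by simpa using hB ∅⟩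
    rw [hF μ]; simp
  | insert u U hu ih =>
    intro F B hF hB
    have hloc : ∀ μ : Set V, (μ \ {u}) ∩ (insert u U : Finset V) = (μ ∩ U) \ {u} := by
      intro μ
      ext z
      simp only [Finset.coe_insert, Set.mem_inter_iff, Set.mem_sdiff, Set.mem_singleton_iff,
        Set.mem_insert_iff, Finset.mem_coe]
      tauto
    have hloc' : ∀ μ : Set V, insert u μ ∩ (insert u U : Finset V) = insert u (μ ∩ U) := by
      intro μ
      ext z
      simp only [Finset.coe_insert, Set.mem_inter_iff, Set.mem_insert_iff, Finset.mem_coe]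
      tauto
    have hF0 : ∀ μ, F (μ \ {u}) = F ((μ ∩ U) \ {u}) := by
      intro μ
      rw [hF (μ \ {u}), hF ((μ ∩ U) \ {u}), hloc, hloc, Set.inter_assoc, Set.inter_self]
    have hF1 : ∀ μ, F (insert u μ) = F (insert u (μ ∩ U)) := by
      intro μ
      rw [hF (insert u μ), hF (insert u (μ ∩ U)), hloc', hloc', Set.inter_assoc, Set.inter_self]
    obtain ⟨a₀, ha₀, hs₀⟩ := ih (fun μ => F (μ \ {u})) B hF0 fun μ => hB _
    -- The spin at `u` enters affinely: `F μ` is its value without `u` plus the indicator of `u ∈ μ`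
    -- times this difference. The bounds `B` and `2 * B` give the factor `3` per spin.
    obtain ⟨a₁, ha₁, hs₁⟩ := ih (fun μ => F (insert u μ) - F (μ \ {u})) (2 * B)
      (fun μ => by rw [hF0 μ, hF1 μ])
      (fun μ => (abs_sub _ _).trans (by linarith [hB (insert u μ), hB (μ \ {u})]))
    refine ⟨fun A => if u ∈ A then a₁ (A.erase u) else a₀ A, fun μ => ?_, ?_⟩
    · rw [Finset.sum_powerset_insert hu]
      have e0 : ∑ A ∈ U.powerset, (if u ∈ A then a₁ (A.erase u) else a₀ A) *
          (if (A : Set V) ⊆ μ then 1 else 0) = F (μ \ {u}) := by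
        rw [ha₀ μ]
        refine Finset.sum_congr rfl fun A hA => ?_
        rw [if_neg fun h => hu (Finset.mem_powerset.1 hA h)]
      have e1 : ∑ A ∈ U.powerset, (if u ∈ insert u A then a₁ ((insert u A).erase u)
          else a₀ (insert u A)) * (if ((insert u A : Finset V) : Set V) ⊆ μ then 1 else 0) =
          if u ∈ μ then F (insert u μ) - F (μ \ {u}) else 0 := by
        split_ifs with huμ
        · rw [ha₁ μ]
          refine Finset.sum_congr rfl fun A hA => ?_
          rw [if_pos (Finset.mem_insert_self _ _),
            Finset.erase_insert fun h => hu (Finset.mem_powerset.1 hA h)]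
          simp [Set.insert_subset_iff, huμ]
        · refine Finset.sum_eq_zero fun A _ => ?_
          simp [Set.insert_subset_iff, huμ]
      rw [e0, e1]
      split_ifs with huμ
      · rw [Set.insert_eq_of_mem huμ]; ring
      · rw [Set.sdiff_singleton_eq_self huμ, add_zero]
    · rw [Finset.sum_powerset_insert hu, Finset.card_insert_of_notMem hu]
      have e0 : ∑ A ∈ U.powerset, |if u ∈ A then a₁ (A.erase u) else a₀ A| =
          ∑ A ∈ U.powerset, |a₀ A| := by
        refine Finset.sum_congr rfl fun A hA => ?_
        rw [if_neg fun h => hu (Finset.mem_powerset.1 hA h)]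
      have e1 : ∑ A ∈ U.powerset, |if u ∈ insert u A then a₁ ((insert u A).erase u)
          else a₀ (insert u A)| = ∑ A ∈ U.powerset, |a₁ A| := by
        refine Finset.sum_congr rfl fun A hA => ?_
        rw [if_pos (Finset.mem_insert_self _ _),
          Finset.erase_insert fun h => hu (Finset.mem_powerset.1 hA h)]
      rw [e0, e1, pow_succ]
      linarith

theorem measurableSet_subset_spin (A : Finset V) : MeasurableSet {μ : Set V | (A : Set V) ⊆ μ} := by
  have : {μ : Set V | (A : Set V) ⊆ μ} = ⋂ x ∈ A, {μ : Set V | x ∈ μ} := by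
    ext μ; simp [Set.subset_def]
  rw [this]
  exact Finset.measurableSet_biInter _ fun x _ => measurableSet_mem x

/-- Functions of finitely many spins are measurable. -/
theorem measurable_of_local {F : Set V → ℝ} (U : Finset V) (hF : ∀ μ, F μ = F (μ ∩ U)) :
    Measurable F := by
  classical
  have hb : ∃ B, ∀ μ, |F μ| ≤ B := by
    have hfin : (Set.range F).Finite := by
      refine ((U.finite_toSet.finite_subsets).image F).subset ?_
      rintro _ ⟨μ, rfl⟩
      exact ⟨μ ∩ U, Set.inter_subset_right, (hF μ).symm⟩
    obtain ⟨B, hB⟩ := (hfin.image abs).bddAbove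
    exact ⟨B, fun μ => hB ⟨_, ⟨μ, rfl⟩, rfl⟩⟩
  obtain ⟨B, hB⟩ := hb
  obtain ⟨a, ha, -⟩ := exists_spin_expansion U F B hF hB
  have : F = fun μ => ∑ A ∈ U.powerset, a A * if (A : Set V) ⊆ μ then 1 else 0 := funext ha
  rw [this]
  exact Finset.measurable_fun_sum _ fun A _ =>
    (Measurable.ite (measurableSet_subset_spin A) measurable_const measurable_const).const_mul _

/-- Covariance is bilinear, so both functions are expanded in products of spins; the powers of `3`
bound the sums of the coefficients. -/
theorem abs_covariance_local_le [IsProbabilityMeasure Pr] {P : Ω → Set V} (hP : Measurable P)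
    {U W : Finset V} {F G : Set V → ℝ} {B B' ε : ℝ}
    (hF : ∀ μ, F μ = F (μ ∩ U)) (hG : ∀ μ, G μ = G (μ ∩ W))
    (hB : ∀ μ, |F μ| ≤ B) (hB' : ∀ μ, |G μ| ≤ B') (hε : 0 ≤ ε)
    (hcov : ∀ A ⊆ U, ∀ A' ⊆ W, |Pr.real {ω | (A : Set V) ∪ (A' : Set V) ⊆ P ω}
        - Pr.real {ω | (A : Set V) ⊆ P ω} * Pr.real {ω | (A' : Set V) ⊆ P ω}| ≤ ε) :
    |∫ ω, F (P ω) * G (P ω) ∂Pr - (∫ ω, F (P ω) ∂Pr) * ∫ ω, G (P ω) ∂Pr| ≤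
      3 ^ (U.card + W.card) * (B * B') * ε := by
  classical
  obtain ⟨a, ha, ha'⟩ := exists_spin_expansion U F B hF hB
  obtain ⟨b, hb, hb'⟩ := exists_spin_expansion W G B' hG hB'
  have hms : ∀ A : Finset V, MeasurableSet {ω | (A : Set V) ⊆ P ω} := fun A =>
    hP (measurableSet_subset_spin A)
  have hind : ∀ A : Finset V, (fun ω => if (A : Set V) ⊆ P ω then (1 : ℝ) else 0) =
      {ω | (A : Set V) ⊆ P ω}.indicator 1 := by
    intro A; funext ω; simp [Set.indicator_apply]
  have hint : ∀ A : Finset V, Integrable (fun ω => if (A : Set V) ⊆ P ω then (1 : ℝ) else 0) Pr := by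
    intro A
    rw [hind]
    exact (integrable_const (1 : ℝ)).indicator (hms A)
  have hE : ∀ A : Finset V, ∫ ω, (if (A : Set V) ⊆ P ω then (1 : ℝ) else 0) ∂Pr =
      Pr.real {ω | (A : Set V) ⊆ P ω} := by
    intro A
    rw [hind, integral_indicator_one (hms A)]
  have hmul : ∀ (A A' : Finset V) (μ : Set V), (if (A : Set V) ⊆ μ then (1 : ℝ) else 0) *
      (if (A' : Set V) ⊆ μ then 1 else 0) = if ((A ∪ A' : Finset V) : Set V) ⊆ μ then 1 else 0 := by
    intro A A' μ
    rw [Finset.coe_union]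
    simp only [Set.union_subset_iff]
    split_ifs <;> simp_all
  have h1 : ∫ ω, F (P ω) ∂Pr = ∑ A ∈ U.powerset, a A * Pr.real {ω | (A : Set V) ⊆ P ω} := by
    simp only [ha]
    rw [integral_finsetSum _ fun A _ => (hint A).const_mul _]
    simp only [integral_const_mul, hE]
  have h2 : ∫ ω, G (P ω) ∂Pr = ∑ A ∈ W.powerset, b A * Pr.real {ω | (A : Set V) ⊆ P ω} := by
    simp only [hb]
    rw [integral_finsetSum _ fun A _ => (hint A).const_mul _]
    simp only [integral_const_mul, hE]
  have h3 : ∫ ω, F (P ω) * G (P ω) ∂Pr = ∑ A ∈ U.powerset, ∑ A' ∈ W.powerset,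
      a A * b A' * Pr.real {ω | (A : Set V) ∪ (A' : Set V) ⊆ P ω} := by
    have : ∀ ω, F (P ω) * G (P ω) = ∑ A ∈ U.powerset, ∑ A' ∈ W.powerset,
        a A * b A' * if ((A ∪ A' : Finset V) : Set V) ⊆ P ω then 1 else 0 := by
      intro ω
      rw [ha, hb, Finset.sum_mul_sum]
      refine Finset.sum_congr rfl fun A _ => Finset.sum_congr rfl fun A' _ => ?_
      rw [← hmul]; ring
    simp only [this]
    rw [integral_finsetSum _ fun A _ => integrable_finsetSum _ fun A' _ => (hint _).const_mul _]
    refine Finset.sum_congr rfl fun A _ => ?_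
    rw [integral_finsetSum _ fun A' _ => (hint _).const_mul _]
    refine Finset.sum_congr rfl fun A' _ => ?_
    rw [integral_const_mul, hE, Finset.coe_union]
  rw [h1, h2, h3, Finset.sum_mul_sum]
  simp only [← Finset.sum_sub_distrib]
  have hbound : ∑ A ∈ U.powerset, ∑ A' ∈ W.powerset, |a A| * |b A'| * ε ≤
      3 ^ (U.card + W.card) * (B * B') * ε := by
    simp only [← Finset.sum_mul, ← Finset.sum_mul_sum]
    refine mul_le_mul_of_nonneg_right ?_ hε
    have := mul_le_mul ha' hb' (Finset.sum_nonneg fun _ _ => abs_nonneg _)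
      ((Finset.sum_nonneg fun _ _ => abs_nonneg _).trans ha')
    refine this.trans_eq ?_
    rw [pow_add]; ring
  refine le_trans ?_ hbound
  refine (Finset.abs_sum_le_sum_abs _ _).trans (Finset.sum_le_sum fun A hA => ?_)
  refine (Finset.abs_sum_le_sum_abs _ _).trans (Finset.sum_le_sum fun A' hA' => ?_)
  rw [← abs_mul]
  have := mul_le_mul_of_nonneg_left (hcov A (Finset.mem_powerset.1 hA) A'
    (Finset.mem_powerset.1 hA')) (abs_nonneg (a A * b A'))
  rw [← abs_mul] at this
  refine le_of_eq_of_le ?_ this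
  congr 1
  ring

theorem IsFastDecreasing.tendsto_zero {φ : ℝ → ℝ} (hφ : IsFastDecreasing φ) :
    Tendsto φ atTop (𝓝 0) := by
  have h := (hφ.decay 1 le_rfl).mul tendsto_inv_atTop_zero
  rw [zero_mul] at h
  refine h.congr' ?_
  filter_upwards [eventually_gt_atTop 0] with s hs
  field_simp

theorem IsFastDecreasing.nonneg {φ : ℝ → ℝ} (hφ : IsFastDecreasing φ) {s : ℝ} (hs : 0 ≤ s) :
    0 ≤ φ s := by
  refine le_of_tendsto hφ.tendsto_zero ?_
  filter_upwards [eventually_ge_atTop s] with u hu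
  exact hφ.antitone hs (hs.trans hu) hu

end

section

variable {V : Type*} [AddGroup V] {S : Finset V} {Ω : Type*} [MeasurableSpace Ω] {Pr : Measure Ω}
  [IsProbabilityMeasure Pr] {P : Ω → Set V} {φ : ℝ → ℝ} {C c : ℕ → ℝ}

theorem IsClusteringWith.abs_sub_le (h : IsClusteringWith S Pr P φ C c) {U W : Finset V} {δ N : ℕ}
    (hδ : 0 < δ) (hdist : ∀ u ∈ U, ∀ w ∈ W, δ ≤ gdist S u w) (hN : U.card + W.card ≤ N) {ε : ℝ}
    (hε : 0 ≤ ε) (hε' : ∀ m ≤ N, |C m| * φ (c m * δ) ≤ ε) (A : Finset V) (hA : A ⊆ U)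
    (B : Finset V) (hB : B ⊆ W) :
    |Pr.real {ω | (A : Set V) ∪ (B : Set V) ⊆ P ω}
        - Pr.real {ω | (A : Set V) ⊆ P ω} * Pr.real {ω | (B : Set V) ⊆ P ω}| ≤ ε := by
  -- Clustering is assumed for nonempty sets only, but the constant term of the spin expansion is
  -- the empty product; its covariance is zero.
  rcases A.eq_empty_or_nonempty with rfl | hAne
  · simpa using hε
  rcases B.eq_empty_or_nonempty with rfl | hBne
  · simpa using hε
  have hdisj : Disjoint A B := by
    rw [Finset.disjoint_left]
    intro x hx hx'
    have := hdist x (hA hx) x (hB hx')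
    rw [gdist_self] at this
    omega
  have hm : A.card + B.card ≤ N :=
    (add_le_add (Finset.card_le_card hA) (Finset.card_le_card hB)).trans hN
  refine (h.clustering A B hAne hBne hdisj).trans (le_trans ?_ (hε' _ hm))
  have hsd : δ ≤ setDist S A B := by
    obtain ⟨x, hx⟩ := hAne
    obtain ⟨y, hy⟩ := hBne
    refine le_csInf ⟨_, x, hx, y, hy, rfl⟩ ?_
    rintro k ⟨x, hx, y, hy, rfl⟩
    exact hdist x (hA hx) y (hB hy)
  have hc := h.c_pos (A.card + B.card)
  have h0 : (0 : ℝ) ≤ c (A.card + B.card) * δ := by positivity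
  have h1 : c (A.card + B.card) * δ ≤ c (A.card + B.card) * setDist S A B :=
    mul_le_mul_of_nonneg_left (by exact_mod_cast hsd) hc.le
  have h2 := h.fastDecreasing.antitone (Set.mem_Ici.2 h0) (Set.mem_Ici.2 (h0.trans h1)) h1
  exact (mul_le_mul_of_nonneg_right (le_abs_self _)
    (h.fastDecreasing.nonneg (h0.trans h1))).trans (mul_le_mul_of_nonneg_left h2 (abs_nonneg _))

/-- Products of local functions around distant points are almost uncorrelated. -/
theorem IsClusteringWith.abs_mixedMoment_sub_le (hS : IsGeneratingSet S)
    (h : IsClusteringWith S Pr P φ C c) {k t : ℕ} {f : V → Set V → ℝ} {x : Fin k → V}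
    (hf : ∀ i μ, f (x i) μ = f (x i) (μ ∩ ball S t (x i))) {B : ℝ} (hB1 : 1 ≤ B)
    (hB : ∀ i μ, |f (x i) μ| ≤ B) {s : ℕ} (hs : 2 * t < s) (I : Set (Fin k))
    [DecidablePred (· ∈ I)] (hI : ∀ i ∈ I, ∀ j ∉ I, s ≤ gdist S (x i) (x j)) {ε : ℝ}
    (hε : 0 ≤ ε) (hε' : ∀ m ≤ k * vol S t, |C m| * φ (c m * (s - 2 * t : ℕ)) ≤ ε)
    (A : Finset (Fin k)) :
    |mixedMoment Pr (fun y ω => f y (P ω)) x A -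
      mixedMoment Pr (fun y ω => f y (P ω)) x (A.filter (· ∈ I)) *
      mixedMoment Pr (fun y ω => f y (P ω)) x (A.filter (· ∉ I))| ≤
      3 ^ (k * vol S t) * B ^ k * ε := by
  classical
  set U : Finset (Fin k) → Finset V := fun A => A.biUnion fun i => ballFinset hS t (x i) with hU
  have hUcard : ∀ A, (U A).card ≤ A.card * vol S t := fun A =>
    Finset.card_biUnion_le_card_mul _ _ _ fun i _ => (card_ballFinset hS t (x i)).le
  have hloc : ∀ (A : Finset (Fin k)) (μ : Set V), ∏ i ∈ A, f (x i) μ =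
      ∏ i ∈ A, f (x i) (μ ∩ U A) := by
    intro A μ
    refine Finset.prod_congr rfl fun i hi => ?_
    rw [hf i μ, hf i (μ ∩ U A), Set.inter_assoc]
    congr 2
    rw [eq_comm, Set.inter_eq_right, ← coe_ballFinset hS, Finset.coe_subset]
    exact Finset.subset_biUnion_of_mem (fun i => ballFinset hS t (x i)) hi
  have hbd : ∀ (A : Finset (Fin k)) (μ : Set V), |∏ i ∈ A, f (x i) μ| ≤ B ^ A.card := by
    intro A μ
    rw [Finset.abs_prod]
    exact (Finset.prod_le_prod (fun _ _ => abs_nonneg _) fun i _ => hB i μ).trans_eq (by simp)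
  have hcardA : (A.filter (· ∈ I)).card + (A.filter (· ∉ I)).card ≤ k := by
    rw [Finset.card_filter_add_card_filter_not]
    simpa using Finset.card_le_univ A
  have hN : (U (A.filter (· ∈ I))).card + (U (A.filter (· ∉ I))).card ≤ k * vol S t := by
    refine (add_le_add (hUcard _) (hUcard _)).trans ?_
    rw [← add_mul]
    exact Nat.mul_le_mul_right _ hcardA
  have hdist : ∀ u ∈ U (A.filter (· ∈ I)), ∀ w ∈ U (A.filter (· ∉ I)),
      s - 2 * t ≤ gdist S u w := by
    intro u hu w hw
    obtain ⟨i, hi, hiu⟩ := Finset.mem_biUnion.1 hu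
    obtain ⟨j, hj, hjw⟩ := Finset.mem_biUnion.1 hw
    rw [mem_ballFinset] at hiu hjw
    have h1 := hI i (Finset.mem_filter.1 hi).2 j (Finset.mem_filter.1 hj).2
    have h2 := gdist_triangle hS (x i) u (x j)
    have h3 := gdist_triangle hS u w (x j)
    rw [gdist_comm w] at h3
    omega
  have hcov := abs_covariance_local_le (Pr := Pr) h.spinModel.measurable
    (hloc (A.filter (· ∈ I))) (hloc (A.filter (· ∉ I))) (hbd _) (hbd _) hε
    (h.abs_sub_le (by omega) hdist hN hε hε')
  have hprod : ∀ ω, ∏ i ∈ A, f (x i) (P ω) =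
      (∏ i ∈ A.filter (· ∈ I), f (x i) (P ω)) * ∏ i ∈ A.filter (· ∉ I), f (x i) (P ω) := fun ω =>
    (Finset.prod_filter_mul_prod_filter_not A (· ∈ I) fun i => f (x i) (P ω)).symm
  unfold mixedMoment
  simp only [hprod]
  refine hcov.trans (mul_le_mul_of_nonneg_right ?_ hε)
  rw [← pow_add]
  exact mul_le_mul (pow_le_pow_right₀ (by norm_num) hN) (pow_le_pow_right₀ hB1 hcardA)
    (by positivity) (by positivity)

end

/-! ## Variables with finite moments -/

section

variable {Ω : Type*} [MeasurableSpace Ω] {Pr : Measure Ω}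

/-- All absolute moments are finite. -/
def HasAllMoments (Pr : Measure Ω) (f : Ω → ℝ) : Prop := ∀ p : ℕ, MemLp f p Pr

theorem HasAllMoments.mul {f g : Ω → ℝ} (hf : HasAllMoments Pr f) (hg : HasAllMoments Pr g) :
    HasAllMoments Pr fun ω => f ω * g ω := by
  intro p
  have : ENNReal.HolderTriple ((2 * p : ℕ) : ℝ≥0∞) ((2 * p : ℕ) : ℝ≥0∞) (p : ℝ≥0∞) := by
    refine ⟨?_⟩
    push_cast
    rw [ENNReal.mul_inv (by simp) (by simp), ← add_mul, ENNReal.inv_two_add_inv_two, one_mul]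
  exact (hg (2 * p)).mul' (hf (2 * p))

theorem HasAllMoments.sum {ι : Type*} {f : ι → Ω → ℝ} (A : Finset ι)
    (hf : ∀ i ∈ A, HasAllMoments Pr (f i)) : HasAllMoments Pr fun ω => ∑ i ∈ A, f i ω :=
  fun p => memLp_finsetSum A fun i hi => hf i hi p

theorem HasAllMoments.integrable {f : Ω → ℝ} (hf : HasAllMoments Pr f) : Integrable f Pr :=
  memLp_one_iff_integrable.1 (by simpa using hf 1)

variable [IsProbabilityMeasure Pr]

theorem hasAllMoments_of_bound {f : Ω → ℝ} (hf : AEStronglyMeasurable f Pr) {B : ℝ}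
    (hB : ∀ ω, |f ω| ≤ B) : HasAllMoments Pr f := fun _ =>
  MemLp.of_bound hf B (Eventually.of_forall hB)

theorem HasAllMoments.prod {ι : Type*} {f : ι → Ω → ℝ} (A : Finset ι)
    (hf : ∀ i ∈ A, HasAllMoments Pr (f i)) : HasAllMoments Pr fun ω => ∏ i ∈ A, f i ω := by
  classical
  induction A using Finset.induction_on with
  | empty => exact fun p => by simpa using memLp_const (1 : ℝ)
  | insert a A ha ih =>
    simp only [Finset.prod_insert ha]
    exact (hf a (Finset.mem_insert_self _ _)).mul
      (ih fun i hi => hf i (Finset.mem_insert_of_mem hi))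

theorem HasAllMoments.sub_const {f : Ω → ℝ} (hf : HasAllMoments Pr f) (e : ℝ) :
    HasAllMoments Pr fun ω => f ω - e := fun p => (hf p).sub (memLp_const e)

theorem HasAllMoments.integrable_pow {f : Ω → ℝ} (hf : HasAllMoments Pr f) (j : ℕ) :
    Integrable (fun ω => f ω ^ j) Pr := by
  have := (HasAllMoments.prod (Finset.range j) fun _ _ => hf).integrable
  simpa using this

end

theorem abs_mixedMoment_le_of_bound {V : Type*} {Ω : Type*} [MeasurableSpace Ω]
    {Pr : Measure Ω} [IsProbabilityMeasure Pr] {k : ℕ} {Y : V → Ω → ℝ}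
    {x : Fin k → V} {B : ℝ} (hB1 : 1 ≤ B) (hB : ∀ i ω, |Y (x i) ω| ≤ B) (A : Finset (Fin k)) :
    |mixedMoment Pr Y x A| ≤ B ^ k := by
  have h1 : ∀ ω, ‖∏ i ∈ A, Y (x i) ω‖ ≤ B ^ k := by
    intro ω
    rw [Real.norm_eq_abs, Finset.abs_prod]
    refine (Finset.prod_le_prod (fun _ _ => abs_nonneg _) fun i _ => hB i ω).trans ?_
    rw [Finset.prod_const]
    exact pow_le_pow_right₀ hB1 (by simpa using Finset.card_le_univ A)
  have := norm_integral_le_of_norm_le_const (μ := Pr) (Eventually.of_forall h1)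
  simpa [mixedMoment] using this

/-! ## Scores -/

theorem measurable_inter_const {V : Type*} (B : Set V) : Measurable fun μ : Set V => μ ∩ B := by
  refine measurable_set_iff.2 fun a => ?_
  by_cases ha : a ∈ B
  · simpa [ha] using measurable_set_mem a
  · simp [ha]

section

variable {V : Type*} [AddGroup V] {S : Finset V} {Ω : Type*} [MeasurableSpace Ω] {Pr : Measure Ω}
  {P : Ω → Set V} {ξ : V → Set V → ℝ}

theorem mem_translate {y z : V} {μ : Set V} : z ∈ translate y μ ↔ -y + z ∈ μ := by
  constructor
  · rintro ⟨w, hw, rfl⟩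
    simpa using hw
  · intro h
    exact ⟨_, h, by simp⟩

theorem translate_inter_ball (hS : IsGeneratingSet S) (x : V) (μ : Set V) (t : ℕ) :
    translate (-x) μ ∩ ball S t 0 = translate (-x) (μ ∩ ball S t x) := by
  ext z
  rw [Set.mem_inter_iff, mem_translate, mem_translate, Set.mem_inter_iff, neg_neg,
    ← neg_add_mem_ball hS (x := x), neg_add_cancel_left]

theorem IsScoreFunction.eq_translate (hξ : IsScoreFunction ξ) (x : V) (μ : Set V) :
    ξ x μ = ξ 0 (translate (-x) μ) := by
  rw [← hξ.translation_invariant (-x) x μ, neg_add_cancel]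

/-- Scores vanish off the configuration, so the random index set can be replaced by the whole ball.
-/
theorem totalMass_eq_sum (hS : IsGeneratingSet S) (hξ : IsScoreFunction ξ) (n : ℕ) (μ : Set V) :
    totalMass S ξ n μ = ∑ x ∈ ballFinset hS n 0, ξ x (μ ∩ ball S n 0) := by
  refine finsum_mem_eq_sum_of_inter_support_eq _ ?_
  rw [coe_ballFinset]
  ext x
  simp only [Set.mem_inter_iff, Function.mem_support]
  constructor
  · tauto
  · rintro ⟨h1, h2⟩
    refine ⟨⟨?_, h1⟩, h2⟩
    by_contra hx
    exact h2 (hξ.eq_zero _ _ fun h => hx h.1)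

/-- The scores in the window `W_n`, centred. -/
def centredScore (S : Finset V) (Pr : Measure Ω) (P : Ω → Set V) (ξ : V → Set V → ℝ) (n : ℕ) (x : V)
    (ω : Ω) : ℝ := ξ x (P ω ∩ ball S n 0) - ∫ ω', ξ x (P ω' ∩ ball S n 0) ∂Pr

theorem measurable_score (hξ : IsScoreFunction ξ) (hP : Measurable P) (x : V) (B : Set V) :
    Measurable fun ω => ξ x (P ω ∩ B) :=
  (hξ.measurable x).comp ((measurable_inter_const B).comp hP)

/-- The central limit theorem for scores with clustering moments. -/
theorem tendstoInDistribution_totalMass [Infinite V] [IsProbabilityMeasure Pr]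
    (hS : IsGeneratingSet S) (hξ : IsScoreFunction ξ) (hP : Measurable P)
    (hmom : ∀ᶠ n : ℕ in atTop, ∀ x ∈ ballFinset hS n 0,
      HasAllMoments Pr fun ω => ξ x (P ω ∩ ball S n 0))
    (hcl : ∀ p : ℕ, 1 ≤ p → ∃ K ψ, 0 ≤ K ∧ IsSummableRate S ψ ∧ ∀ᶠ n : ℕ in atTop,
      HasClusteringMoments S Pr (ballFinset hS n 0) (centredScore S Pr P ξ n) (p + 1) K ψ)
    (ν : ℝ) (hν : 0 < ν)
    (hvar : (fun n : ℕ => (vol S n : ℝ) ^ ν) =O[atTop]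
      fun n : ℕ => Var[fun ω => totalMass S ξ n (P ω); Pr]) :
    TendstoInDistribution
      (fun (n : ℕ) (ω : Ω) => (totalMass S ξ n (P ω) - ∫ ω', totalMass S ξ n (P ω') ∂Pr) /
          √(Var[fun ω' => totalMass S ξ n (P ω'); Pr]))
      atTop (id : ℝ → ℝ) (fun _ => Pr) (gaussianReal 0 1) := by
  have hmeas : ∀ n, Measurable fun ω => totalMass S ξ n (P ω) := by
    intro n
    simp only [totalMass_eq_sum hS hξ]
    exact Finset.measurable_fun_sum _ fun x _ => measurable_score hξ hP x _
  have hvareq : ∀ n, Var[fun ω => totalMass S ξ n (P ω); Pr] =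
      ∫ ω, (totalMass S ξ n (P ω) - ∫ ω', totalMass S ξ n (P ω') ∂Pr) ^ 2 ∂Pr := fun n =>
    variance_eq_integral (hmeas n).aemeasurable
  have hall : ∀ᶠ n : ℕ in atTop, HasAllMoments Pr fun ω => totalMass S ξ n (P ω) := by
    filter_upwards [hmom] with n hn
    simp only [totalMass_eq_sum hS hξ]
    exact HasAllMoments.sum _ hn
  simp only [hvareq] at hvar ⊢
  refine tendstoInDistribution_of_clustering hS (Y := centredScore S Pr P ξ)
    (H := fun n ω => totalMass S ξ n (P ω) - ∫ ω', totalMass S ξ n (P ω') ∂Pr)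
    (fun n => ((hmeas n).sub_const _).aemeasurable) ?_ ?_ ?_ hν hvar hcl
  · filter_upwards [hmom] with n hn ω
    simp only [totalMass_eq_sum hS hξ, centredScore]
    rw [Finset.sum_sub_distrib, integral_finsetSum _ fun x hx => (hn x hx).integrable]
  · filter_upwards [hall] with n hn j
    exact (hn.sub_const _).integrable_pow j
  · filter_upwards [hall] with n hn
    rw [integral_sub hn.integrable (integrable_const _)]
    simp

theorem summableIn_indicator (hS : IsGeneratingSet S) (R : ℝ) {Q : ℝ} :
    IsSummableIn S fun s => if s ≤ R then Q else 0 := by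
  intro c hc p hp
  refine summable_of_hasFiniteSupport ((finite_ball hS ⌈R / c⌉₊ 0).subset fun x hx => ?_)
  rw [mem_ball hS]
  have h1 : c * gdist S 0 x ≤ R := by
    by_contra h
    refine hx ?_
    simp only
    rw [if_neg h, Real.zero_rpow (by positivity)]
  have h2 : (gdist S 0 x : ℝ) ≤ R / c := by rw [le_div_iff₀ hc]; linarith
  exact_mod_cast h2.trans (Nat.le_ceil _)

/-- The map `u ↦ u ^ (1 / p)` is subadditive for `p ≥ 1`. -/
theorem IsSummableIn.add {φ ψ : ℝ → ℝ} (hφ : IsSummableIn S φ) (hψ : IsSummableIn S ψ)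
    (hφ0 : ∀ s, 0 ≤ s → 0 ≤ φ s) (hψ0 : ∀ s, 0 ≤ s → 0 ≤ ψ s) :
    IsSummableIn S fun s => φ s + ψ s := by
  intro c hc p hp
  have hp' : (1 : ℝ) ≤ p := by exact_mod_cast hp
  have h0 : ∀ x : V, 0 ≤ c * gdist S 0 x := fun x => by positivity
  refine Summable.of_nonneg_of_le (fun x => ?_) (fun x => ?_) ((hφ c hc p hp).add (hψ c hc p hp))
  · exact Real.rpow_nonneg (add_nonneg (hφ0 _ (h0 x)) (hψ0 _ (h0 x))) _
  · refine Real.rpow_add_le_add_rpow (hφ0 _ (h0 x)) (hψ0 _ (h0 x)) (by positivity) ?_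
    rw [div_le_one (by linarith)]
    exact hp'

/-- The `max` keeps the argument of `φ` in `[0, ∞)`, since a rate has to be nonnegative on the whole
line. -/
theorem IsSummableIn.const_mul {φ : ℝ → ℝ} (hφ : IsSummableIn S φ) {Q a : ℝ} (hQ : 0 ≤ Q)
    (ha : 0 < a) (hφ0 : ∀ s, 0 ≤ s → 0 ≤ φ s) : IsSummableIn S fun s => Q * φ (a * max s 0) := by
  intro c hc p hp
  refine ((hφ (a * c) (by positivity) p hp).mul_left (Q ^ (1 / (p : ℝ)))).congr fun x => ?_
  simp only
  rw [max_eq_left (by positivity), ← mul_assoc, Real.mul_rpow hQ (hφ0 _ (by positivity))]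

/-- A rate of decay which is only prescribed for large distances. -/
theorem isSummableRate_of_eventually (hS : IsGeneratingSet S) {φ : ℝ → ℝ}
    (hφ : AntitoneOn φ (Set.Ici 0)) (hφ0 : ∀ s, 0 ≤ s → 0 ≤ φ s) (hsum : IsSummableIn S φ)
    {Q Q' a R : ℝ} (hQ : 0 ≤ Q) (hQ' : 1 ≤ Q') (ha : 0 < a) (hR : 0 ≤ R) :
    IsSummableRate S fun s => Q * φ (a * max s 0) + if s ≤ R then Q' else 0 := by
  have hpos : ∀ s : ℝ, 0 ≤ a * max s 0 := fun s => mul_nonneg ha.le (le_max_right _ _)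
  have hind : ∀ s : ℝ, 0 ≤ if s ≤ R then Q' else 0 := fun s => by split_ifs <;> linarith
  refine ⟨fun s _ u _ hsu => ?_, fun s => ?_, ?_, ?_⟩
  · refine add_le_add (mul_le_mul_of_nonneg_left (hφ (hpos s) (hpos u) ?_) hQ) ?_
    · exact mul_le_mul_of_nonneg_left (max_le_max_right _ hsu) ha.le
    · split_ifs <;> linarith
  · exact add_nonneg (mul_nonneg hQ (hφ0 _ (hpos s))) (hind s)
  · simp only [if_pos hR]
    have := mul_nonneg hQ (hφ0 _ (hpos 0))
    linarith
  · exact (hsum.const_mul hQ ha hφ0).add (summableIn_indicator hS R)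
      (fun s _ => mul_nonneg hQ (hφ0 _ (hpos s))) fun s _ => hind s

/-! ### Local scores -/

/-- A finite ball carries only finitely many configurations, so a local score is bounded. -/
theorem exists_local_score (hS : IsGeneratingSet S) (hξ : IsScoreFunction ξ) (hloc : IsLocal S ξ) :
    ∃ (r : ℕ) (B : ℝ), 0 ≤ B ∧ ∀ x μ, ξ x μ = ξ x (μ ∩ ball S r x) ∧ |ξ x μ| ≤ B := by
  obtain ⟨r, hr, ξ₀, hξ₀⟩ := hloc
  have hfin : ((fun T => |ξ₀ T|) '' {T | T ⊆ ball S r 0}).Finite :=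
    (finite_ball hS r 0).finite_subsets.image _
  obtain ⟨B, hB⟩ := hfin.bddAbove
  have hb : ∀ μ, |ξ 0 μ| ≤ B := fun μ => by
    rw [hξ₀ μ]
    exact hB ⟨_, Set.inter_subset_right, rfl⟩
  refine ⟨r, B, (abs_nonneg _).trans (hb ∅), fun x μ => ⟨?_, ?_⟩⟩
  · rw [hξ.eq_translate x μ, hξ.eq_translate x (μ ∩ ball S r x), ← translate_inter_ball hS,
      hξ₀ (translate (-x) μ), hξ₀ (translate (-x) μ ∩ ball S r 0), Set.inter_assoc, Set.inter_self]
  · rw [hξ.eq_translate]; exact hb _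

/-- For groups at distance `s > 4 r` the balls of radius `r` around them are at distance at least `s
- 2 r ≥ s / 2`, and the clustering of the model applies. Shorter distances are covered by the
indicator term of the rate. -/
theorem hasClusteringMoments_of_local [IsProbabilityMeasure Pr] (hS : IsGeneratingSet S)
    (hξ : IsScoreFunction ξ) (hP : IsSummablyClustering S Pr P) (hloc : IsLocal S ξ) (k : ℕ) :
    ∃ K ψ, 0 ≤ K ∧ IsSummableRate S ψ ∧ ∀ n : ℕ,
      HasClusteringMoments S Pr (ballFinset hS n 0) (centredScore S Pr P ξ n) k K ψ := by
  obtain ⟨φ, C, c, hcl, hsum⟩ := hP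
  obtain ⟨r, B₀, hB₀, hB⟩ := exists_local_score hS hξ hloc
  set B := 2 * B₀ + 1 with hBdef
  have hB1 : 1 ≤ B := by linarith
  set N := k * vol S r with hN
  -- At most `N` spins are involved, so the smallest `c m` and the sum of the `|C m|` over `m ≤ N`
  -- serve all of them.
  obtain ⟨m₀, -, hm₀⟩ := Finset.exists_min_image (Finset.range (N + 1)) c ⟨0, by simp⟩
  have hc0 := hcl.c_pos m₀
  set Q := ∑ m ∈ Finset.range (N + 1), |C m| with hQ
  have hQ0 : 0 ≤ Q := Finset.sum_nonneg fun _ _ => abs_nonneg _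
  have hφ0 : ∀ s, 0 ≤ s → 0 ≤ φ s := fun s hs => hcl.fastDecreasing.nonneg hs
  refine ⟨B ^ k, fun s => 3 ^ N * B ^ k * Q * φ (c m₀ / 2 * max s 0) +
    if s ≤ (4 * r : ℕ) then B ^ k + B ^ k * B ^ k + 1 else 0, by positivity,
    isSummableRate_of_eventually hS hcl.fastDecreasing.antitone hφ0 hsum (by positivity) ?_
      (by positivity) (by positivity), fun n x hx => ?_⟩
  · have : 0 ≤ B ^ k := by positivity
    nlinarith
  set f : V → Set V → ℝ := fun y μ => ξ y (μ ∩ ball S n 0) - ∫ ω', ξ y (P ω' ∩ ball S n 0) ∂Pr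
    with hf
  have hfloc : ∀ i μ, f (x i) μ = f (x i) (μ ∩ ball S r (x i)) := by
    intro i μ
    simp only [hf]
    rw [(hB (x i) (μ ∩ ball S n 0)).1, Set.inter_right_comm]
  have hfB : ∀ y μ, |f y μ| ≤ B := by
    intro y μ
    have h1 : |∫ ω', ξ y (P ω' ∩ ball S n 0) ∂Pr| ≤ B₀ := by
      simpa using norm_integral_le_of_norm_le_const (μ := Pr)
        (f := fun ω' => ξ y (P ω' ∩ ball S n 0))
        (Eventually.of_forall fun ω' => (hB y (P ω' ∩ ball S n 0)).2)
    refine (abs_sub _ _).trans ?_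
    linarith [(hB y (μ ∩ ball S n 0)).2]
  have hmom : ∀ y, HasAllMoments Pr (centredScore S Pr P ξ n y) := fun y =>
    hasAllMoments_of_bound ((measurable_score hξ hcl.spinModel.measurable y
      _).sub_const _).aestronglyMeasurable (B := B) fun ω => hfB y (P ω)
  have hK := abs_mixedMoment_le_of_bound (Pr := Pr) (Y := centredScore S Pr P ξ n) (x := x) hB1
    fun i ω => hfB (x i) (P ω)
  refine ⟨fun A => (HasAllMoments.prod A fun i _ => hmom (x i)).integrable, hK,
    fun s I _ hs hI A => ?_⟩
  have hφs : 0 ≤ φ (c m₀ / 2 * max (s : ℝ) 0) := hφ0 _ (by positivity)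
  rcases le_or_gt s (4 * r) with hsr | hsr
  · have hsr' : (s : ℝ) ≤ (4 * r : ℕ) := by exact_mod_cast hsr
    simp only [if_pos hsr']
    refine (abs_sub _ _).trans ?_
    rw [abs_mul]
    have h1 := mul_le_mul (hK (A.filter (· ∈ I))) (hK (A.filter (· ∉ I))) (abs_nonneg _)
      (by positivity)
    have h2 : 0 ≤ 3 ^ N * B ^ k * Q * φ (c m₀ / 2 * max (s : ℝ) 0) := by positivity
    linarith [hK A]
  · have hsr' : ¬ (s : ℝ) ≤ (4 * r : ℕ) := by rw [not_le]; exact_mod_cast hsr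
    simp only [if_neg hsr', add_zero]
    have := hcl.abs_mixedMoment_sub_le hS (f := f) (x := x) hfloc hB1 (fun i μ => hfB (x i) μ)
      (by omega : 2 * r < s) I hI (ε := Q * φ (c m₀ / 2 * max (s : ℝ) 0)) (by positivity)
      (fun m hm => ?_) A
    · refine this.trans_eq ?_
      ring
    · have hm' : m ∈ Finset.range (N + 1) := by rw [Finset.mem_range]; omega
      refine mul_le_mul (Finset.single_le_sum (f := fun m => |C m|) (fun _ _ => abs_nonneg _) hm')
        ?_ (hφ0 _ (mul_nonneg (hcl.c_pos m).le (by positivity))) hQ0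
      refine hcl.fastDecreasing.antitone (Set.mem_Ici.2 (by positivity))
        (Set.mem_Ici.2 (mul_nonneg (hcl.c_pos m).le (by positivity))) ?_
      rw [max_eq_left (by positivity)]
      have h1 : (s : ℝ) / 2 ≤ (s - 2 * r : ℕ) := by
        rw [Nat.cast_sub (by omega)]
        have : (4 * r : ℝ) < s := by exact_mod_cast hsr
        push_cast
        linarith
      calc c m₀ / 2 * s = c m₀ * (s / 2) := by ring
        _ ≤ c m * (s - 2 * r : ℕ) :=
          mul_le_mul (hm₀ m hm') h1 (by positivity) (hcl.c_pos m).le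

end

/-! ## Stretched exponential decay and polynomial growth -/

theorem HasStretchedExpDecay.eventually_le {φ : ℝ → ℝ} {b : ℝ} (h : HasStretchedExpDecay φ b) :
    ∃ δ : ℝ, 0 < δ ∧ ∀ᶠ t in atTop, φ t ≤ Real.exp (-δ * t ^ b) := by
  obtain ⟨r, hr, hr0⟩ := EReal.lt_iff_exists_real_btwn.1 h
  have hr0' : r < 0 := by exact_mod_cast hr0
  refine ⟨-r, by linarith, ?_⟩
  filter_upwards [eventually_lt_of_limsup_lt hr, eventually_gt_atTop 0] with t ht ht0
  have hp : 0 < t ^ b := Real.rpow_pos_of_pos ht0 b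
  rw [EReal.div_lt_iff (by exact_mod_cast hp) (EReal.coe_ne_top _)] at ht
  rw [neg_neg]
  -- Nonpositive values have logarithm `-∞` in the definition of the decay and satisfy the bound
  -- trivially.
  rcases le_or_gt (φ t) 0 with h0 | h0
  · exact h0.trans (Real.exp_pos _).le
  · rw [ENNReal.log_ofReal_of_pos h0, ← EReal.coe_mul, EReal.coe_lt_coe_iff] at ht
    rw [← Real.log_le_iff_le_exp h0]
    exact ht.le

/-- The range before the asymptotic regime is absorbed into the constant. The start `s₀` is `0` for
clustering functions and `1` for tails of the radius of stabilisation. -/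
theorem HasStretchedExpDecay.exists_le_of_bound {φ : ℝ → ℝ} {b : ℝ} (h : HasStretchedExpDecay φ b)
    (hb : 0 < b) {s₀ B : ℝ} (hs₀ : 0 ≤ s₀) (hB : ∀ s, s₀ ≤ s → φ s ≤ B) :
    ∃ A δ : ℝ, 0 < A ∧ 0 < δ ∧ ∀ s, s₀ ≤ s → φ s ≤ A * Real.exp (-δ * s ^ b) := by
  obtain ⟨δ, hδ, hev⟩ := h.eventually_le
  obtain ⟨T, hT⟩ := eventually_atTop.1 hev
  refine ⟨1 + |B| * Real.exp (δ * (max T 0) ^ b), δ, by positivity, hδ, fun s hs => ?_⟩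
  have hs0 := hs₀.trans hs
  have he := Real.exp_pos (-δ * s ^ b)
  rcases le_or_gt T s with hTs | hTs
  · refine (hT s hTs).trans (le_mul_of_one_le_left he.le ?_)
    have : 0 ≤ |B| * Real.exp (δ * (max T 0) ^ b) := by positivity
    linarith
  · have h1 : 1 ≤ Real.exp (δ * (max T 0) ^ b) * Real.exp (-δ * s ^ b) := by
      rw [← Real.exp_add, Real.one_le_exp_iff]
      have : s ^ b ≤ (max T 0) ^ b :=
        Real.rpow_le_rpow hs0 (hTs.le.trans (le_max_left _ _)) hb.le
      nlinarith
    have h2 := mul_le_mul_of_nonneg_left h1 (abs_nonneg B)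
    nlinarith [hB s hs, le_abs_self B]

section

variable {V : Type*} [AddGroup V] {S : Finset V}

theorem HasPolynomialGrowth.exists_le (h : HasPolynomialGrowth S) :
    ∃ (G : ℝ) (d : ℕ), 1 ≤ G ∧ ∀ n : ℕ, 1 ≤ n → (vol S n : ℝ) ≤ G * (n : ℝ) ^ d := by
  obtain ⟨d₂, hd₂, hO⟩ := h
  obtain ⟨G, hG, hbd⟩ := bound_of_isBigO_nat_atTop hO
  refine ⟨max G 1, ⌈d₂⌉₊, le_max_right _ _, fun n hn => ?_⟩
  have hn' : (1 : ℝ) ≤ n := by exact_mod_cast hn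
  have h1 := hbd (x := n) (Real.rpow_pos_of_pos (by linarith) _).ne'
  rw [Real.norm_of_nonneg (by positivity), Real.norm_of_nonneg (by positivity)] at h1
  refine h1.trans (mul_le_mul (le_max_left _ _) ?_ (by positivity) (by positivity))
  rw [← Real.rpow_natCast]
  exact Real.rpow_le_rpow_of_exponent_le hn' (Nat.le_ceil _)

theorem exp_neg_rpow_le {δ β : ℝ} (hδ : 0 < δ) (hβ : 0 < β) (m : ℕ) :
    ∃ C : ℝ, 0 ≤ C ∧ ∀ r : ℕ, Real.exp (-δ * (r : ℝ) ^ β) ≤ C * ((1 + r : ℝ) ^ m)⁻¹ := by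
  -- With `β N ≥ m`, the single term `x ^ N / N !` of the exponential series at `x = δ r ^ β` beats
  -- `r ^ m`.
  obtain ⟨N, hN⟩ := exists_nat_gt (m / β)
  have hN' : (m : ℝ) ≤ β * N := by
    rw [div_lt_iff₀ hβ] at hN; linarith
  refine ⟨1 + 2 ^ m * (N.factorial / δ ^ N), by positivity, fun r => ?_⟩
  rcases Nat.eq_zero_or_pos r with rfl | hr
  · rw [Nat.cast_zero, Real.zero_rpow hβ.ne']
    simp
    positivity
  have hr1 : (1 : ℝ) ≤ r := by exact_mod_cast hr
  have h1 : (δ * (r : ℝ) ^ β) ^ N / N.factorial ≤ Real.exp (δ * (r : ℝ) ^ β) :=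
    Real.pow_div_factorial_le_exp _ (by positivity) N
  have h2 : (r : ℝ) ^ m ≤ ((r : ℝ) ^ β) ^ N := by
    rw [← Real.rpow_natCast, ← Real.rpow_natCast, ← Real.rpow_mul (by positivity)]
    exact Real.rpow_le_rpow_of_exponent_le hr1 hN'
  have h3 : (1 + r : ℝ) ^ m ≤ 2 ^ m * (r : ℝ) ^ m := by
    rw [← mul_pow]
    exact pow_le_pow_left₀ (by positivity) (by linarith) m
  have hf : (0 : ℝ) < N.factorial := by exact_mod_cast Nat.factorial_pos N
  rw [neg_mul, Real.exp_neg, ← div_eq_mul_inv, le_div_iff₀ (by positivity),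
    inv_mul_le_iff₀ (Real.exp_pos _)]
  have h4 : (1 + r : ℝ) ^ m ≤ 2 ^ m * (N.factorial / δ ^ N) * ((δ * (r : ℝ) ^ β) ^ N / N.factorial) := by
    refine (h3.trans (mul_le_mul_of_nonneg_left h2 (by positivity))).trans_eq ?_
    rw [mul_pow]
    field_simp
  have h5 := mul_le_mul_of_nonneg_left h1 (by positivity : 0 ≤ 2 ^ m * ((N.factorial : ℝ) / δ ^ N))
  have h6 := Real.exp_pos (δ * (r : ℝ) ^ β)
  nlinarith

/-- Points are grouped by their distance to the identity, and each sphere is bounded by the ball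
containing it. -/
theorem summable_comp_gdist (hS : IsGeneratingSet S) {h : ℕ → ℝ} (h0 : ∀ r, 0 ≤ h r)
    (hsum : Summable fun r => (vol S r : ℝ) * h r) : Summable fun x : V => h (gdist S 0 x) := by
  refine summable_of_sum_le (c := ∑' r, (vol S r : ℝ) * h r) (fun x => h0 _) fun F => ?_
  set N := F.sup (gdist S 0) with hN
  rw [← Finset.sum_fiberwise_of_maps_to (t := Finset.range (N + 1)) (g := gdist S 0)
    (fun x hx => Finset.mem_range.2 (Nat.lt_succ_of_le (Finset.le_sup hx)))]
  refine le_trans (Finset.sum_le_sum fun r _ => ?_)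
    (hsum.sum_le_tsum (Finset.range (N + 1)) fun r _ => mul_nonneg (Nat.cast_nonneg _) (h0 r))
  refine (Finset.sum_le_card_nsmul _ _ (h r) fun x hx => ?_).trans ?_
  · rw [(Finset.mem_filter.1 hx).2]
  · rw [nsmul_eq_mul]
    refine mul_le_mul_of_nonneg_right ?_ (h0 r)
    rw [← card_ballFinset hS r 0]
    exact_mod_cast Finset.card_le_card fun x hx => by
      rw [mem_ballFinset, (Finset.mem_filter.1 hx).2]

theorem isSummableIn_exp (hS : IsGeneratingSet S) (hG : HasPolynomialGrowth S) {δ β : ℝ}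
    (hδ : 0 < δ) (hβ : 0 < β) : IsSummableIn S fun s => Real.exp (-δ * s ^ β) := by
  intro c hc p hp
  obtain ⟨G, d, hG1, hvol⟩ := hG.exists_le
  have hp0 : (0 : ℝ) < p := by exact_mod_cast hp
  obtain ⟨C, hC, hle⟩ := exp_neg_rpow_le (δ := δ * c ^ β / p) (by positivity) hβ (d + 2)
  have hvol' : ∀ r, (vol S r : ℝ) ≤ G * (1 + r : ℝ) ^ d := by
    intro r
    have h1 : (vol S r : ℝ) ≤ vol S (r + 1) := by exact_mod_cast vol_mono hS (Nat.le_succ r)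
    refine h1.trans ((hvol (r + 1) (by omega)).trans_eq ?_)
    push_cast
    rw [add_comm]
  have h2 : Summable fun r : ℕ => G * C * ((1 + r : ℝ) ^ 2)⁻¹ := by
    have := (summable_nat_add_iff 1).2 (Real.summable_nat_pow_inv.2 (by norm_num : 1 < 2))
    refine (this.mul_left (G * C)).congr fun r => ?_
    push_cast
    rw [add_comm]
  have h3 : Summable fun r : ℕ => (vol S r : ℝ) * Real.exp (-(δ * c ^ β / p) * (r : ℝ) ^ β) := by
    refine Summable.of_nonneg_of_le (fun r => by positivity) (fun r => ?_) h2
    refine (mul_le_mul (hvol' r) (hle r) (by positivity) (by positivity)).trans_eq ?_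
    rw [pow_add]
    field_simp
  refine (summable_comp_gdist hS (fun r => (Real.exp_pos _).le) h3).congr fun x => ?_
  rw [← Real.exp_mul, Real.mul_rpow hc.le (by positivity)]
  congr 1
  ring

end

/-! ## Truncation of scores -/

section

variable {V : Type*} [AddGroup V] {S : Finset V} {ξ : V → Set V → ℝ}

/-- The infimum is attained since `ℕ∞` is well ordered, and stabilisation at one radius persists at
every larger one. -/
theorem stabRadiusZero_le_iff (hS : IsGeneratingSet S) {t : ℕ} (ht : 0 < t) {μ : Set V} :
    stabRadiusZero S ξ μ ≤ t ↔
      ∀ μ' : Set V, μ' ∩ ball S t 0 = μ ∩ ball S t 0 → ξ 0 μ = ξ 0 μ' := by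
  constructor
  · intro h μ' hμ'
    unfold stabRadiusZero at h
    have hne : {k : ℕ∞ | ∃ r : ℕ, 0 < r ∧ k = r ∧
        ∀ μ' : Set V, μ' ∩ ball S r 0 = μ ∩ ball S r 0 → ξ 0 μ = ξ 0 μ'}.Nonempty := by
      by_contra hc
      rw [Set.not_nonempty_iff_eq_empty] at hc
      rw [hc, sInf_empty] at h
      simp at h
    obtain ⟨r, -, hrk, hr⟩ := csInf_mem hne
    rw [hrk] at h
    have hrt : r ≤ t := by exact_mod_cast h
    have hsub : ball S r 0 ⊆ ball S t 0 := fun x hx => by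
      rw [mem_ball hS] at hx ⊢; omega
    apply hr
    rw [← Set.inter_eq_right.2 hsub, ← Set.inter_assoc, ← Set.inter_assoc, hμ']
  · exact fun h => sInf_le ⟨t, ht, rfl, h⟩

/-- Whether the score has stabilised at radius `t` is itself decided by the spins within distance
`t`. This is what makes `truncScore` a local function. -/
theorem stabRadiusZero_inter_le_iff (hS : IsGeneratingSet S) {t : ℕ} (ht : 0 < t) (μ : Set V) :
    stabRadiusZero S ξ (μ ∩ ball S t 0) ≤ t ↔ stabRadiusZero S ξ μ ≤ t := by
  rw [stabRadiusZero_le_iff hS ht, stabRadiusZero_le_iff hS ht]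
  have h0 : μ ∩ ball S t 0 ∩ ball S t 0 = μ ∩ ball S t 0 := by
    rw [Set.inter_assoc, Set.inter_self]
  constructor
  · intro h μ' hμ'
    rw [← h μ h0.symm]
    exact h μ' (hμ'.trans h0.symm)
  · intro h μ' hμ'
    rw [← h _ h0]
    exact h μ' (hμ'.trans h0)

open scoped Classical in
/-- The score on the event that its radius of stabilisation is at most `t`. -/
def truncScore (S : Finset V) (ξ : V → Set V → ℝ) (t : ℕ) (x : V) (μ : Set V) : ℝ :=
  if stabRadius S ξ x μ ≤ t then ξ x μ else 0

theorem stabRadius_inter_le_iff (hS : IsGeneratingSet S) {t : ℕ} (ht : 0 < t) (x : V) (μ : Set V) :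
    stabRadius S ξ x (μ ∩ ball S t x) ≤ t ↔ stabRadius S ξ x μ ≤ t := by
  unfold stabRadius
  rw [← translate_inter_ball hS, stabRadiusZero_inter_le_iff hS ht]

theorem score_inter_eq (hS : IsGeneratingSet S) (hξ : IsScoreFunction ξ) {t : ℕ} (ht : 0 < t)
    {x : V} {μ : Set V} (h : stabRadius S ξ x μ ≤ t) : ξ x (μ ∩ ball S t x) = ξ x μ := by
  rw [hξ.eq_translate x μ, hξ.eq_translate x, ← translate_inter_ball hS]
  refine ((stabRadiusZero_le_iff hS ht).1 h _ ?_).symm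
  rw [Set.inter_assoc, Set.inter_self]

theorem truncScore_inter (hS : IsGeneratingSet S) (hξ : IsScoreFunction ξ) {t : ℕ} (ht : 0 < t)
    (x : V) (μ : Set V) : truncScore S ξ t x (μ ∩ ball S t x) = truncScore S ξ t x μ := by
  unfold truncScore
  simp only [stabRadius_inter_le_iff hS ht]
  split_ifs with h
  · exact score_inter_eq hS hξ ht h
  · rfl

theorem abs_truncScore_le (hS : IsGeneratingSet S) (hξ : IsScoreFunction ξ) {t : ℕ} (ht : 0 < t)
    {B : ℝ} (hB0 : 0 ≤ B) (hB : ∀ μ : Set V, |ξ 0 (μ ∩ ball S t 0)| ≤ B) (x : V) (μ : Set V) :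
    |truncScore S ξ t x μ| ≤ B := by
  unfold truncScore
  split_ifs with h
  · rw [← score_inter_eq hS hξ ht h, hξ.eq_translate, ← translate_inter_ball hS]
    exact hB _
  · simpa using hB0

theorem HasExpGrowth.exists_le (h : HasExpGrowth S ξ) : ∃ (a : ℝ) (q : ℕ), 0 ≤ a ∧
    ∀ t : ℕ, 0 < t → ∀ μ : Set V, |ξ 0 (μ ∩ ball S t 0)| ≤ Real.exp (a * (t : ℝ) ^ q) := by
  obtain ⟨κ, a, hκ, h⟩ := h
  refine ⟨|a|, ⌈κ⌉₊, abs_nonneg a, fun t ht μ => (h t ht μ).trans (Real.exp_le_exp.2 ?_)⟩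
  have ht' : (1 : ℝ) ≤ t := by exact_mod_cast ht
  refine (mul_le_mul_of_nonneg_right (le_abs_self a) (by positivity)).trans
    (mul_le_mul_of_nonneg_left ?_ (abs_nonneg a))
  rw [← Real.rpow_natCast]
  exact Real.rpow_le_rpow_of_exponent_le ht' (Nat.le_ceil _)

end

/-! ## Comparison of mixed moments with those of truncated variables -/

section

/-- A substitute for Hölder's inequality: every factor is at most the largest one, and as it is at
least one, missing factors may be added. -/
theorem sq_prod_le_sum_pow {k : ℕ} {z : Fin k → ℝ} (hz : ∀ i, 1 ≤ z i) (i₁ : Fin k)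
    (A : Finset (Fin k)) : (∏ i ∈ A, z i) ^ 2 ≤ ∑ i, z i ^ (2 * k) := by
  obtain ⟨i₀, _, hi₀⟩ := Finset.exists_max_image Finset.univ z ⟨i₁, Finset.mem_univ _⟩
  have hz0 : ∀ i, 0 ≤ z i := fun i => zero_le_one.trans (hz i)
  have h1 : ∏ i ∈ A, z i ≤ z i₀ ^ k := by
    refine (Finset.prod_le_prod (fun i _ => hz0 i)
      fun i _ => hi₀ i (Finset.mem_univ i)).trans ?_
    rw [Finset.prod_const]
    exact pow_le_pow_right₀ (hz i₀) (by simpa using Finset.card_le_univ A)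
  calc (∏ i ∈ A, z i) ^ 2 ≤ (z i₀ ^ k) ^ 2 :=
        pow_le_pow_left₀ (Finset.prod_nonneg fun i _ => hz0 i) h1 2
    _ = z i₀ ^ (2 * k) := by rw [← pow_mul, mul_comm]
    _ ≤ ∑ i, z i ^ (2 * k) := Finset.single_le_sum (f := fun i => z i ^ (2 * k))
        (fun i _ => pow_nonneg (hz0 i) _) (Finset.mem_univ i₀)

variable {V : Type*} {Ω : Type*} [MeasurableSpace Ω] {Pr : Measure Ω}

theorem abs_prod_le_of_dominated {k : ℕ} {y z : Fin k → ℝ} {Λ : ℝ} (hΛ : 1 ≤ Λ)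
    (hy : ∀ i, |y i| ≤ Λ * z i) (hz : ∀ i, 1 ≤ z i) (A : Finset (Fin k)) :
    |∏ i ∈ A, y i| ≤ Λ ^ k * ∏ i ∈ A, z i := by
  rw [Finset.abs_prod]
  refine (Finset.prod_le_prod (fun _ _ => abs_nonneg _) fun i _ => hy i).trans ?_
  rw [Finset.prod_mul_distrib, Finset.prod_const]
  refine mul_le_mul_of_nonneg_right (pow_le_pow_right₀ hΛ (by simpa using Finset.card_le_univ A)) ?_
  exact Finset.prod_nonneg fun i _ => zero_le_one.trans (hz i)

theorem abs_mixedMoment_le_of_dominated {k : ℕ} (hk : 0 < k) {Y Z : V → Ω → ℝ} {x : Fin k → V}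
    {Λ L : ℝ} (hΛ : 1 ≤ Λ) (hY : ∀ i ω, |Y (x i) ω| ≤ Λ * Z (x i) ω) (hZ : ∀ i ω, 1 ≤ Z (x i) ω)
    (hint : ∀ i, Integrable (fun ω => Z (x i) ω ^ (2 * k)) Pr)
    (hL : ∀ i, ∫ ω, Z (x i) ω ^ (2 * k) ∂Pr ≤ L) (A : Finset (Fin k)) :
    |mixedMoment Pr Y x A| ≤ Λ ^ k * (k * L) := by
  have hint' : Integrable (fun ω => Λ ^ k * ∑ i, Z (x i) ω ^ (2 * k)) Pr :=
    (integrable_finsetSum _ fun i _ => hint i).const_mul _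
  have h := norm_integral_le_of_norm_le (f := fun ω => ∏ i ∈ A, Y (x i) ω) hint'
    (Eventually.of_forall fun ω => by
      refine (abs_prod_le_of_dominated hΛ (fun i => hY i ω) (fun i => hZ i ω) A).trans ?_
      refine mul_le_mul_of_nonneg_left ?_ (by positivity)
      refine le_trans ?_ (sq_prod_le_sum_pow (fun i => hZ i ω) ⟨0, hk⟩ A)
      have h1 : 1 ≤ ∏ i ∈ A, Z (x i) ω := by
        simpa using Finset.prod_le_prod (s := A) (f := fun _ => (1 : ℝ)) (g := fun i => Z (x i) ω)
          (fun _ _ => zero_le_one) fun i _ => hZ i ω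
      nlinarith)
  refine h.trans ?_
  rw [integral_const_mul, integral_finsetSum _ fun i _ => hint i]
  refine mul_le_mul_of_nonneg_left ?_ (by positivity)
  refine (Finset.sum_le_card_nsmul _ _ L fun i _ => hL i).trans_eq ?_
  simp

variable [IsProbabilityMeasure Pr]

/-- The two products differ only on the union of the exceptional events, each of probability at most
`ρ ^ 2`; Cauchy-Schwarz turns this into an error of order `ρ`. -/
theorem abs_mixedMoment_sub_le_of_truncation {k : ℕ} {Y Y' Z : V → Ω → ℝ} {x : Fin k → V}
    {E : V → Set Ω} {Λ L ρ : ℝ} (hΛ : 1 ≤ Λ) (hρ : 0 < ρ)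
    (hmY : ∀ i, HasAllMoments Pr (Y (x i))) (hmY' : ∀ i, HasAllMoments Pr (Y' (x i)))
    (hY : ∀ i ω, |Y (x i) ω| ≤ Λ * Z (x i) ω) (hY' : ∀ i ω, |Y' (x i) ω| ≤ Λ * Z (x i) ω)
    (hZ : ∀ i ω, 1 ≤ Z (x i) ω) (hint : ∀ i, Integrable (fun ω => Z (x i) ω ^ (2 * k)) Pr)
    (hL : ∀ i, ∫ ω, Z (x i) ω ^ (2 * k) ∂Pr ≤ L) (hE : ∀ i, MeasurableSet (E (x i)))
    (hYE : ∀ i, ∀ ω ∉ E (x i), Y (x i) ω = Y' (x i) ω) (hEρ : ∀ i, Pr.real (E (x i)) ≤ ρ ^ 2)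
    (A : Finset (Fin k)) :
    |mixedMoment Pr Y x A - mixedMoment Pr Y' x A| ≤ Λ ^ k * (k * (L + 1)) * ρ := by
  have hint1 : Integrable (fun ω => ∑ i, Z (x i) ω ^ (2 * k)) Pr :=
    integrable_finsetSum _ fun i _ => hint i
  have hind : ∀ i, Integrable ((E (x i)).indicator (1 : Ω → ℝ)) Pr := fun i =>
    (integrable_const (1 : ℝ)).indicator (hE i)
  have hint2 : Integrable (fun ω => ∑ i, (E (x i)).indicator (1 : Ω → ℝ) ω) Pr :=
    integrable_finsetSum _ fun i _ => hind i
  unfold mixedMoment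
  rw [← integral_sub (HasAllMoments.prod A fun i _ => hmY i).integrable
    (HasAllMoments.prod A fun i _ => hmY' i).integrable]
  have hind0 : ∀ i ω, 0 ≤ (E (x i)).indicator (1 : Ω → ℝ) ω := fun i ω =>
    Set.indicator_nonneg (fun _ _ => zero_le_one) _
  have hint3 : Integrable (fun ω => Λ ^ k * (ρ * ∑ i, Z (x i) ω ^ (2 * k) +
      ρ⁻¹ * ∑ i, (E (x i)).indicator (1 : Ω → ℝ) ω)) Pr :=
    ((hint1.const_mul ρ).add (hint2.const_mul ρ⁻¹)).const_mul (Λ ^ k)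
  refine (norm_integral_le_of_norm_le
    (f := fun ω => ∏ i ∈ A, Y (x i) ω - ∏ i ∈ A, Y' (x i) ω) hint3
    (Eventually.of_forall fun ω => ?_)).trans ?_
  · have hz : ∀ i, 1 ≤ Z (x i) ω := fun i => hZ i ω
    have hs0 : 0 ≤ ∑ i, Z (x i) ω ^ (2 * k) := Finset.sum_nonneg fun i _ =>
      pow_nonneg (zero_le_one.trans (hz i)) _
    by_cases hω : ∃ i, ω ∈ E (x i)
    · obtain ⟨i₀, hi₀⟩ := hω
      have h1 := abs_prod_le_of_dominated hΛ (fun i => hY i ω) hz A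
      have h2 := abs_prod_le_of_dominated hΛ (fun i => hY' i ω) hz A
      have h3 := sq_prod_le_sum_pow hz i₀ A
      have h4 : 1 ≤ ∑ i, (E (x i)).indicator (1 : Ω → ℝ) ω := by
        refine le_trans ?_ (Finset.single_le_sum (fun i _ => hind0 i ω) (Finset.mem_univ i₀))
        rw [Set.indicator_of_mem hi₀]; simp
      set u := ∏ i ∈ A, Z (x i) ω
      -- Pointwise form of Cauchy-Schwarz; the weight balances a bounded second moment against a
      -- probability of order `ρ ^ 2`.
      have h5 : 2 * u ≤ ρ * u ^ 2 + ρ⁻¹ := by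
        have : ρ * u ^ 2 + ρ⁻¹ - 2 * u = ρ⁻¹ * (ρ * u - 1) ^ 2 := by
          field_simp; ring
        have h6 : 0 ≤ ρ⁻¹ * (ρ * u - 1) ^ 2 := by positivity
        linarith
      have h6 : ρ * u ^ 2 + ρ⁻¹ ≤ ρ * ∑ i, Z (x i) ω ^ (2 * k) +
          ρ⁻¹ * ∑ i, (E (x i)).indicator (1 : Ω → ℝ) ω :=
        add_le_add (mul_le_mul_of_nonneg_left h3 hρ.le)
          (le_mul_of_one_le_right (by positivity) h4)
      calc ‖∏ i ∈ A, Y (x i) ω - ∏ i ∈ A, Y' (x i) ω‖ ≤ Λ ^ k * u + Λ ^ k * u :=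
            (norm_sub_le _ _).trans (add_le_add h1 h2)
        _ = Λ ^ k * (2 * u) := by ring
        _ ≤ _ := mul_le_mul_of_nonneg_left (h5.trans h6) (by positivity)
    · push Not at hω
      rw [Finset.prod_congr rfl fun i _ => hYE i ω (hω i), sub_self, norm_zero]
      exact mul_nonneg (by positivity) (add_nonneg (mul_nonneg hρ.le hs0)
        (mul_nonneg (by positivity) (Finset.sum_nonneg fun i _ => hind0 i ω)))
  · rw [integral_const_mul, mul_assoc]
    refine mul_le_mul_of_nonneg_left ?_ (by positivity)
    have e1 : ∫ ω, ∑ i, Z (x i) ω ^ (2 * k) ∂Pr ≤ k * L := by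
      rw [integral_finsetSum _ fun i _ => hint i]
      refine (Finset.sum_le_card_nsmul _ _ L fun i _ => hL i).trans_eq ?_
      simp
    have e2 : ∫ ω, ∑ i, (E (x i)).indicator (1 : Ω → ℝ) ω ∂Pr ≤ k * ρ ^ 2 := by
      rw [integral_finsetSum _ fun i _ => hind i]
      refine (Finset.sum_le_card_nsmul _ _ (ρ ^ 2) fun i _ => ?_).trans_eq (by simp)
      rw [integral_indicator_one (hE i)]
      exact hEρ i
    rw [integral_add (hint1.const_mul ρ) (hint2.const_mul ρ⁻¹), integral_const_mul,
      integral_const_mul]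
    calc _ ≤ ρ * (k * L) + ρ⁻¹ * (k * ρ ^ 2) := by gcongr
      _ = k * (L + 1) * ρ := by field_simp

theorem abs_mixedMoment_sub_mul_le_of_truncation {k : ℕ} (hk : 0 < k) {Y Y' Z : V → Ω → ℝ}
    {x : Fin k → V} {E : V → Set Ω} {Λ L ρ : ℝ} (hΛ : 1 ≤ Λ) (hρ : 0 < ρ)
    (hmY : ∀ i, HasAllMoments Pr (Y (x i))) (hmY' : ∀ i, HasAllMoments Pr (Y' (x i)))
    (hY : ∀ i ω, |Y (x i) ω| ≤ Λ * Z (x i) ω) (hY' : ∀ i ω, |Y' (x i) ω| ≤ Λ * Z (x i) ω)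
    (hZ : ∀ i ω, 1 ≤ Z (x i) ω) (hint : ∀ i, Integrable (fun ω => Z (x i) ω ^ (2 * k)) Pr)
    (hL : ∀ i, ∫ ω, Z (x i) ω ^ (2 * k) ∂Pr ≤ L) (hE : ∀ i, MeasurableSet (E (x i)))
    (hYE : ∀ i, ∀ ω ∉ E (x i), Y (x i) ω = Y' (x i) ω) (hEρ : ∀ i, Pr.real (E (x i)) ≤ ρ ^ 2)
    (A A₁ A₂ : Finset (Fin k)) :
    |mixedMoment Pr Y x A - mixedMoment Pr Y x A₁ * mixedMoment Pr Y x A₂| ≤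
      |mixedMoment Pr Y' x A - mixedMoment Pr Y' x A₁ * mixedMoment Pr Y' x A₂| +
        Λ ^ k * (k * (L + 1)) * (1 + 2 * (Λ ^ k * (k * L))) * ρ := by
  have hd := abs_mixedMoment_sub_le_of_truncation hΛ hρ hmY hmY' hY hY' hZ hint hL hE hYE hEρ
  have hK := abs_mixedMoment_le_of_dominated hk hΛ hY hZ hint hL
  have hK' := abs_mixedMoment_le_of_dominated hk hΛ hY' hZ hint hL
  have hK0 := (abs_nonneg _).trans (hK ∅)
  have hd0 := (abs_nonneg _).trans (hd ∅)
  set M := mixedMoment Pr Y x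
  set M' := mixedMoment Pr Y' x
  have e : M A - M A₁ * M A₂ = (M' A - M' A₁ * M' A₂) + ((M A - M' A) -
      (M A₁ * (M A₂ - M' A₂) + (M A₁ - M' A₁) * M' A₂)) := by ring
  rw [e]
  refine (abs_add_le _ _).trans (add_le_add_right ((abs_sub _ _).trans ?_) _)
  refine (add_le_add (hd A) ((abs_add_le _ _).trans ?_)).trans_eq
    (b := _ + (Λ ^ k * (k * L) * (Λ ^ k * (k * (L + 1)) * ρ) +
      Λ ^ k * (k * (L + 1)) * ρ * (Λ ^ k * (k * L)))) (by ring)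
  rw [abs_mul, abs_mul]
  exact add_le_add (mul_le_mul (hK A₁) (hd A₂) (abs_nonneg _) hK0)
    (mul_le_mul (hd A₁) (hK' A₂) (abs_nonneg _) hd0)

end

/-! ## Choice of the truncation level -/

/-- The level is `t = ⌊s ^ η⌋`. The condition `η q ≤ b / 2` keeps `Q t ^ q` below the order of `δ s
^ b`, and `η ≤ 1 / 2` with `s ≥ 16` gives `4 t ≤ s`. The price is the smaller exponent `β`. -/
theorem exists_truncation_level {q : ℕ} {Q b δ c δ' : ℝ} (hq : 1 ≤ q) (hQ : 0 ≤ Q) (hb : 0 < b)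
    (hδ : 0 < δ) (hc : 0 < c) (hδ' : 0 < δ') :
    ∃ D γ β : ℝ, 1 ≤ D ∧ 0 < γ ∧ 0 < β ∧ ∀ s : ℕ, 16 ≤ s → ∃ t : ℕ, 0 < t ∧ 4 * t ≤ s ∧
      Real.exp (Q * (t : ℝ) ^ q - δ * (s : ℝ) ^ b) ≤ D * Real.exp (-γ * (s : ℝ) ^ β) ∧
      Real.exp (-δ' * (t : ℝ) ^ c) ≤ D * Real.exp (-γ * (s : ℝ) ^ β) := by
  have hq' : (1 : ℝ) ≤ q := by exact_mod_cast hq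
  set η : ℝ := b / (2 * (q + b)) with hη
  have hη0 : 0 < η := by positivity
  have hη1 : η ≤ 1 / 2 := by
    rw [hη, div_le_div_iff₀ (by positivity) (by norm_num)]; nlinarith
  have hη2 : η * q ≤ b / 2 := by
    rw [hη, div_mul_eq_mul_div, div_le_div_iff₀ (by positivity) (by norm_num)]; nlinarith [mul_pos hb hb]
  set β : ℝ := min (b / 2) (η * c) with hβ
  have hβ0 : 0 < β := lt_min (by positivity) (by positivity)
  set γ : ℝ := min 1 (δ' * (1 / 2) ^ c) with hγ
  have hγ0 : 0 < γ := lt_min one_pos (by positivity)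
  -- The exponent is the maximum over `u` of `(Q + 1) u - δ u ^ 2`, to be used with `u = s ^ (b /
  -- 2)`.
  refine ⟨Real.exp ((Q + 1) ^ 2 / (4 * δ)), γ, β, Real.one_le_exp (by positivity), hγ0, hβ0,
    fun s hs => ⟨⌊(s : ℝ) ^ η⌋₊, ?_, ?_, ?_, ?_⟩⟩
  all_goals
    have hs16 : (16 : ℝ) ≤ s := by exact_mod_cast hs
    have hs1 : (1 : ℝ) ≤ s := by linarith
    have hs0 : (0 : ℝ) < s := by linarith
    have hη3 : 1 ≤ (s : ℝ) ^ η := Real.one_le_rpow hs1 hη0.le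
    have hfl : ((⌊(s : ℝ) ^ η⌋₊ : ℕ) : ℝ) ≤ (s : ℝ) ^ η := Nat.floor_le (by positivity)
  · exact Nat.floor_pos.2 hη3
  · have h1 : (s : ℝ) ^ η ≤ √s := by
      rw [Real.sqrt_eq_rpow]
      exact Real.rpow_le_rpow_of_exponent_le hs1 hη1
    have h2 : 4 ≤ √(s : ℝ) := Real.le_sqrt_of_sq_le (by linarith)
    have h3 : √(s : ℝ) * √s = s := Real.mul_self_sqrt hs0.le
    have h4 : (4 : ℝ) * (⌊(s : ℝ) ^ η⌋₊ : ℕ) ≤ s := by nlinarith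
    exact_mod_cast h4
  · have h1 : ((⌊(s : ℝ) ^ η⌋₊ : ℕ) : ℝ) ^ q ≤ (s : ℝ) ^ (b / 2) := by
      refine (pow_le_pow_left₀ (by positivity) hfl q).trans ?_
      rw [← Real.rpow_natCast, ← Real.rpow_mul hs0.le]
      exact Real.rpow_le_rpow_of_exponent_le hs1 hη2
    have h2 : (s : ℝ) ^ b = ((s : ℝ) ^ (b / 2)) ^ 2 := by
      rw [← Real.rpow_natCast, ← Real.rpow_mul hs0.le]
      congr 1; push_cast; ring
    have h3 : (s : ℝ) ^ β ≤ (s : ℝ) ^ (b / 2) :=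
      Real.rpow_le_rpow_of_exponent_le hs1 (min_le_left _ _)
    rw [← Real.exp_add, Real.exp_le_exp, h2]
    set u := (s : ℝ) ^ (b / 2)
    have h4 : 0 ≤ (s : ℝ) ^ β := by positivity
    have h5 : γ * (s : ℝ) ^ β ≤ u := by
      calc γ * (s : ℝ) ^ β ≤ 1 * (s : ℝ) ^ β :=
            mul_le_mul_of_nonneg_right (min_le_left _ _) h4
        _ ≤ u := by linarith
    have h6 : (Q + 1) * u - δ * u ^ 2 ≤ (Q + 1) ^ 2 / (4 * δ) := by
      rw [le_div_iff₀ (by positivity)]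
      nlinarith [sq_nonneg (2 * δ * u - (Q + 1))]
    have h7 := mul_le_mul_of_nonneg_left h1 hQ
    linarith
  · have h1 : (s : ℝ) ^ η * (1 / 2) ≤ (⌊(s : ℝ) ^ η⌋₊ : ℕ) := by
      have h2 := Nat.lt_floor_add_one ((s : ℝ) ^ η)
      have h3 : (1 : ℝ) ≤ (⌊(s : ℝ) ^ η⌋₊ : ℕ) := by exact_mod_cast Nat.floor_pos.2 hη3
      linarith
    have h2 : ((s : ℝ) ^ η * (1 / 2)) ^ c ≤ ((⌊(s : ℝ) ^ η⌋₊ : ℕ) : ℝ) ^ c :=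
      Real.rpow_le_rpow (by positivity) h1 hc.le
    rw [Real.mul_rpow (by positivity) (by norm_num), ← Real.rpow_mul hs0.le] at h2
    have h3 : (s : ℝ) ^ β ≤ (s : ℝ) ^ (η * c) :=
      Real.rpow_le_rpow_of_exponent_le hs1 (min_le_right _ _)
    have h4 : γ * (s : ℝ) ^ β ≤ δ' * (1 / 2) ^ c * (s : ℝ) ^ (η * c) :=
      mul_le_mul (min_le_right _ _) h3 (by positivity) (by positivity)
    have h5 := mul_le_mul_of_nonneg_left h2 hδ'.le
    refine le_trans ?_ (le_mul_of_one_le_left (Real.exp_pos _).le (Real.one_le_exp (by positivity)))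
    rw [Real.exp_le_exp]
    linarith

/-- Collects all factors that grow with the truncation level: the spin expansion, the size of the
scores and the clustering constants. The squared volume needs degree `2 * d`, and the `+ 1` ensures
a positive degree. -/
theorem exists_le_exp_pow {G a Λ : ℝ} (hG : 0 ≤ G) (ha : 0 ≤ a) (hΛ : 0 ≤ Λ) (k d q : ℕ) :
    ∃ Q : ℝ, 0 ≤ Q ∧ ∀ (t v : ℕ), 0 < t → (v : ℝ) ≤ G * (t : ℝ) ^ d →
      (3 : ℝ) ^ (k * v) * (Λ * Real.exp (a * (t : ℝ) ^ q)) ^ k * Real.exp (((k * v : ℕ) : ℝ) ^ 2) ≤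
        Λ ^ k * Real.exp (Q * (t : ℝ) ^ (2 * d + q + 1)) := by
  refine ⟨2 * (k * G) + a * k + (k * G) ^ 2, by positivity, fun t v ht hv => ?_⟩
  have ht1 : (1 : ℝ) ≤ t := by exact_mod_cast ht
  set T := (t : ℝ) ^ (2 * d + q + 1) with hT
  have hp : ∀ i, i ≤ 2 * d + q + 1 → (t : ℝ) ^ i ≤ T := fun i hi => pow_le_pow_right₀ ht1 hi
  have hkv : ((k * v : ℕ) : ℝ) ≤ k * G * (t : ℝ) ^ d := by
    push_cast
    rw [mul_assoc]
    exact mul_le_mul_of_nonneg_left hv (Nat.cast_nonneg _)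
  have h1 : (3 : ℝ) ^ (k * v) ≤ Real.exp (2 * (k * G) * T) := by
    have h3 : (3 : ℝ) ≤ Real.exp 2 := by linarith [Real.add_one_le_exp (2 : ℝ)]
    refine (pow_le_pow_left₀ (by norm_num) h3 _).trans ?_
    rw [← Real.exp_nat_mul, Real.exp_le_exp]
    have := mul_le_mul_of_nonneg_left (hp d (by omega)) (by positivity : 0 ≤ k * G)
    linarith
  have h2 : Real.exp (((k * v : ℕ) : ℝ) ^ 2) ≤ Real.exp ((k * G) ^ 2 * T) := by
    rw [Real.exp_le_exp]
    refine (pow_le_pow_left₀ (Nat.cast_nonneg _) hkv 2).trans ?_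
    rw [mul_pow, ← pow_mul]
    exact mul_le_mul_of_nonneg_left (hp _ (by omega)) (by positivity)
  have h3 : (Λ * Real.exp (a * (t : ℝ) ^ q)) ^ k ≤ Λ ^ k * Real.exp (a * k * T) := by
    rw [mul_pow, ← Real.exp_nat_mul]
    refine mul_le_mul_of_nonneg_left (Real.exp_le_exp.2 ?_) (by positivity)
    have := mul_le_mul_of_nonneg_left (hp q (by omega)) (by positivity : 0 ≤ a * k)
    linarith
  calc _ ≤ Real.exp (2 * (k * G) * T) * (Λ ^ k * Real.exp (a * k * T)) *
          Real.exp ((k * G) ^ 2 * T) := by gcongr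
    _ = Λ ^ k * (Real.exp (2 * (k * G) * T) * Real.exp (a * k * T) *
          Real.exp ((k * G) ^ 2 * T)) := by ring
    _ = _ := by
        rw [← Real.exp_add, ← Real.exp_add]
        congr 2
        ring

/-! ## Exponentially quasi-local scores -/

section

variable {V : Type*} [AddGroup V] {S : Finset V} {Ω : Type*} [MeasurableSpace Ω] {Pr : Measure Ω}
  {P : Ω → Set V} {ξ : V → Set V → ℝ}

theorem HasMomentCondition.exists_integral_le (hξ : IsScoreFunction ξ) (hP : Measurable P) {p : ℕ}
    (h : HasMomentCondition S Pr P ξ p) : ∃ L : ℝ, 0 ≤ L ∧ ∀ n : ℕ, 1 ≤ n → ∀ x ∈ ball S n 0,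
      Integrable (fun ω => max |ξ x (P ω ∩ ball S n 0)| 1 ^ p) Pr ∧
      ∫ ω, max |ξ x (P ω ∩ ball S n 0)| 1 ^ p ∂Pr ≤ L := by
  unfold HasMomentCondition at h
  simp only [Real.rpow_natCast] at h
  set T := ⨆ (n : ℕ∞) (_ : 1 ≤ n) (x ∈ ball S n 0),
    ∫⁻ ω, ENNReal.ofReal (max |ξ x (P ω ∩ ball S n 0)| 1 ^ p) ∂Pr
  refine ⟨T.toReal, ENNReal.toReal_nonneg, fun n hn x hx => ?_⟩
  · have hle : ∫⁻ ω, ENNReal.ofReal (max |ξ x (P ω ∩ ball S n 0)| 1 ^ p) ∂Pr ≤ T :=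
      le_iSup₂_of_le (n : ℕ∞) (by exact_mod_cast hn) (le_iSup₂_of_le x hx le_rfl)
    have hm : AEStronglyMeasurable (fun ω => max |ξ x (P ω ∩ ball S n 0)| 1 ^ p) Pr := by
      have := measurable_score hξ hP x (ball S n 0)
      exact ((this.abs.max measurable_const).pow_const p).aestronglyMeasurable
    have h0 : 0 ≤ᵐ[Pr] fun ω => max |ξ x (P ω ∩ ball S n 0)| 1 ^ p :=
      Eventually.of_forall fun ω => by positivity
    refine ⟨⟨hm, (hasFiniteIntegral_iff_ofReal h0).2 (hle.trans_lt h)⟩, ?_⟩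
    rw [integral_eq_lintegral_of_nonneg_ae h0 hm]
    exact ENNReal.toReal_mono h.ne hle

theorem hasAllMoments_of_integrable_max [IsProbabilityMeasure Pr] {f : Ω → ℝ} (hf : Measurable f)
    (h : ∀ p : ℕ, 1 ≤ p → Integrable (fun ω => max |f ω| 1 ^ p) Pr) : HasAllMoments Pr f := by
  intro p
  rcases Nat.eq_zero_or_pos p with rfl | hp
  · simpa using memLp_zero_iff_aestronglyMeasurable.2 hf.aestronglyMeasurable
  · rw [← integrable_norm_rpow_iff hf.aestronglyMeasurable (by exact_mod_cast hp.ne')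
      (ENNReal.natCast_ne_top p)]
    simp only [ENNReal.toReal_natCast, Real.rpow_natCast]
    refine (h p hp).mono' (hf.norm.pow_const p).aestronglyMeasurable
      (Eventually.of_forall fun ω => ?_)
    rw [Real.norm_of_nonneg (by positivity)]
    exact pow_le_pow_left₀ (norm_nonneg _) (le_max_left _ _) p

theorem IsExpQuasiLocal.exists_le [IsProbabilityMeasure Pr] (h : IsExpQuasiLocal S Pr P ξ) :
    ∃ A δ c : ℝ, 0 < A ∧ 0 < δ ∧ 0 < c ∧ ∀ n : ℕ, 1 ≤ n → ∀ x ∈ ball S n 0, ∀ t : ℕ, 0 < t →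
      Pr.real {ω | ¬ stabRadius S ξ x (P ω ∩ ball S n 0) ≤ t} ≤
        A * Real.exp (-δ * (t : ℝ) ^ c) := by
  obtain ⟨A, φ, hA, hanti, -, hle, c, hc, hdec⟩ := h
  obtain ⟨A', δ, hA', hδ, hφ⟩ := hdec.exists_le_of_bound hc zero_le_one (B := φ 1) fun s hs =>
    hanti (Set.mem_Ioi.2 one_pos) (Set.mem_Ioi.2 (one_pos.trans_le hs)) hs
  refine ⟨A * A', δ, c, by positivity, hδ, hc, fun n hn x hx t ht => ?_⟩
  have ht' : (1 : ℝ) ≤ t := by exact_mod_cast ht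
  rw [mul_assoc]
  refine (measureReal_mono fun ω hω => ?_).trans ((hle t (by linarith) n (by exact_mod_cast hn) x
    hx).trans (mul_le_mul_of_nonneg_left (hφ t ht') hA.le))
  have h1 : (t : ℕ∞) ≤ stabRadius S ξ x (P ω ∩ ball S n 0) := (not_le.1 hω).le
  rw [Set.mem_ofPred_eq, ENNReal.ofReal_natCast, ← ENat.toENNReal_coe]
  exact ENat.toENNReal_le.2 h1

/-- Follows from `log m ≤ m`. Such a crude bound suffices because `m` will be polynomial in a level
that is a small power of the distance. -/
theorem exists_abs_le_exp_sq {C : ℕ → ℝ} {a : ℝ} (ha : a ≤ 1)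
    (hC : C =O[atTop] fun k : ℕ => (k : ℝ) ^ (a * k)) :
    ∃ K : ℝ, 0 < K ∧ ∀ m, |C m| ≤ K * Real.exp ((m : ℝ) ^ 2) := by
  obtain ⟨K, hK, h⟩ := bound_of_isBigO_nat_atTop hC
  refine ⟨K, hK, fun m => ?_⟩
  have hpos : 0 < (m : ℝ) ^ (a * m) := by
    rcases Nat.eq_zero_or_pos m with rfl | hm
    · simp
    · positivity
  refine (h hpos.ne').trans (mul_le_mul_of_nonneg_left ?_ hK.le)
  rw [Real.norm_of_nonneg hpos.le]
  rcases Nat.eq_zero_or_pos m with rfl | hm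
  · simp
  have hm1 : (1 : ℝ) ≤ m := by exact_mod_cast hm
  rw [Real.rpow_def_of_pos (by positivity), Real.exp_le_exp]
  have h1 : Real.log m ≤ m := (Real.log_le_sub_one_of_pos (by positivity)).trans (by linarith)
  have h2 : 0 ≤ Real.log m := Real.log_nonneg hm1
  nlinarith [mul_nonneg h2 (by positivity : (0 : ℝ) ≤ m), mul_le_mul_of_nonneg_left h1
    (by positivity : (0 : ℝ) ≤ m), mul_le_mul_of_nonneg_right ha
    (mul_nonneg h2 (by positivity : (0 : ℝ) ≤ m))]

/-- The variable `u` stands for the distance left after enlarging the points to balls; keeping half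
of `s` only changes the rate. -/
theorem IsExpClustering.exists_le (h : IsExpClustering S Pr P) :
    ∃ (φ : ℝ → ℝ) (C c : ℕ → ℝ) (A δ b : ℝ), IsClusteringWith S Pr P φ C c ∧
      0 < A ∧ 0 < δ ∧ 0 < b ∧ ∀ (m N : ℕ) (s u : ℝ), m ≤ N → 0 ≤ s → s / 2 ≤ u →
        |C m| * φ (c m * u) ≤ A * Real.exp ((N : ℝ) ^ 2) * Real.exp (-δ * s ^ b) := by
  obtain ⟨φ, C, c, hcl, ⟨c₀, hc₀, hc⟩, ⟨a, -, ha, hC⟩, b, hb, hdec⟩ := h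
  obtain ⟨K, hK, hCK⟩ := exists_abs_le_exp_sq ha.le hC
  obtain ⟨A, δ, hA, hδ, hφ⟩ := hdec.exists_le_of_bound hb le_rfl hcl.fastDecreasing.le_one
  refine ⟨φ, C, c, K * A, δ * (c₀ / 2) ^ b, b, hcl, by positivity, by positivity, hb,
    fun m N s u hmN hs hu => ?_⟩
  have h1 : c₀ / 2 * s ≤ c m * u :=
    (by ring : c₀ / 2 * s = c₀ * (s / 2)).trans_le
      (mul_le_mul (hc m) hu (by positivity) (hcl.c_pos m).le)
  have h0 : 0 ≤ c₀ / 2 * s := by positivity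
  have h2 : φ (c m * u) ≤ A * Real.exp (-(δ * (c₀ / 2) ^ b) * s ^ b) := by
    refine (hφ _ (h0.trans h1)).trans (mul_le_mul_of_nonneg_left (Real.exp_le_exp.2 ?_) hA.le)
    have := Real.rpow_le_rpow h0 h1 hb.le
    rw [Real.mul_rpow (by positivity) hs] at this
    nlinarith
  have h3 : |C m| ≤ K * Real.exp ((N : ℝ) ^ 2) := by
    refine (hCK m).trans (mul_le_mul_of_nonneg_left (Real.exp_le_exp.2 ?_) hK.le)
    exact pow_le_pow_left₀ (Nat.cast_nonneg _) (by exact_mod_cast hmN) 2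
  refine (mul_le_mul h3 h2 (hcl.fastDecreasing.nonneg (h0.trans h1)) (by positivity)).trans_eq ?_
  ring

theorem measurableSet_stabRadius_le (hS : IsGeneratingSet S) (hP : Measurable P) {t : ℕ}
    (ht : 0 < t) (x : V) (B : Set V) :
    MeasurableSet {ω | ¬ stabRadius S ξ x (P ω ∩ B) ≤ t} := by
  classical
  have h : Measurable fun μ : Set V => if stabRadius S ξ x μ ≤ t then (0 : ℝ) else 1 := by
    refine measurable_of_local (ballFinset hS t x) fun μ => ?_
    rw [coe_ballFinset]
    simp only [stabRadius_inter_le_iff hS ht]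
  have h' := (h.comp ((measurable_inter_const B).comp hP)) (measurableSet_singleton 1)
  convert h' using 1
  ext ω
  simp only [Set.mem_ofPred_eq, Set.mem_preimage, Function.comp_apply, Set.mem_singleton_iff]
  split_ifs with h <;> simp [h]

theorem measurable_truncScore (hS : IsGeneratingSet S) (hξ : IsScoreFunction ξ) {t : ℕ}
    (ht : 0 < t) (x : V) : Measurable (truncScore S ξ t x) := by
  refine measurable_of_local (ballFinset hS t x) fun μ => ?_
  rw [coe_ballFinset, truncScore_inter hS hξ ht]

theorem hasAllMoments_score [IsProbabilityMeasure Pr] (hξ : IsScoreFunction ξ) (hP : Measurable P)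
    (hmom : ∀ p : ℝ, 1 ≤ p → HasMomentCondition S Pr P ξ p) {n : ℕ} (hn : 1 ≤ n) {x : V}
    (hx : x ∈ ball S n 0) : HasAllMoments Pr fun ω => ξ x (P ω ∩ ball S n 0) := by
  refine hasAllMoments_of_integrable_max (measurable_score hξ hP x _) fun p hp => ?_
  obtain ⟨L, -, hL⟩ := (hmom p (by exact_mod_cast hp)).exists_integral_le hξ hP
  exact (hL n hn x hx).1

theorem abs_truncScore_le_abs (t : ℕ) (x : V) (μ : Set V) :
    |truncScore S ξ t x μ| ≤ |ξ x μ| := by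
  unfold truncScore
  split_ifs
  · rfl
  · simp

/-- At distance `s > 16` the scores are truncated at the level given by `exists_truncation_level`.
The covariance of the truncated scores is bounded as in the local case, and the truncation error by
the tail of the radius of stabilisation. -/
theorem hasClusteringMoments_of_quasiLocal [IsProbabilityMeasure Pr] (hS : IsGeneratingSet S)
    (hξ : IsScoreFunction ξ) (hG : HasPolynomialGrowth S) (hP : IsExpClustering S Pr P)
    (hql : IsExpQuasiLocal S Pr P ξ) (hgr : HasExpGrowth S ξ)
    (hmom : ∀ p : ℝ, 1 ≤ p → HasMomentCondition S Pr P ξ p) {k : ℕ} (hk : 0 < k) :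
    ∃ K ψ, 0 ≤ K ∧ IsSummableRate S ψ ∧ ∀ n : ℕ, 1 ≤ n →
      HasClusteringMoments S Pr (ballFinset hS n 0) (centredScore S Pr P ξ n) k K ψ := by
  obtain ⟨G, d, hG1, hvol⟩ := hG.exists_le
  obtain ⟨a, q, ha, hgrow⟩ := hgr.exists_le
  obtain ⟨A₂, δ₂, c₂, hA₂, hδ₂, hc₂, hstab⟩ := hql.exists_le
  obtain ⟨φ, C, c, A₁, δ, b, hcl, hA₁, hδ, hb, hCφ⟩ := hP.exists_le
  have hPm := hcl.spinModel.measurable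
  obtain ⟨L, hL0, hL⟩ := (hmom (2 * k : ℕ) (by
    have : 1 ≤ 2 * k := by omega
    exact_mod_cast this)).exists_integral_le hξ hPm
  -- Centring costs at most `L`, which is at most `L * Z` since `Z ≥ 1`; the same factor dominates
  -- the truncated scores.
  set Λ : ℝ := 1 + L with hΛdef
  have hΛ : 1 ≤ Λ := by linarith
  obtain ⟨Q, hQ, hQle⟩ := exists_le_exp_pow (G := G) (a := a) (Λ := Λ) (by linarith) ha
    (by linarith) k d q
  obtain ⟨D, γ, β, hD, hγ, hβ, hlevel⟩ := exists_truncation_level (q := 2 * d + q + 1) (by omega)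
    hQ hb hδ hc₂ (half_pos hδ₂)
  set K : ℝ := Λ ^ k * (k * L) with hK
  have hK0 : 0 ≤ K := by positivity
  set Θ : ℝ := Λ ^ k * (k * (L + 1)) * (1 + 2 * K) with hΘ
  have hΘ0 : 0 ≤ Θ := by positivity
  refine ⟨K, fun s => (A₁ * Λ ^ k + Θ * √A₂) * D * Real.exp (-γ * (1 * max s 0) ^ β) +
    if s ≤ 16 then K + K * K + 1 else 0, hK0, isSummableRate_of_eventually hS
      (φ := fun s => Real.exp (-γ * s ^ β)) ?_ (fun s _ => (Real.exp_pos _).le)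
      (isSummableIn_exp hS hG hγ hβ) (by positivity) (by nlinarith) one_pos (by norm_num),
    fun n hn x hx => ?_⟩
  · intro s hs u _ hsu
    rw [Real.exp_le_exp]
    have := Real.rpow_le_rpow (Set.mem_Ici.1 hs) hsu hβ.le
    nlinarith
  have hx' : ∀ i, x i ∈ ball S n 0 := fun i => by
    rw [← coe_ballFinset hS]; exact hx i
  set Z : V → Ω → ℝ := fun y ω => max |ξ y (P ω ∩ ball S n 0)| 1 with hZdef
  have hZ : ∀ i ω, 1 ≤ Z (x i) ω := fun i ω => le_max_right _ _
  have hint := fun i => (hL n hn (x i) (hx' i)).1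
  have hLi := fun i => (hL n hn (x i) (hx' i)).2
  set e : V → ℝ := fun y => ∫ ω', ξ y (P ω' ∩ ball S n 0) ∂Pr with he
  have heL : ∀ i, |e (x i)| ≤ L := fun i => by
    refine (norm_integral_le_of_norm_le (f := fun ω => ξ (x i) (P ω ∩ ball S n 0)) (hint i)
      (Eventually.of_forall fun ω => ?_)).trans (hLi i)
    exact (le_max_left _ 1).trans (le_self_pow₀ (hZ i ω) (by omega))
  have hdom : ∀ i ω (y : ℝ), |y| ≤ |ξ (x i) (P ω ∩ ball S n 0)| →
      |y - e (x i)| ≤ Λ * Z (x i) ω := by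
    intro i ω y hy
    refine (abs_sub _ _).trans ?_
    have h1 : |y| ≤ Z (x i) ω := hy.trans (le_max_left _ _)
    have h2 := mul_le_mul_of_nonneg_left (hZ i ω) hL0
    rw [hΛdef]
    linarith [heL i]
  have hY : ∀ i ω, |centredScore S Pr P ξ n (x i) ω| ≤ Λ * Z (x i) ω := fun i ω =>
    hdom i ω _ le_rfl
  have hmY : ∀ i, HasAllMoments Pr (centredScore S Pr P ξ n (x i)) := fun i =>
    (hasAllMoments_score hξ hPm hmom hn (hx' i)).sub_const _
  have hKle := abs_mixedMoment_le_of_dominated hk hΛ hY hZ hint hLi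
  refine ⟨fun A => (HasAllMoments.prod A fun i _ => hmY i).integrable, hKle,
    fun s I _ hs hI A => ?_⟩
  simp only [one_mul, max_eq_left (Nat.cast_nonneg (α := ℝ) s)]
  have hexp0 := Real.exp_pos (-γ * (s : ℝ) ^ β)
  rcases le_or_gt s 16 with hs16 | hs16
  · have hs16' : (s : ℝ) ≤ 16 := by exact_mod_cast hs16
    rw [if_pos hs16']
    refine (abs_sub _ _).trans ?_
    rw [abs_mul]
    have h1 := mul_le_mul (hKle (A.filter (· ∈ I))) (hKle (A.filter (· ∉ I))) (abs_nonneg _) hK0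
    have h2 : 0 ≤ (A₁ * Λ ^ k + Θ * √A₂) * D * Real.exp (-γ * (s : ℝ) ^ β) := by positivity
    linarith [hKle A]
  have hs16' : ¬ (s : ℝ) ≤ 16 := by rw [not_le]; exact_mod_cast hs16
  rw [if_neg hs16', add_zero]
  obtain ⟨t, ht, hts, hlev1, hlev2⟩ := hlevel s hs16.le
  -- The truncated score is centred by the mean of the untruncated one, so that both variables agree
  -- off the exceptional event.
  set f : V → Set V → ℝ := fun y μ => truncScore S ξ t y (μ ∩ ball S n 0) - e y with hf
  have hfloc : ∀ i μ, f (x i) μ = f (x i) (μ ∩ ball S t (x i)) := by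
    intro i μ
    simp only [hf]
    rw [Set.inter_right_comm, truncScore_inter hS hξ ht]
  have hB1 : 1 ≤ Real.exp (a * (t : ℝ) ^ q) := Real.one_le_exp (by positivity)
  have hfB : ∀ i μ, |f (x i) μ| ≤ Λ * Real.exp (a * (t : ℝ) ^ q) := by
    intro i μ
    have h1 := abs_truncScore_le hS hξ ht (Real.exp_pos _).le (hgrow t ht) (x i) (μ ∩ ball S n 0)
    have h2 := mul_le_mul_of_nonneg_left hB1 hL0
    refine (abs_sub _ _).trans ?_
    rw [hΛdef]
    linarith [heL i]
  have hmf : ∀ i, HasAllMoments Pr fun ω => f (x i) (P ω) := fun i => by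
    refine hasAllMoments_of_bound ?_ fun ω => hfB i (P ω)
    exact (((measurable_truncScore hS hξ ht (x i)).comp
      ((measurable_inter_const _).comp hPm)).sub_const _).aestronglyMeasurable
  -- The square root of the tail bound for the radius, whence the halved rate passed to
  -- `exists_truncation_level`.
  set ρ : ℝ := √A₂ * Real.exp (-(δ₂ / 2) * (t : ℝ) ^ c₂) with hρ
  have hρ0 : 0 < ρ := by positivity
  have hρ2 : ρ ^ 2 = A₂ * Real.exp (-δ₂ * (t : ℝ) ^ c₂) := by
    rw [hρ, mul_pow, Real.sq_sqrt hA₂.le, ← Real.exp_nat_mul]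
    congr 2
    push_cast
    ring
  have htr := abs_mixedMoment_sub_mul_le_of_truncation hk (Y := centredScore S Pr P ξ n)
    (Y' := fun y ω => f y (P ω)) (E := fun y => {ω | ¬ stabRadius S ξ y (P ω ∩ ball S n 0) ≤ t})
    hΛ hρ0 hmY hmf hY (fun i ω => hdom i ω _ (abs_truncScore_le_abs t (x i) _)) hZ hint hLi
    (fun i => measurableSet_stabRadius_le hS hPm ht (x i) _) (fun i ω hω => by
      rw [Set.mem_ofPred_eq, not_not] at hω
      simp only [hf, centredScore, truncScore, if_pos hω, he])
    (fun i => (hstab n hn (x i) (hx' i) t ht).trans_eq hρ2.symm) A (A.filter (· ∈ I))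
    (A.filter (· ∉ I))
  have hloc := hcl.abs_mixedMoment_sub_le hS hfloc (one_le_mul_of_one_le_of_one_le hΛ hB1) hfB
    (by omega : 2 * t < s) I hI
    (ε := A₁ * Real.exp (((k * vol S t : ℕ) : ℝ) ^ 2) * Real.exp (-δ * (s : ℝ) ^ b))
    (by positivity) (fun m hm => hCφ m _ s _ hm (Nat.cast_nonneg _) (by
      rw [Nat.cast_sub (by omega)]
      have : (4 * t : ℝ) ≤ s := by exact_mod_cast hts
      push_cast
      linarith)) A
  refine htr.trans ((add_le_add_left hloc _).trans ?_)
  have h1 : 3 ^ (k * vol S t) * (Λ * Real.exp (a * (t : ℝ) ^ q)) ^ k *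
      (A₁ * Real.exp (((k * vol S t : ℕ) : ℝ) ^ 2) * Real.exp (-δ * (s : ℝ) ^ b)) ≤
      A₁ * Λ ^ k * (D * Real.exp (-γ * (s : ℝ) ^ β)) := by
    calc _ = A₁ * (3 ^ (k * vol S t) * (Λ * Real.exp (a * (t : ℝ) ^ q)) ^ k *
          Real.exp (((k * vol S t : ℕ) : ℝ) ^ 2)) * Real.exp (-δ * (s : ℝ) ^ b) := by ring
      _ ≤ A₁ * (Λ ^ k * Real.exp (Q * (t : ℝ) ^ (2 * d + q + 1))) *
          Real.exp (-δ * (s : ℝ) ^ b) :=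
        mul_le_mul_of_nonneg_right (mul_le_mul_of_nonneg_left (hQle t _ ht (hvol t ht)) hA₁.le)
          (Real.exp_pos _).le
      _ = A₁ * Λ ^ k * Real.exp (Q * (t : ℝ) ^ (2 * d + q + 1) - δ * (s : ℝ) ^ b) := by
        rw [sub_eq_add_neg, Real.exp_add]; ring_nf
      _ ≤ _ := mul_le_mul_of_nonneg_left hlev1 (by positivity)
  have h2 : Θ * ρ ≤ Θ * √A₂ * (D * Real.exp (-γ * (s : ℝ) ^ β)) := by
    rw [hρ, ← mul_assoc]
    exact mul_le_mul_of_nonneg_left hlev2 (by positivity)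
  refine (add_le_add h1 h2).trans_eq ?_
  ring

end

end SpinCLT

end

/-! ### The central limit theorem in the two cases -/

theorem mainTheorem1 {V : Type*} [AddGroup V] [Countable V] [Infinite V]
    (S : Finset V) (hS : SpinCLT.IsGeneratingSet S)
    {Ω : Type*} [MeasurableSpace Ω] (Pr : Measure Ω) [IsProbabilityMeasure Pr]
    (P : Ω → Set V) (ξ : V → Set V → ℝ) (hξ : SpinCLT.IsScoreFunction ξ)
    (h : (SpinCLT.IsBAmenable S ∧
          SpinCLT.IsSummablyClustering S Pr P ∧
          SpinCLT.IsLocal S ξ) ∨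
         (SpinCLT.HasPolynomialGrowth S ∧
          SpinCLT.IsExpClustering S Pr P ∧
          SpinCLT.IsExpQuasiLocal S Pr P ξ ∧
          SpinCLT.HasExpGrowth S ξ ∧
          ∀ p : ℝ, 1 ≤ p → SpinCLT.HasMomentCondition S Pr P ξ p))
    (ν : ℝ) (hν : 0 < ν)
    (hvar : (fun n : ℕ => (SpinCLT.vol S n : ℝ) ^ ν) =O[atTop]
      fun n : ℕ => Var[fun ω => SpinCLT.totalMass S ξ n (P ω); Pr]) :
    TendstoInDistribution
      (fun (n : ℕ) (ω : Ω) =>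
        (SpinCLT.totalMass S ξ n (P ω) - ∫ ω', SpinCLT.totalMass S ξ n (P ω') ∂Pr) /
          √(Var[fun ω' => SpinCLT.totalMass S ξ n (P ω'); Pr]))
      atTop (id : ℝ → ℝ) (fun _ => Pr) (gaussianReal 0 1) := by
  rcases h with ⟨-, hP, hloc⟩ | ⟨hG, hP, hql, hgr, hmom⟩
  · have hPm : Measurable P := by
      obtain ⟨φ, C, c, hcl, -⟩ := hP
      exact hcl.spinModel.measurable
    obtain ⟨r, B, -, hB⟩ := SpinCLT.exists_local_score hS hξ hloc
    refine SpinCLT.tendstoInDistribution_totalMass hS hξ hPm (Eventually.of_forall fun n x _ =>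
      SpinCLT.hasAllMoments_of_bound (SpinCLT.measurable_score hξ hPm x _).aestronglyMeasurable
        fun ω => (hB x _).2) (fun p _ => ?_) ν hν hvar
    obtain ⟨K, ψ, hK, hψ, h⟩ := SpinCLT.hasClusteringMoments_of_local hS hξ hP hloc (p + 1)
    exact ⟨K, ψ, hK, hψ, Eventually.of_forall h⟩
  · have hPm : Measurable P := by
      obtain ⟨φ, C, c, hcl, -⟩ := hP
      exact hcl.spinModel.measurable
    refine SpinCLT.tendstoInDistribution_totalMass hS hξ hPm ?_ (fun p _ => ?_) ν hν hvar
    -- The moment and stabilisation bounds are available only for windows of radius at least one.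
    · filter_upwards [eventually_ge_atTop 1] with n hn x hx
      rw [← Finset.mem_coe, SpinCLT.coe_ballFinset] at hx
      exact SpinCLT.hasAllMoments_score hξ hPm hmom hn hx
    · obtain ⟨K, ψ, hK, hψ, h⟩ := SpinCLT.hasClusteringMoments_of_quasiLocal hS hξ hG hP hql hgr
        hmom p.succ_pos
      exact ⟨K, ψ, hK, hψ, (eventually_ge_atTop 1).mono h⟩
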